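/- For $B\in\mathbb R^{n\times n}$ write $\mathcal W(B)=\{x^HBx:\ x\in\mathbb C^n,\ \|x\|_2=1\}$ for its numerical range, $\mathbb C^-=\{z\in\mathbb C:\Re z<0\}$, $\|B\|_2$ for the spectral norm and $\kappa(B)=\|B\|_2\|B^{-1}\|_2$. Let $\mathrm{Off}(B)$ be the set of the blocks $B(s+1:n,\,1:s)$ and $B(1:s,\,s+1:n)$, $s=1,\dots,n-1$; $B$ is quasiseparable of order $r$ if $\max_{M\in\mathrm{Off}(B)}\mathrm{rank}(M)=r$ (with $r=0$ if $n\le 1$). For a matrix $M$ let $\sigma_1(M)\ge\sigma_2(M)\ge\cdots$ be its singular values, with $\sigma_i(M)=0$ for $i$ larger than the size of $M$. For compact $S,T\subset\mathbb C$ let $$Z_h(S,T)=\inf_{g}\ \frac{\max_{z\in S}|g(z)|}{\min_{z\in T}|g(z)|},$$ the infimum being over the rational functions $g$ with numerator and denominator of degree at most $h$, without poles in $S$ and without zeros in $T$ (where $|g|=\infty$ at a pole). Let $A,F,Q\in\mathbb R^{n\times n}$ be quasiseparable of orders $r_a,r_f,r_q$, respectively, with $\mathcal W(A)\subset\mathbb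 C^-$, $F$ symmetric positive definite and $Q$ symmetric positive semidefinite, and let $X\in\mathbb R^{n\times n}$ be the symmetric positive semidefinite (stabilizing) solution of the Riccati equation $A^\top X+XA-XFX+Q=0$. Let $F=LL^\top$ be the Cholesky factorization of $F$ ($L$ lower triangular with positive diagonal), and assume $\mathcal W(L^{-1}AL)\subset\mathbb C^-$. Then the singular values of every $M\in\mathrm{Off}(X)$ satisfy $$\frac{\sigma_{ht+r_f+1}(M)}{\|X\|_2}\ \le\ \kappa(F)\,(1+\sqrt2)^2\,Z_h(E,-E),\qquad h=1,2,\dots,$$ where $$t=4r_a+6r_f+2r_q,\qquad E=\mathcal W(L^{-1}AL)+\Big[-\tau-\sqrt{\tau^2+\|F\|_2\|Q\|_2},\ 0\Big],\qquad \tau=\big|\min\big(\mathcal W(L^{-1}AL)\cap\mathbb R\big)\big|.$$ If $X=0$, the left-hand side is read as $0$. -/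

import Mathlib

open scoped Matrix Matrix.Norms.L2Operator Pointwise ENNReal

noncomputable section

namespace QSRiccati

/-- The numerical range `{xᴴ B x : x ∈ ℂⁿ, ‖x‖₂ = 1}` of a complex matrix `B`. -/
def numericalRange {n : ℕ} (B : Matrix (Fin n) (Fin n) ℂ) : Set ℂ :=
  {z | ∃ x : EuclideanSpace ℂ (Fin n), ‖x‖ = 1 ∧ z = star x.ofLp ⬝ᵥ (B *ᵥ x.ofLp)}

/-- The numerical range of a real matrix, with complex test vectors. -/
def realNumericalRange {n : ℕ} (A : Matrix (Fin n) (Fin n) ℝ) : Set ℂ :=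
  numericalRange (A.map Complex.ofReal)

/-- The block `M(s+1:n, 1:s)` (one-based indices) of an `n × n` matrix `M`. -/
def lowerBlock {n : ℕ} (M : Matrix (Fin n) (Fin n) ℝ) (s : ℕ) :
    Matrix {i : Fin n // s ≤ (i : ℕ)} {j : Fin n // (j : ℕ) < s} ℝ :=
  M.toBlock (fun i => s ≤ (i : ℕ)) (fun j => (j : ℕ) < s)

/-- The block `M(1:s, s+1:n)` (one-based indices) of an `n × n` matrix `M`. -/
def upperBlock {n : ℕ} (M : Matrix (Fin n) (Fin n) ℝ) (s : ℕ) :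
    Matrix {i : Fin n // (i : ℕ) < s} {j : Fin n // s ≤ (j : ℕ)} ℝ :=
  M.toBlock (fun i => (i : ℕ) < s) (fun j => s ≤ (j : ℕ))

/-- The quasiseparable order: the maximal rank of the off-diagonal blocks `M(s+1:n, 1:s)` and
`M(1:s, s+1:n)`, `s = 1, …, n - 1`. -/
def qsrank {n : ℕ} (M : Matrix (Fin n) (Fin n) ℝ) : ℕ :=
  (Finset.Ico 1 n).sup fun s => max (lowerBlock M s).rank (upperBlock M s).rank

/-- The `i`-th largest singular value `σ_i(M)`, for `i = 1, 2, …`, of a rectangular real matrix;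
it is `0` when `i` exceeds the size of the matrix. (Mathlib's singular values are indexed
from `0`.) -/
def sigma {m k : Type*} [Fintype m] [Fintype k] [DecidableEq k] (i : ℕ) (M : Matrix m k ℝ) : ℝ :=
  (Matrix.toEuclideanLin M).singularValues (i - 1)

/-- The spectral condition number `κ(F) = ‖F‖₂ ‖F⁻¹‖₂` of an invertible matrix. -/
def cond {n : ℕ} (F : Matrix (Fin n) (Fin n) ℝ) : ℝ := ‖F‖ * ‖F⁻¹‖

/-- `L` is the Cholesky factor of `F`: lower triangular, with positive diagonal, `L Lᵀ = F`. -/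
structure IsCholeskyFactor {n : ℕ} (L F : Matrix (Fin n) (Fin n) ℝ) : Prop where
  lower : ∀ i j, i < j → L i j = 0
  diag_pos : ∀ i, 0 < L i i
  mul_transpose : L * Lᵀ = F

/-- The modulus `|g(z)| ∈ [0, ∞]` of `g = p / q`, with value `∞` at a pole (a zero of `q` that is
not a zero of `p`). -/
def ratModulus (p q : Polynomial ℂ) (z : ℂ) : ℝ≥0∞ := ‖p.eval z‖ₑ / ‖q.eval z‖ₑ

/-- The ratio `(max_{z ∈ E} |g(z)|) / (min_{z ∈ F} |g(z)|)` for `g = p / q`. -/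
def zolotarevRatio (p q : Polynomial ℂ) (E F : Set ℂ) : ℝ≥0∞ :=
  (⨆ z ∈ E, ratModulus p q z) / (⨅ z ∈ F, ratModulus p q z)

/-- The Zolotarev number `Z_h(E, F)` of compact sets `E`, `F`, with values in `[0, ∞]`: the optimal
ratio over the rational functions `g = p / q` with numerator and denominator of degree at most `h`.
It is enough to consider `g` without poles in `E` and without zeros in `F`; this is where, for
compact sets, the maximum over `E` is finite and the minimum over `F` is nonzero. -/
def zolotarevENN (h : ℕ) (E F : Set ℂ) : ℝ≥0∞ :=
  ⨅ (p : Polynomial ℂ) (q : Polynomial ℂ) (_ : p.natDegree ≤ h ∧ q.natDegree ≤ h ∧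
    (∀ z ∈ E, q.eval z ≠ 0) ∧ (∀ z ∈ F, p.eval z ≠ 0)), zolotarevRatio p q E F

/-- The Zolotarev number is at most `1`, as the competitor `g = 1` shows. -/
theorem zolotarevENN_le_one (h : ℕ) (E F : Set ℂ) : zolotarevENN h E F ≤ 1 := by
  refine (iInf₂_le (1 : Polynomial ℂ) (1 : Polynomial ℂ)).trans
    ((iInf_le _ ⟨by simp, by simp, by simp, by simp⟩).trans ?_)
  refine ENNReal.div_le_of_le_mul ?_
  rw [one_mul]
  refine (iSup₂_le fun z _ => ?_ : _ ≤ (1 : ℝ≥0∞)).trans (le_iInf₂ fun z _ => ?_)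
  all_goals simp [ratModulus]

/-- The Zolotarev number `Z_h(E, F)` as a real number; it is finite by `zolotarevENN_le_one`. -/
def zolotarev (h : ℕ) (E F : Set ℂ) : ℝ := (zolotarevENN h E F).toReal

/-- `|min (W(B) ∩ ℝ)|` for a real matrix `B`. -/
def tau {n : ℕ} (B : Matrix (Fin n) (Fin n) ℝ) : ℝ :=
  |sInf {x : ℝ | (x : ℂ) ∈ realNumericalRange B}|

/-- The set `W(L⁻¹ A L) + [-τ - √(τ² + ‖F‖₂ ‖Q‖₂), 0]` with `τ = |min (W(L⁻¹ A L) ∩ ℝ)|`. -/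
def setE {n : ℕ} (A F Q L : Matrix (Fin n) (Fin n) ℝ) : Set ℂ :=
  realNumericalRange (L⁻¹ * A * L) +
    Complex.ofReal '' Set.Icc
      (-tau (L⁻¹ * A * L) - Real.sqrt (tau (L⁻¹ * A * L) ^ 2 + ‖F‖ * ‖Q‖)) 0

end QSRiccati

end

/-!
The Cholesky congruence `X ↦ Lᵀ X L` turns the equation into a Riccati equation with identity
quadratic term. Its off-diagonal block `Y` solves a Sylvester equation `B Y - Y C = G`, where `Bᵀ`
and `-C` are compressions of the closed-loop matrix and `G` has small rank. The closed-loop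
numerical range lies in `E`, because the largest eigenvalue of `Lᵀ X L` is bounded by a scalar
quadratic inequality.

If `g = p / q` is rational of degree at most `h`, then `Y - g(B) Y g(C)⁻¹` has rank at most
`h * rank G`, and the Crouzeix–Palencia theorem, applied on `E` to `g` and on `-E` to `1 / g`, gives
`‖g(B)‖ ‖g(C)⁻¹‖ ≤ (1 + √2)² max_E |g| / min_{-E} |g|`. Undoing the congruence costs the rank of one
block of `F` and the factor `κ(F)`.

The Crouzeix–Palencia theorem is proved without parametrizing a boundary curve: a smooth cutoff `χ`
plays the role of the domain, and contour integrals become area integrals against `∂χ/∂z̄`.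
-/

noncomputable section

namespace QSRiccati

open MeasureTheory Metric Filter Topology ComplexConjugate Polynomial

section CauchyRiemann

/-- Twice the Cauchy–Riemann operator `∂/∂z̄`, applied to a real function; as a vector of the plane
it is the gradient. -/
def dbar (χ : ℂ → ℝ) (z : ℂ) : ℂ := fderiv ℝ χ z 1 + Complex.I * fderiv ℝ χ z Complex.I

theorem inner_dbar (χ : ℂ → ℝ) (z w : ℂ) : inner ℝ (dbar χ z) w = fderiv ℝ χ z w := by
  have hw : w = w.re • (1 : ℂ) + w.im • Complex.I := by simp [Complex.re_add_im]
  conv_rhs => rw [hw, map_add, map_smul, map_smul]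
  simp [dbar, Complex.inner]

theorem dbar_sub {χ₁ χ₂ : ℂ → ℝ} {z : ℂ} (h₁ : DifferentiableAt ℝ χ₁ z)
    (h₂ : DifferentiableAt ℝ χ₂ z) : dbar (χ₁ - χ₂) z = dbar χ₁ z - dbar χ₂ z := by
  simp only [dbar, fderiv_sub h₁ h₂, _root_.sub_apply, Complex.ofReal_sub]
  ring

variable {χ : ℂ → ℝ}

theorem continuous_dbar (hχ : ContDiff ℝ 1 χ) : Continuous (dbar χ) := by
  have := hχ.continuous_fderiv one_ne_zero
  unfold dbar
  fun_prop

theorem dbar_eq_zero_of_eventuallyEq {z : ℂ} {c : ℝ} (h : χ =ᶠ[𝓝 z] fun _ => c) :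
    dbar χ z = 0 := by
  simp [dbar, h.fderiv_eq]

theorem tsupport_dbar_subset (χ : ℂ → ℝ) : tsupport (dbar χ) ⊆ tsupport χ := by
  refine closure_minimal (fun z hz => ?_) (isClosed_tsupport χ)
  by_contra h
  exact hz (dbar_eq_zero_of_eventuallyEq (c := 0) (notMem_tsupport_iff_eventuallyEq.1 h))

theorem tsupport_dbar_subset_compl {S : Set ℂ} (hS : ∀ z ∈ S, χ =ᶠ[𝓝 z] fun _ => 1) :
    tsupport (dbar χ) ⊆ Sᶜ := by
  intro z hz hzS
  refine (notMem_tsupport_iff_eventuallyEq.2 ?_) hz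
  filter_upwards [(hS z hzS).eventuallyEq_nhds] with w hw
  exact dbar_eq_zero_of_eventuallyEq hw

theorem hasCompactSupport_dbar (hs : HasCompactSupport χ) : HasCompactSupport (dbar χ) :=
  hs.of_isClosed_subset (isClosed_tsupport _) (tsupport_dbar_subset χ)

variable {B : Type*} [NormedAddCommGroup B]

theorem integrable_smul_of_continuousOn {𝕜 : Type*} [NormedField 𝕜] [NormedSpace 𝕜 B] {c : ℂ → 𝕜}
    (hc : Continuous c) (hcs : HasCompactSupport c) {G : ℂ → B} (hG : ContinuousOn G (tsupport c)) :
    Integrable (fun z => c z • G z) :=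
  (integrableOn_iff_integrable_of_support_subset
    ((Function.support_smul_subset_left c G).trans (subset_tsupport c))).1
    ((hc.continuousOn.smul hG).integrableOn_compact hcs)

theorem integral_fderiv_apply_eq_zero [NormedSpace ℝ B] {G : ℂ → B} (hG : ContDiff ℝ 1 G)
    (hGs : HasCompactSupport G) (v : ℂ) : ∫ z, fderiv ℝ G z v = 0 := by
  have h := integral_smul_fderiv_eq_neg_fderiv_smul_of_integrable (μ := volume) (𝕜 := ℝ)
    (f := fun _ => 1) (g := G) (v := v) (by simp)
    (by simpa using (((hG.continuous_fderiv one_ne_zero).clm_apply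
      continuous_const).integrable_of_hasCompactSupport (hGs.fderiv_apply ℝ v)))
    (by simpa using hG.continuous.integrable_of_hasCompactSupport hGs)
    (fun _ _ => differentiableAt_const _) fun z _ => hG.differentiable one_ne_zero z
  simpa using h

/-- Green's formula for a holomorphic function against the gradient of a cutoff. -/
theorem integral_dbar_smul_eq_zero [NormedSpace ℂ B] [CompleteSpace B] (hχ : ContDiff ℝ 1 χ)
    (hχs : HasCompactSupport χ) {U : Set ℂ} (hU : IsOpen U) (hχU : tsupport χ ⊆ U) {R : ℂ → B}
    (hR : DifferentiableOn ℂ R U) : ∫ z, dbar χ z • R z = 0 := by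
  set G : ℂ → B := fun z => χ z • R z
  have hGs : HasCompactSupport G := hχs.smul_right
  have hGC : ContDiff ℝ 1 G := contDiff_of_contDiffOn_union_of_isOpen (s := U) (t := (tsupport χ)ᶜ)
    (hχ.contDiffOn.smul ((hR.contDiffOn hU).restrict_scalars ℝ))
    (contDiffOn_const (c := (0 : B)) |>.congr fun z hz => by
      simp [G, image_eq_zero_of_notMem_tsupport hz])
    (Set.eq_univ_of_forall fun z => (em (z ∈ tsupport χ)).imp (@hχU z) id)
    hU (isClosed_tsupport χ).isOpen_compl
  have hGv (v : ℂ) : Integrable fun z => fderiv ℝ G z v :=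
    ((hGC.continuous_fderiv one_ne_zero).clm_apply
      continuous_const).integrable_of_hasCompactSupport (hGs.fderiv_apply ℝ v)
  have key (z : ℂ) :
      dbar χ z • R z = fderiv ℝ G z 1 + Complex.I • fderiv ℝ G z Complex.I := by
    by_cases hz : z ∈ tsupport χ
    · have hRz := hR.differentiableAt (hU.mem_nhds (hχU hz))
      have hfd (v : ℂ) : fderiv ℝ G z v = χ z • v • deriv R z + fderiv ℝ χ z v • R z := by
        simp only [G, fderiv_fun_smul (hχ.differentiable one_ne_zero z)
          (hRz.restrictScalars ℝ), hRz.fderiv_restrictScalars ℝ]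
        simp
      rw [hfd, hfd, dbar, smul_add, smul_comm Complex.I (χ z), smul_smul Complex.I Complex.I,
        Complex.I_mul_I, add_smul, mul_smul]
      simp only [one_smul, neg_smul, smul_neg, Complex.coe_smul]
      abel
    · have hG0 : G =ᶠ[𝓝 z] fun _ => 0 := by
        filter_upwards [notMem_tsupport_iff_eventuallyEq.1 hz] with w hw
        simp [G, hw]
      simp [hG0.fderiv_eq,
        dbar_eq_zero_of_eventuallyEq (c := 0) (notMem_tsupport_iff_eventuallyEq.1 hz)]
  simp_rw [key]
  rw [integral_add (hGv 1) (by exact (hGv Complex.I).smul Complex.I), integral_smul,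
    integral_fderiv_apply_eq_zero hGC hGs, integral_fderiv_apply_eq_zero hGC hGs]
  simp

end CauchyRiemann

section Cutoff

/-- A cutoff of the set `D` of thickness `R`: equal to `1` near `D`, vanishing beyond distance `R`,
and decreasing in the directions that point away from `D`. -/
structure IsCutoff (D : Set ℂ) (R : ℝ) (χ : ℂ → ℝ) : Prop where
  contDiff : ContDiff ℝ 1 χ
  eventually_one : ∀ z ∈ D, χ =ᶠ[𝓝 z] fun _ => 1
  tsupport_subset : tsupport χ ⊆ cthickening R D
  le_one : ∀ z, χ z ≤ 1
  inner_dbar_nonpos : ∀ z, ∀ v ∈ D, inner ℝ (dbar χ z) (z - v) ≤ 0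

variable {D : Set ℂ} {R : ℝ} {χ : ℂ → ℝ}

theorem IsCutoff.hasCompactSupport (h : IsCutoff D R χ) (hD : IsCompact D) :
    HasCompactSupport χ :=
  hD.cthickening.of_isClosed_subset (isClosed_tsupport χ) h.tsupport_subset

/-- The mollification of the indicator function of `S` by the bump function `φ`. -/
def mollifiedIndicator (φ : ContDiffBump (0 : ℂ)) (S : Set ℂ) : ℂ → ℝ :=
  convolution (φ.normed volume) (S.indicator 1) (ContinuousLinearMap.lsmul ℝ ℝ)

variable {φ : ContDiffBump (0 : ℂ)} {S : Set ℂ}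

theorem mollifiedIndicator_eq_of_forall_mem_ball {z : ℂ} {c : ℝ}
    (h : ∀ w ∈ ball z φ.rOut, S.indicator 1 w = c) : mollifiedIndicator φ S z = c := by
  have hz := h z (mem_ball_self φ.rOut_pos)
  rw [mollifiedIndicator, φ.normed_convolution_eq_right fun w hw => (h w hw).trans hz.symm, hz]

theorem contDiff_mollifiedIndicator (φ : ContDiffBump (0 : ℂ)) (hS : MeasurableSet S) :
    ContDiff ℝ 1 (mollifiedIndicator φ S) :=
  φ.hasCompactSupport_normed.contDiff_convolution_left (n := 1) _ φ.contDiff_normed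
    ((locallyIntegrable_const (1 : ℝ)).indicator hS)

theorem integrable_normed_smul_indicator (φ : ContDiffBump (0 : ℂ)) (hS : MeasurableSet S) (z : ℂ) :
    Integrable fun s => φ.normed volume s • S.indicator (1 : ℂ → ℝ) (z - s) :=
  φ.hasCompactSupport_normed.convolutionExists_left (ContinuousLinearMap.lsmul ℝ ℝ)
    φ.continuous_normed ((locallyIntegrable_const (1 : ℝ)).indicator hS) z

theorem mollifiedIndicator_le_of_forall {z w : ℂ} (hS : MeasurableSet S)
    (h : ∀ s ∈ ball 0 φ.rOut, w - s ∈ S → z - s ∈ S) :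
    mollifiedIndicator φ S w ≤ mollifiedIndicator φ S z := by
  refine integral_mono (integrable_normed_smul_indicator φ hS w)
    (integrable_normed_smul_indicator φ hS z) fun s => ?_
  by_cases hs : s ∈ ball (0 : ℂ) φ.rOut
  · refine mul_le_mul_of_nonneg_left ?_ (φ.nonneg_normed s)
    by_cases hw : w - s ∈ S
    · simp [hw, h s hs hw]
    · simp [hw, Set.indicator_nonneg]
  · have : φ.normed volume s = 0 := by
      rwa [← Function.notMem_support, φ.support_normed_eq]
    simp [this]

theorem mollifiedIndicator_le_one (hS : MeasurableSet S) (z : ℂ) :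
    mollifiedIndicator φ S z ≤ 1 := by
  rw [← φ.integral_normed (μ := volume)]
  refine integral_mono (integrable_normed_smul_indicator φ hS z) φ.integrable_normed fun s => ?_
  exact mul_le_of_le_one_right (φ.nonneg_normed s)
    (Set.indicator_le_self' (fun _ _ => zero_le_one) _)

theorem fderiv_nonpos_of_forall_segment_le {v z : ℂ} (hχ : DifferentiableAt ℝ χ z)
    (h : ∀ w, z ∈ segment ℝ v w → χ w ≤ χ z) : fderiv ℝ χ z (z - v) ≤ 0 := by
  refine IsLocalMaxOn.hasFDerivWithinAt_nonpos (s := segment ℝ z (z + (z - v))) ?_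
    hχ.hasFDerivAt.hasFDerivWithinAt (mem_posTangentConeAt_of_segment_subset subset_rfl)
  refine eventually_mem_nhdsWithin.mono fun w hw => h w ?_
  obtain ⟨t, ⟨ht, -⟩, rfl⟩ := (segment_eq_image' ℝ z (z + (z - v))).subset hw
  refine ⟨t / (1 + t), 1 / (1 + t), by positivity, by positivity, by field_simp; ring, ?_⟩
  have : (1 + t : ℂ) ≠ 0 := by exact_mod_cast (by positivity : (1 + t : ℝ) ≠ 0)
  simp only [Complex.real_smul, Complex.ofReal_div, Complex.ofReal_add, Complex.ofReal_one]
  field_simp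
  ring

theorem exists_isCutoff (hD : Convex ℝ D) (hR : 0 < R) : ∃ χ, IsCutoff D R χ := by
  set φ : ContDiffBump (0 : ℂ) := ⟨R / 8, R / 4, by positivity, by linarith⟩
  have hφ : φ.rOut = R / 4 := rfl
  set S := cthickening (R / 2) D
  have hSm : MeasurableSet S := isClosed_cthickening.measurableSet
  have hball {z : ℂ} (hz : z ∈ thickening (R / 4) D) : ball z φ.rOut ⊆ S := by
    obtain ⟨v, hv, hzv⟩ := mem_thickening_iff.1 hz
    exact fun w hw => thickening_subset_cthickening _ D (mem_thickening_iff.2 ⟨v, hv,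
      (dist_triangle w z v).trans_lt (by rw [mem_ball, hφ] at hw; linarith)⟩)
  have hD' {v : ℂ} (hv : v ∈ D) : v ∈ thickening (R / 4) D :=
    self_subset_thickening (by positivity) D hv
  have hcd := contDiff_mollifiedIndicator φ hSm
  refine ⟨mollifiedIndicator φ S, hcd, fun z hz => ?_, ?_, mollifiedIndicator_le_one hSm,
    fun z v hv => ?_⟩
  · filter_upwards [isOpen_thickening.mem_nhds (hD' hz)] with w hw
    exact mollifiedIndicator_eq_of_forall_mem_ball fun x hx => by simp [hball hw hx]
  · refine closure_minimal (fun z hz => ?_) isClosed_cthickening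
    by_contra hzR
    refine hz (mollifiedIndicator_eq_of_forall_mem_ball fun w hw => ?_)
    refine Set.indicator_of_notMem (fun hwS => hzR ?_) _
    have hz' : z ∈ cthickening (R / 4) S :=
      thickening_subset_cthickening _ _ (mem_thickening_iff.2 ⟨w, hwS, by
        rw [dist_comm]; exact hw⟩)
    exact cthickening_mono (by linarith) D
      (cthickening_cthickening_subset (by positivity) (by positivity) D hz')
  · rw [inner_dbar]
    refine fderiv_nonpos_of_forall_segment_le (hcd.differentiable one_ne_zero z) fun w hzw => ?_
    refine mollifiedIndicator_le_of_forall hSm fun s hs hws => ?_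
    have hvs : v - s ∈ S := hball (hD' hv) (by simpa [dist_eq_norm] using hs)
    refine (hD.cthickening _).segment_subset hvs hws ?_
    simpa [sub_eq_neg_add] using (mem_segment_translate ℝ (-s)).2 hzw

end Cutoff

section PolarCoordinates

variable {χ : ℂ → ℝ}

theorem hasCompactSupport_circleMap_radius (hs : HasCompactSupport χ) (z : ℂ) (θ : ℝ) :
    HasCompactSupport fun r => χ (circleMap z r θ) := by
  obtain ⟨C, hC⟩ := hs.isCompact.isBounded.subset_closedBall z
  refine HasCompactSupport.intro (isCompact_closedBall (0 : ℝ) C) fun r hr => ?_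
  refine image_eq_zero_of_notMem_tsupport fun hmem => hr ?_
  simpa [circleMap] using hC hmem

theorem deriv_circleMap_radius (hχ : ContDiff ℝ 1 χ) (z : ℂ) (r θ : ℝ) :
    deriv (fun r => χ (circleMap z r θ)) r
      = fderiv ℝ χ (circleMap z r θ) (Complex.exp (θ * Complex.I)) := by
  have h : HasDerivAt (fun r : ℝ => circleMap z r θ) (Complex.exp (θ * Complex.I)) r := by
    simpa [circleMap] using
      ((Complex.ofRealCLM.hasDerivAt (x := r)).mul_const (Complex.exp (θ * Complex.I))).const_add z
  exact ((hχ.differentiable one_ne_zero _).hasFDerivAt.comp_hasDerivAt r h).deriv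

theorem integrableOn_fderiv_circleMap (hχ : ContDiff ℝ 1 χ) (hs : HasCompactSupport χ) (z : ℂ)
    (ρ : ℝ) :
    IntegrableOn (fun p : ℝ × ℝ => fderiv ℝ χ (circleMap z p.1 p.2) (Complex.exp (p.2 * Complex.I)))
      (Set.Ioi ρ ×ˢ Set.Ioo (-Real.pi) Real.pi) := by
  obtain ⟨C, hC⟩ := hs.isCompact.isBounded.subset_closedBall z
  have := hχ.continuous_fderiv one_ne_zero
  have hcont : Continuous fun p : ℝ × ℝ =>
      fderiv ℝ χ (circleMap z p.1 p.2) (Complex.exp (p.2 * Complex.I)) := by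
    unfold circleMap
    fun_prop
  refine (hcont.continuousOn.integrableOn_compact
    (isCompact_Icc.prod isCompact_Icc : IsCompact (Set.Icc ρ C ×ˢ Set.Icc (-Real.pi) Real.pi))
    ).of_forall_sdiff_eq_zero (measurableSet_Ioi.prod measurableSet_Ioo) fun p hp => ?_
  have hp1 : C < p.1 := by
    by_contra! h
    exact hp.2 ⟨⟨hp.1.1.le, h⟩, Set.Ioo_subset_Icc_self hp.1.2⟩
  have hnot : circleMap z p.1 p.2 ∉ tsupport χ := fun hmem => by
    have : |p.1| ≤ C := by simpa [circleMap] using hC hmem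
    linarith [le_abs_self p.1]
  have h0 : fderiv ℝ χ (circleMap z p.1 p.2) = 0 :=
    image_eq_zero_of_notMem_tsupport fun h => hnot (tsupport_fderiv_subset ℝ h)
  simp [h0]

theorem mul_re_dbar_div {r : ℝ} (hr : r ≠ 0) (z : ℂ) (θ : ℝ) :
    r * (dbar χ z / (r * Complex.exp (θ * Complex.I))).re
      = fderiv ℝ χ z (Complex.exp (θ * Complex.I)) := by
  have hinv : (Complex.exp (θ * Complex.I))⁻¹ = conj (Complex.exp (θ * Complex.I)) := by
    rw [← Complex.exp_neg, ← Complex.exp_conj]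
    simp
  have hr' : (r : ℂ) ≠ 0 := by exact_mod_cast hr
  have e : r * (dbar χ z / (r * Complex.exp (θ * Complex.I)))
      = conj (conj (dbar χ z) * Complex.exp (θ * Complex.I)) := by
    rw [div_eq_mul_inv, mul_inv, hinv, map_mul, Complex.conj_conj]
    field_simp
  rw [← inner_dbar, ← Complex.re_ofReal_mul, e, Complex.conj_re, Complex.inner, mul_comm]

theorem setIntegral_re_dbar_div (hχ : ContDiff ℝ 1 χ) (hs : HasCompactSupport χ) (z : ℂ) {ρ : ℝ}
    (hρ : 0 ≤ ρ) : ∫ w in {w | ρ < ‖w‖}, (dbar χ (z + w) / w).re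
      = -∫ θ in Set.Ioo (-Real.pi) Real.pi, χ (circleMap z ρ θ) := by
  have hpt : ∀ p ∈ polarCoord.target, p.1 • Set.indicator {w | ρ < ‖w‖}
        (fun w => (dbar χ (z + w) / w).re) (Complex.polarCoord.symm p)
      = Set.indicator (Set.Ioi ρ ×ˢ Set.univ)
        (fun p : ℝ × ℝ => fderiv ℝ χ (circleMap z p.1 p.2) (Complex.exp (p.2 * Complex.I))) p := by
    rintro ⟨r, θ⟩ ⟨hr : 0 < r, -⟩
    have hsymm : Complex.polarCoord.symm (r, θ) = r * Complex.exp (θ * Complex.I) := by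
      simp [Complex.polarCoord_symm_apply, Complex.exp_mul_I]
    by_cases h : ρ < r
    · rw [Set.indicator_of_mem (by simpa [abs_of_pos hr] using h),
        Set.indicator_of_mem (by simpa using h), hsymm, smul_eq_mul, mul_re_dbar_div hr.ne',
        circleMap]
    · rw [Set.indicator_of_notMem (by simpa [abs_of_pos hr] using h),
        Set.indicator_of_notMem (by simpa using h), smul_zero]
  have hinteg := integrableOn_fderiv_circleMap hχ hs z ρ
  rw [IntegrableOn, Measure.volume_eq_prod, ← Measure.prod_restrict] at hinteg
  rw [← integral_indicator (measurableSet_lt measurable_const measurable_norm),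
    ← Complex.integral_comp_polarCoord_symm,
    setIntegral_congr_fun polarCoord.open_target.measurableSet hpt,
    setIntegral_indicator (measurableSet_Ioi.prod .univ), polarCoord_target, Set.prod_inter_prod,
    Set.inter_univ, Set.inter_eq_right.2 (Set.Ioi_subset_Ioi hρ), Measure.volume_eq_prod,
    ← Measure.prod_restrict, integral_prod_symm _ hinteg, ← integral_neg]
  congr with θ
  simp only [← deriv_circleMap_radius hχ]
  refine (hasCompactSupport_circleMap_radius hs z θ).integral_Ioi_deriv_eq ?_ ρ
  have hr : ContDiff ℝ 1 fun r : ℝ => circleMap z r θ :=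
    contDiff_const.add (Complex.ofRealCLM.contDiff.mul contDiff_const)
  exact hχ.comp hr

end PolarCoordinates

section RadialCutoff

/-- A cutoff of the disc of radius `ρ` that depends on `‖z‖` only. -/
def radialCutoff (ρ : ℝ) (z : ℂ) : ℝ := Real.smoothTransition (2 - ‖z‖ ^ 2 / ρ ^ 2)

/-- The real factor `m` in `dbar (radialCutoff ρ) z = m z * z`. -/
def radialDensity (ρ : ℝ) (z : ℂ) : ℝ :=
  -(2 / ρ ^ 2) * deriv Real.smoothTransition (2 - ‖z‖ ^ 2 / ρ ^ 2)

variable {ρ : ℝ} {z : ℂ}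

theorem contDiff_radialCutoff (ρ : ℝ) : ContDiff ℝ 1 (radialCutoff ρ) := by
  unfold radialCutoff
  have := contDiff_norm_sq ℝ (E := ℂ) (n := 1)
  exact Real.smoothTransition.contDiff.comp (by fun_prop)

theorem hasCompactSupport_radialCutoff (hρ : 0 < ρ) : HasCompactSupport (radialCutoff ρ) := by
  refine HasCompactSupport.intro (isCompact_closedBall (0 : ℂ) (2 * ρ)) fun z hz => ?_
  refine Real.smoothTransition.zero_of_nonpos ?_
  have hz' : 2 * ρ < ‖z‖ := by simpa using hz
  rw [sub_nonpos, le_div_iff₀ (by positivity)]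
  nlinarith

theorem radialCutoff_eq_one (hz : ‖z‖ ≤ ρ) : radialCutoff ρ z = 1 := by
  refine Real.smoothTransition.one_of_one_le ?_
  have : ‖z‖ ^ 2 / ρ ^ 2 ≤ 1 := div_le_one_of_le₀ (by gcongr) (by positivity)
  linarith

theorem dbar_radialCutoff (ρ : ℝ) (z : ℂ) :
    dbar (radialCutoff ρ) z = radialDensity ρ z * z := by
  have hd : HasDerivAt Real.smoothTransition (deriv Real.smoothTransition (2 - ‖z‖ ^ 2 / ρ ^ 2))
      (2 - ‖z‖ ^ 2 / ρ ^ 2) :=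
    ((Real.smoothTransition.contDiff (n := 1)).differentiable one_ne_zero _).hasDerivAt
  have h : fderiv ℝ (radialCutoff ρ) z = radialDensity ρ z • innerSL ℝ z := by
    refine (hd.comp_hasFDerivAt z
      (((hasStrictFDerivAt_norm_sq z).hasFDerivAt.mul_const (ρ ^ 2)⁻¹).const_sub 2)).fderiv.trans ?_
    ext w
    simp only [smul_neg, neg_apply, smul_apply, coe_innerSL_apply, Complex.inner, Complex.mul_re,
      Complex.conj_re, Complex.conj_im, mul_neg, sub_neg_eq_add, smul_add, nsmul_eq_mul,
      Nat.cast_ofNat, smul_eq_mul, radialDensity, neg_mul, neg_smul, neg_inj]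
    ring
  refine ext_inner_right ℝ fun w => ?_
  rw [inner_dbar, h, ← Complex.real_smul, real_inner_smul_left]
  simp

theorem radialDensity_nonpos (ρ : ℝ) (z : ℂ) : radialDensity ρ z ≤ 0 :=
  mul_nonpos_of_nonpos_of_nonneg (by simpa using by positivity)
    Real.smoothTransition.monotone.deriv_nonneg

theorem radialDensity_eq_zero (hz : ‖z‖ < ρ) : radialDensity ρ z = 0 := by
  have hlt : 1 < 2 - ‖z‖ ^ 2 / ρ ^ 2 := by
    have : ‖z‖ ^ 2 / ρ ^ 2 < 1 := by
      have := (norm_nonneg z).trans_lt hz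
      rw [div_lt_one (by positivity)]
      gcongr
    linarith
  have h : Real.smoothTransition =ᶠ[𝓝 (2 - ‖z‖ ^ 2 / ρ ^ 2)] fun _ => 1 := by
    filter_upwards [isOpen_Ioi.mem_nhds hlt] with w hw
    exact Real.smoothTransition.one_of_one_le (le_of_lt hw)
  simp [radialDensity, h.deriv_eq]

theorem integral_radialDensity (hρ : 0 < ρ) : ∫ z, radialDensity ρ z = -(2 * Real.pi) := by
  have h := setIntegral_re_dbar_div (contDiff_radialCutoff ρ) (hasCompactSupport_radialCutoff hρ) 0
    le_rfl
  have hpos : {w : ℂ | 0 < ‖w‖} = {0}ᶜ := by ext; simp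
  simp only [circleMap_zero_radius, Function.const_apply, setIntegral_const, zero_add,
    radialCutoff_eq_one (norm_zero.trans_le hρ.le), hpos] at h
  rw [← setIntegral_univ, ← setIntegral_congr_set
    (ae_eq_univ.2 (by simp) : ({0}ᶜ : Set ℂ) =ᵐ[volume] Set.univ)]
  refine (setIntegral_congr_fun (measurableSet_singleton 0).compl fun w hw => ?_).trans
    (h.trans ?_)
  · rw [dbar_radialCutoff, mul_div_cancel_right₀ _ hw, Complex.ofReal_re]
  · simp [two_mul, Real.pi_pos.le]

theorem integrable_radialDensity (hρ : 0 < ρ) : Integrable (radialDensity ρ) := by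
  by_contra h
  have := integral_radialDensity hρ
  rw [integral_undef h] at this
  linarith [Real.pi_pos]

end RadialCutoff

section Resolvent

variable {B : Type*} [NormedRing B] [NormedAlgebra ℂ B]

theorem sub_mul_resolvent {a : B} {z : ℂ} (hz : z ∉ spectrum ℂ a) :
    (algebraMap ℂ B z - a) * resolvent a z = 1 :=
  Ring.mul_inverse_cancel _ (spectrum.notMem_iff.1 hz)

theorem resolvent_mul_sub {a : B} {z : ℂ} (hz : z ∉ spectrum ℂ a) :
    resolvent a z * (algebraMap ℂ B z - a) = 1 :=
  Ring.inverse_mul_cancel _ (spectrum.notMem_iff.1 hz)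

variable [CompleteSpace B]

theorem differentiableOn_resolvent (a : B) : DifferentiableOn ℂ (resolvent a) (spectrum ℂ a)ᶜ :=
  fun z hz => (spectrum.hasDerivAt_resolvent_const_left (k := z)
    (by simpa [spectrum] using hz)).differentiableAt.differentiableWithinAt

theorem tendsto_smul_resolvent_cobounded (a : B) :
    Tendsto (fun z : ℂ => z • resolvent a z) (Bornology.cobounded ℂ) (𝓝 1) := by
  have h := ((spectrum.resolvent_tendsto_cobounded (𝕜 := ℂ) a).const_mul a).const_add 1
  rw [mul_zero, add_zero] at h
  refine h.congr' ?_
  filter_upwards [Bornology.isBounded_def.1 (spectrum.isBounded (𝕜 := ℂ) a)] with z hz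
  rw [← sub_mul_resolvent hz, sub_mul, sub_add_cancel, Algebra.smul_def]

theorem exists_norm_smul_resolvent_sub_one_le (a : B) {ε : ℝ} (hε : 0 < ε) : ∃ ρ : ℝ, 0 < ρ ∧
    ∀ z : ℂ, ρ ≤ ‖z‖ → z ∉ spectrum ℂ a ∧ ‖z • resolvent a z - 1‖ ≤ ε := by
  have h := (tendsto_smul_resolvent_cobounded a).eventually (closedBall_mem_nhds 1 hε)
  obtain ⟨s, -, hs⟩ := (hasBasis_cobounded_norm (E := ℂ)).mem_iff.1
    (h.and (Bornology.isBounded_def.1 (spectrum.isBounded (𝕜 := ℂ) a)))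
  refine ⟨max s 1, by positivity, fun z hz => ?_⟩
  obtain ⟨h1, h2⟩ := hs ((le_max_left s 1).trans hz)
  exact ⟨h2, by rwa [← dist_eq_norm]⟩

variable {χ : ℂ → ℝ}

theorem integrable_dbar_smul_resolvent (h : ContDiff ℝ 1 χ) (hs : HasCompactSupport χ) {a : B}
    (ha : ∀ z ∈ spectrum ℂ a, χ =ᶠ[𝓝 z] fun _ => 1) :
    Integrable fun z => dbar χ z • resolvent a z :=
  integrable_smul_of_continuousOn (continuous_dbar h) (hasCompactSupport_dbar hs)
    ((differentiableOn_resolvent a).continuousOn.mono (tsupport_dbar_subset_compl ha))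

theorem integral_dbar_smul_resolvent_congr {χ' : ℂ → ℝ} (h : ContDiff ℝ 1 χ)
    (h' : ContDiff ℝ 1 χ') (hs : HasCompactSupport χ) (hs' : HasCompactSupport χ') {a : B}
    (ha : ∀ z ∈ spectrum ℂ a, χ =ᶠ[𝓝 z] fun _ => 1)
    (ha' : ∀ z ∈ spectrum ℂ a, χ' =ᶠ[𝓝 z] fun _ => 1) :
    ∫ z, dbar χ z • resolvent a z = ∫ z, dbar χ' z • resolvent a z := by
  have h0 := integral_dbar_smul_eq_zero (h.sub h') (hs.sub hs') (spectrum.isClosed a).isOpen_compl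
    (fun z hz hza => by
      refine (notMem_tsupport_iff_eventuallyEq.2 ?_) hz
      filter_upwards [ha z hza, ha' z hza] with w hw hw'
      simp [hw, hw']) (differentiableOn_resolvent a)
  rw [← sub_eq_zero, ← integral_sub (integrable_dbar_smul_resolvent h hs ha)
    (integrable_dbar_smul_resolvent h' hs' ha'), ← h0]
  congr with z
  rw [← sub_smul]
  exact congrArg (· • resolvent a z) (dbar_sub (h.differentiable one_ne_zero z)
    (h'.differentiable one_ne_zero z)).symm

theorem norm_integral_dbar_radialCutoff_smul_resolvent_sub_le {a : B} {ρ ε : ℝ} (hρ : 0 < ρ)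
    (h : ∀ z : ℂ, ρ ≤ ‖z‖ → z ∉ spectrum ℂ a ∧ ‖z • resolvent a z - 1‖ ≤ ε)
    (hi : Integrable fun z => dbar (radialCutoff ρ) z • resolvent a z) :
    ‖(∫ z, dbar (radialCutoff ρ) z • resolvent a z) - (-(2 * Real.pi) : ℂ) • (1 : B)‖
      ≤ 2 * Real.pi * ε := by
  have hm := integrable_radialDensity hρ
  have hone : ∫ z, (radialDensity ρ z : ℂ) • (1 : B) = (-(2 * Real.pi) : ℂ) • (1 : B) := by
    rw [integral_smul_const, integral_complex_ofReal, integral_radialDensity hρ]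
    push_cast
    rfl
  rw [← hone, ← integral_sub hi (by exact hm.ofReal.smul_const _)]
  refine (norm_integral_le_of_norm_le (g := fun z => -radialDensity ρ z * ε)
    (hm.neg.mul_const ε) (Eventually.of_forall fun z => ?_)).trans_eq ?_
  · rw [dbar_radialCutoff, mul_smul, ← smul_sub, norm_smul, Complex.norm_real, Real.norm_eq_abs,
      abs_of_nonpos (radialDensity_nonpos ρ z)]
    rcases lt_or_ge ‖z‖ ρ with hz | hz
    · simp [radialDensity_eq_zero hz]
    · gcongr
      · linarith [radialDensity_nonpos ρ z]
      · exact (h z hz).2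
  · rw [integral_mul_const, integral_neg, integral_radialDensity hρ, neg_neg]

/-- Cauchy's integral formula for the unit, with the contour replaced by the gradient of a
cutoff. -/
theorem integral_dbar_smul_resolvent (h : ContDiff ℝ 1 χ) (hs : HasCompactSupport χ) {a : B}
    (ha : ∀ z ∈ spectrum ℂ a, χ =ᶠ[𝓝 z] fun _ => 1) :
    ∫ z, dbar χ z • resolvent a z = (-(2 * Real.pi) : ℂ) • (1 : B) := by
  refine eq_of_forall_dist_le fun ε hε => ?_
  obtain ⟨ρ, hρ, hρε⟩ := exists_norm_smul_resolvent_sub_one_le a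
    (show 0 < ε / (2 * Real.pi) by positivity)
  have ha' : ∀ z ∈ spectrum ℂ a, radialCutoff ρ =ᶠ[𝓝 z] fun _ => 1 := fun z hz => by
    have hzρ : ‖z‖ < ρ := by
      by_contra! hle
      exact (hρε z hle).1 hz
    filter_upwards [(isOpen_lt continuous_norm continuous_const).mem_nhds hzρ] with w hw
    exact radialCutoff_eq_one (le_of_lt hw)
  have hc := contDiff_radialCutoff ρ
  have hcs := hasCompactSupport_radialCutoff hρ
  rw [dist_eq_norm, integral_dbar_smul_resolvent_congr h hc hs hcs ha ha']
  refine (norm_integral_dbar_radialCutoff_smul_resolvent_sub_le hρ hρε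
    (integrable_dbar_smul_resolvent hc hcs ha')).trans_eq ?_
  field_simp

end Resolvent

section RationalCalculus

variable {B : Type*} [NormedRing B] [NormedAlgebra ℂ B]

/-- The value `p(a) q(a)⁻¹` of the rational function `p / q` at an element of a Banach algebra; it
is `0` if `q(a)` is not invertible. -/
def ratEval (p q : ℂ[X]) (a : B) : B := aeval a p * Ring.inverse (aeval a q)

theorem commute_aeval (a : B) (p q : ℂ[X]) : Commute (aeval a p) (aeval a q) := by
  rw [Commute, SemiconjBy, ← map_mul, ← map_mul, mul_comm]

theorem eq_ratEval_iff {a b : B} {p q : ℂ[X]} (hq : IsUnit (aeval a q)) :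
    b = ratEval p q a ↔ b * aeval a q = aeval a p :=
  Ring.eq_mul_inverse_iff_mul_eq _ _ _ hq

theorem ratEval_mul_ratEval {a : B} {p₁ q₁ p₂ q₂ : ℂ[X]} (h₁ : IsUnit (aeval a q₁))
    (h₂ : IsUnit (aeval a q₂)) :
    ratEval p₁ q₁ a * ratEval p₂ q₂ a = ratEval (p₁ * p₂) (q₁ * q₂) a := by
  rw [eq_ratEval_iff (by rw [map_mul]; exact h₁.mul h₂), mul_comm q₁, map_mul, map_mul, mul_assoc,
    ← mul_assoc (ratEval p₂ q₂ a), (eq_ratEval_iff h₂).1 rfl, (commute_aeval a p₂ q₁).eq,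
    ← mul_assoc, (eq_ratEval_iff h₁).1 rfl]

theorem ratEval_add_ratEval {a : B} {p₁ q₁ p₂ q₂ : ℂ[X]} (h₁ : IsUnit (aeval a q₁))
    (h₂ : IsUnit (aeval a q₂)) :
    ratEval p₁ q₁ a + ratEval p₂ q₂ a = ratEval (p₁ * q₂ + p₂ * q₁) (q₁ * q₂) a := by
  rw [eq_ratEval_iff (by rw [map_mul]; exact h₁.mul h₂), add_mul]
  nth_rewrite 2 [mul_comm q₁ q₂]
  rw [map_mul, map_mul, ← mul_assoc, ← mul_assoc, (eq_ratEval_iff h₁).1 rfl,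
    (eq_ratEval_iff h₂).1 rfl, map_add, map_mul, map_mul]

theorem resolvent_eq_ratEval (a : B) (z : ℂ) : resolvent a z = ratEval 1 (C z - X) a := by
  simp [ratEval, resolvent]

theorem map_ratEval {B' : Type*} [NormedRing B'] [NormedAlgebra ℂ B'] (θ : B →ₐ[ℂ] B') {a : B}
    {p q : ℂ[X]} (hq : IsUnit (aeval a q)) : θ (ratEval p q a) = ratEval p q (θ a) := by
  have h : IsUnit (aeval (θ a) q) := by
    rw [aeval_algHom_apply]
    exact hq.map θ
  rw [eq_ratEval_iff h, aeval_algHom_apply, aeval_algHom_apply, ← map_mul,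
    (eq_ratEval_iff hq).1 rfl]

theorem map_resolvent {B' : Type*} [NormedRing B'] [NormedAlgebra ℂ B'] (θ : B →ₐ[ℂ] B') {a : B}
    {z : ℂ} (hz : z ∉ spectrum ℂ a) : θ (resolvent a z) = resolvent (θ a) z := by
  rw [resolvent_eq_ratEval, resolvent_eq_ratEval, map_ratEval]
  simpa using spectrum.notMem_iff.1 hz

theorem ratEval_complex (p q : ℂ[X]) (z : ℂ) : ratEval p q z = p.eval z / q.eval z := by
  simp [ratEval, coe_aeval_eq_eval, div_eq_mul_inv]

theorem exists_differentiable_eval_sub_aeval_eq (a : B) (p : ℂ[X]) :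
    ∃ P : ℂ → B, Differentiable ℂ P ∧
      ∀ z, algebraMap ℂ B (p.eval z) - aeval a p = (algebraMap ℂ B z - a) * P z := by
  induction p using Polynomial.induction_on' with
  | add p q hp hq =>
    obtain ⟨P, hP, eP⟩ := hp
    obtain ⟨Q, hQ, eQ⟩ := hq
    refine ⟨P + Q, hP.add hQ, fun z => ?_⟩
    rw [Pi.add_apply, mul_add, ← eP, ← eQ, eval_add, map_add, map_add]
    abel
  | monomial n c =>
    induction n with
    | zero => exact ⟨0, differentiable_const _, fun z => by simp⟩
    | succ n ih =>
      obtain ⟨P, hP, eP⟩ := ih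
      refine ⟨fun z => z • P z + aeval a (monomial n c), by fun_prop, fun z => ?_⟩
      rw [mul_add, mul_smul_comm, ← eP, ← X_mul_monomial, map_mul, aeval_X, eval_mul, eval_X,
        map_mul, Algebra.smul_def]
      noncomm_ring

variable [CompleteSpace B]

theorem isUnit_aeval {q : ℂ[X]} {a : B} (hq : ∀ z ∈ spectrum ℂ a, q.eval z ≠ 0) :
    IsUnit (aeval a q) := by
  rcases subsingleton_or_nontrivial B with h | h
  · exact isUnit_of_subsingleton _
  · rw [← spectrum.zero_notMem_iff ℂ, spectrum.map_polynomial_aeval]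
    rintro ⟨z, hz, h0⟩
    exact hq z hz h0

theorem exists_differentiableOn_div_sub_ratEval_eq {a : B} (p : ℂ[X]) {q : ℂ[X]}
    (hq : ∀ z ∈ spectrum ℂ a, q.eval z ≠ 0) :
    ∃ R : ℂ → B, DifferentiableOn ℂ R {z | q.eval z ≠ 0} ∧ ∀ z, q.eval z ≠ 0 →
      algebraMap ℂ B (p.eval z / q.eval z) - ratEval p q a = (algebraMap ℂ B z - a) * R z := by
  obtain ⟨P, hP, eP⟩ := exists_differentiable_eval_sub_aeval_eq a p
  obtain ⟨Q, hQ, eQ⟩ := exists_differentiable_eval_sub_aeval_eq a q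
  refine ⟨fun z => (q.eval z)⁻¹ • (P z - Q z * ratEval p q a), fun z hz => ?_, fun z hz => ?_⟩
  · have hd : Differentiable ℂ fun z => P z - Q z * ratEval p q a := by fun_prop
    exact ((q.differentiable z).differentiableWithinAt.inv hz).smul (hd z).differentiableWithinAt
  · have hqp : aeval a q * ratEval p q a = aeval a p := by
      rw [ratEval, ← mul_assoc, (commute_aeval a q p).eq, mul_assoc,
        Ring.mul_inverse_cancel _ (isUnit_aeval hq), mul_one]
    rw [mul_smul_comm, mul_sub, ← mul_assoc, ← eP, ← eQ, sub_mul, hqp, sub_sub_sub_cancel_right,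
      smul_sub, ← Algebra.smul_def, smul_smul, inv_mul_cancel₀ hz, one_smul, div_eq_inv_mul,
      map_mul, Algebra.smul_def]

/-- The values at `a` of the rational functions without poles in a set `D` that contains the
spectrum. -/
def rationalValues (a : B) (D : Set ℂ) (ha : spectrum ℂ a ⊆ D) : Subalgebra ℂ B where
  carrier := {b | ∃ p q : ℂ[X], (∀ z ∈ D, q.eval z ≠ 0) ∧ b = ratEval p q a}
  algebraMap_mem' c := ⟨C c, 1, by simp, by simp [ratEval]⟩
  add_mem' := by
    rintro _ _ ⟨p₁, q₁, h₁, rfl⟩ ⟨p₂, q₂, h₂, rfl⟩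
    exact ⟨_, _, fun z hz => by simp [h₁ z hz, h₂ z hz], ratEval_add_ratEval
      (isUnit_aeval fun z hz => h₁ z (ha hz)) (isUnit_aeval fun z hz => h₂ z (ha hz))⟩
  mul_mem' := by
    rintro _ _ ⟨p₁, q₁, h₁, rfl⟩ ⟨p₂, q₂, h₂, rfl⟩
    exact ⟨_, _, fun z hz => by simp [h₁ z hz, h₂ z hz], ratEval_mul_ratEval
      (isUnit_aeval fun z hz => h₁ z (ha hz)) (isUnit_aeval fun z hz => h₂ z (ha hz))⟩

theorem resolvent_mem_rationalValues {a : B} {D : Set ℂ} (ha : spectrum ℂ a ⊆ D) {z : ℂ}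
    (hz : z ∉ D) : resolvent a z ∈ rationalValues a D ha := by
  refine ⟨1, C z - X, fun w hw h => hz ?_, resolvent_eq_ratEval a z⟩
  rw [eval_sub, eval_C, eval_X, sub_eq_zero] at h
  rwa [h]

end RationalCalculus

section CauchyTransform

variable {B : Type*} [NormedRing B] [NormedAlgebra ℂ B] {D : Set ℂ} {R : ℝ} {χ : ℂ → ℝ} {a : B}

/-- The Cauchy transform `(2πi)⁻¹ ∮ φ(z) (z - a)⁻¹ dz` along the boundary of `D`, with the contour
smeared out by a cutoff `χ` of `D`. -/
def cauchyTransform (χ : ℂ → ℝ) (φ : ℂ → ℂ) (a : B) : B :=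
  (-(2 * Real.pi)⁻¹ : ℂ) • ∫ z, dbar χ z • φ z • resolvent a z

theorem IsCutoff.dbar_eq_zero (h : IsCutoff D R χ) {z : ℂ} (hz : z ∈ D) : dbar χ z = 0 :=
  dbar_eq_zero_of_eventuallyEq (h.eventually_one z hz)

theorem IsCutoff.subset_tsupport (h : IsCutoff D R χ) : D ⊆ tsupport χ := fun z hz => by
  refine _root_.subset_tsupport χ ?_
  rw [Function.mem_support, (h.eventually_one z hz).eq_of_nhds]
  exact one_ne_zero

variable [CompleteSpace B]

theorem IsCutoff.integrable (h : IsCutoff D R χ) (hD : IsCompact D) (ha : spectrum ℂ a ⊆ D)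
    {φ : ℂ → ℂ} (hφ : ContinuousOn φ (tsupport χ)) :
    Integrable fun z => dbar χ z • φ z • resolvent a z :=
  integrable_smul_of_continuousOn (continuous_dbar h.contDiff)
    (hasCompactSupport_dbar (h.hasCompactSupport hD))
    ((hφ.mono (tsupport_dbar_subset χ)).smul ((differentiableOn_resolvent a).continuousOn.mono
      (tsupport_dbar_subset_compl fun z hz => h.eventually_one z (ha hz))))

theorem IsCutoff.cauchyTransform_one (h : IsCutoff D R χ) (hD : IsCompact D)
    (ha : spectrum ℂ a ⊆ D) : cauchyTransform χ 1 a = 1 := by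
  have hpi : (2 * Real.pi : ℂ) ≠ 0 := by exact_mod_cast Real.two_pi_pos.ne'
  have hinteg := integral_dbar_smul_resolvent h.contDiff (h.hasCompactSupport hD)
    fun z hz => h.eventually_one z (ha hz)
  simp only [cauchyTransform, Pi.one_apply, one_smul]
  push_cast
  rw [hinteg, smul_smul, neg_mul_neg, inv_mul_cancel₀ hpi, one_smul]

theorem continuousOn_eval_div_eval (p : ℂ[X]) {q : ℂ[X]} {S : Set ℂ}
    (hq : ∀ z ∈ S, q.eval z ≠ 0) : ContinuousOn (fun z => p.eval z / q.eval z) S :=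
  p.continuous.continuousOn.div q.continuous.continuousOn hq

theorem IsCutoff.cauchyTransform_eq_ratEval (h : IsCutoff D R χ) (hD : IsCompact D)
    (ha : spectrum ℂ a ⊆ D) (p : ℂ[X]) {q : ℂ[X]} (hq : ∀ z ∈ tsupport χ, q.eval z ≠ 0) :
    cauchyTransform χ (fun z => p.eval z / q.eval z) a = ratEval p q a := by
  obtain ⟨G, hG, eG⟩ := exists_differentiableOn_div_sub_ratEval_eq p
    fun z hz => hq z (h.subset_tsupport (ha hz))
  have hs := h.hasCompactSupport hD
  have hG0 : ∫ z, dbar χ z • G z = 0 := integral_dbar_smul_eq_zero h.contDiff hs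
    (isOpen_ne_fun q.continuous continuous_const) hq hG
  have hsplit (z : ℂ) : dbar χ z • (p.eval z / q.eval z) • resolvent a z
      = dbar χ z • G z + (dbar χ z • resolvent a z) * ratEval p q a := by
    by_cases hz : dbar χ z = 0
    · simp [hz]
    have hzs : z ∉ spectrum ℂ a := fun hzs => hz (h.dbar_eq_zero (ha hzs))
    have hzt : z ∈ tsupport χ :=
      tsupport_dbar_subset χ (_root_.subset_tsupport _ (Function.mem_support.2 hz))
    have hGz : G z = resolvent a z * (algebraMap ℂ B (p.eval z / q.eval z) - ratEval p q a) := by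
      rw [eG z (hq z hzt), ← mul_assoc, resolvent_mul_sub hzs, one_mul]
    rw [hGz, mul_sub, smul_sub, smul_mul_assoc, sub_add_cancel, Algebra.smul_def (p.eval z / _),
      Algebra.commutes]
  have hiG : Integrable fun z => dbar χ z • G z :=
    integrable_smul_of_continuousOn (continuous_dbar h.contDiff) (hasCompactSupport_dbar hs)
      (hG.continuousOn.mono fun z hz => hq z (tsupport_dbar_subset χ hz))
  have hi := h.integrable hD ha (φ := 1) continuousOn_const
  have hone := h.cauchyTransform_one hD ha
  simp only [cauchyTransform, Pi.one_apply, one_smul] at hi hone ⊢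
  simp_rw [hsplit]
  rw [integral_add hiG (hi.mul_const _), hG0, zero_add, integral_mul_const_of_integrable hi,
    ← smul_mul_assoc, hone, one_mul]

theorem IsCutoff.map_cauchyTransform (h : IsCutoff D R χ) (hD : IsCompact D)
    (ha : spectrum ℂ a ⊆ D) {φ : ℂ → ℂ} (hφ : ContinuousOn φ (tsupport χ)) {B' : Type*}
    [NormedRing B'] [NormedAlgebra ℂ B'] [CompleteSpace B'] (θ : B →A[ℂ] B') :
    θ (cauchyTransform χ φ a) = cauchyTransform χ φ (θ a) := by
  have hinteg := θ.toContinuousLinearMap.integral_comp_comm (h.integrable hD ha hφ)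
  rw [cauchyTransform, cauchyTransform, map_smul]
  congr 1
  refine hinteg.symm.trans (integral_congr_ae (Eventually.of_forall fun z => ?_))
  by_cases hz : z ∈ D
  · simp [h.dbar_eq_zero hz]
  · have hr := map_resolvent (θ : B →ₐ[ℂ] B') fun hzs => hz (ha hzs)
    simpa using congrArg (dbar χ z • φ z • ·) hr

theorem integral_mem_of_isClosed {α : Type*} [MeasurableSpace α] {μ : Measure α}
    {V : Submodule ℂ B} (hV : IsClosed (V : Set B)) {F : α → B} (hF : ∀ z, F z ∈ V) :
    ∫ z, F z ∂μ ∈ V := by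
  by_cases hi : Integrable F μ
  · have h0 : ∀ z, V.mkQL (F z) = 0 := fun z => (Submodule.Quotient.mk_eq_zero V).2 (hF z)
    have hinteg := V.mkQL.integral_comp_comm hi
    simp only [h0, integral_zero] at hinteg
    exact (Submodule.Quotient.mk_eq_zero V).1 hinteg.symm
  · rw [integral_undef hi]
    exact V.zero_mem

theorem IsCutoff.cauchyTransform_mem_closure (h : IsCutoff D R χ) (ha : spectrum ℂ a ⊆ D)
    (φ : ℂ → ℂ) : cauchyTransform χ φ a ∈ (rationalValues a D ha).topologicalClosure := by
  set V := (rationalValues a D ha).topologicalClosure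
  refine V.smul_mem (integral_mem_of_isClosed (V := Subalgebra.toSubmodule V)
    (rationalValues a D ha).isClosed_topologicalClosure fun z => ?_) _
  by_cases hz : z ∈ D
  · simp [h.dbar_eq_zero hz]
  · exact V.smul_mem (V.smul_mem (Subalgebra.le_topologicalClosure _
      (resolvent_mem_rationalValues ha hz)) _) _

end CauchyTransform

section DoubleLayer

variable {B : Type*} [NormedRing B] [StarRing B] [NormedAlgebra ℂ B] {D : Set ℂ} {R : ℝ}
  {χ : ℂ → ℝ} {a : B}

/-- The operator-valued density of the double-layer potential of the boundary of `D`, that is, twice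
the real part of the Cauchy kernel of `cauchyTransform`. -/
def doubleLayerDensity (χ : ℂ → ℝ) (a : B) (z : ℂ) : B :=
  (-(2 * Real.pi)⁻¹ : ℂ) • (dbar χ z • resolvent a z + star (dbar χ z • resolvent a z))

theorem doubleLayerDensity_eq_zero (a : B) {z : ℂ} (hz : dbar χ z = 0) :
    doubleLayerDensity χ a z = 0 := by
  simp [doubleLayerDensity, hz]

theorem mem_tsupport_of_doubleLayerDensity_ne_zero {z : ℂ} (hz : doubleLayerDensity χ a z ≠ 0) :
    z ∈ tsupport χ :=
  tsupport_dbar_subset χ (subset_tsupport _ fun h0 => hz (doubleLayerDensity_eq_zero a h0))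

variable [StarModule ℂ B]

theorem smul_doubleLayerDensity (χ : ℂ → ℝ) (φ : ℂ → ℂ) (a : B) (z : ℂ) :
    φ z • doubleLayerDensity χ a z = (-(2 * Real.pi)⁻¹ : ℂ) • (dbar χ z • φ z • resolvent a z
      + star (dbar χ z • conj (φ z) • resolvent a z)) := by
  rw [doubleLayerDensity, smul_comm (φ z), smul_add, smul_comm (φ z)]
  simp only [star_smul, RCLike.star_def, Complex.conj_conj, smul_comm (φ z)]

variable [NormedStarGroup B]

theorem integrable_star {α : Type*} [MeasurableSpace α] {μ : Measure α} {F : α → B}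
    (hF : Integrable F μ) : Integrable (fun z => star (F z)) μ :=
  (starL' ℝ : B ≃L[ℝ] B).toContinuousLinearMap.integrable_comp hF

theorem integral_star {α : Type*} [MeasurableSpace α] {μ : Measure α} (F : α → B) :
    ∫ z, star (F z) ∂μ = star (∫ z, F z ∂μ) :=
  (starL' ℝ : B ≃L[ℝ] B).integral_comp_comm F

variable [CompleteSpace B]

theorem IsCutoff.integrable_smul_doubleLayerDensity (h : IsCutoff D R χ) (hD : IsCompact D)
    (ha : spectrum ℂ a ⊆ D) {φ : ℂ → ℂ} (hφ : ContinuousOn φ (tsupport χ)) :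
    Integrable fun z => φ z • doubleLayerDensity χ a z := by
  simp_rw [smul_doubleLayerDensity]
  have hi := h.integrable hD ha hφ
  have hi' := h.integrable hD ha (Complex.continuous_conj.comp_continuousOn hφ)
  exact (hi.add (integrable_star hi')).smul (-(2 * Real.pi)⁻¹ : ℂ)

theorem IsCutoff.integrable_doubleLayerDensity (h : IsCutoff D R χ) (hD : IsCompact D)
    (ha : spectrum ℂ a ⊆ D) : Integrable (doubleLayerDensity χ a) := by
  simpa using h.integrable_smul_doubleLayerDensity hD ha (φ := 1) continuousOn_const

theorem IsCutoff.cauchyTransform_add_star (h : IsCutoff D R χ) (hD : IsCompact D)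
    (ha : spectrum ℂ a ⊆ D) {φ : ℂ → ℂ} (hφ : ContinuousOn φ (tsupport χ)) :
    cauchyTransform χ φ a + star (cauchyTransform χ (fun z => conj (φ z)) a)
      = ∫ z, φ z • doubleLayerDensity χ a z := by
  have hi := h.integrable hD ha hφ
  have hi' := h.integrable hD ha (Complex.continuous_conj.comp_continuousOn hφ)
  simp_rw [smul_doubleLayerDensity]
  rw [integral_smul, integral_add hi (integrable_star (by exact hi')), integral_star, smul_add,
    cauchyTransform, cauchyTransform, star_smul]
  congr 3
  simp

theorem IsCutoff.integral_doubleLayerDensity (h : IsCutoff D R χ) (hD : IsCompact D)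
    (ha : spectrum ℂ a ⊆ D) : ∫ z, doubleLayerDensity χ a z = 2 := by
  have hsum := h.cauchyTransform_add_star hD ha (φ := 1) continuousOn_const
  have hone := h.cauchyTransform_one hD ha
  simp only [Pi.one_apply, one_smul, map_one] at hsum
  rw [← hsum, show (fun _ => 1 : ℂ → ℂ) = 1 from rfl, hone, star_one, one_add_one_eq_two]

end DoubleLayer

section PositiveDensity

variable {H : Type*} [NormedAddCommGroup H] [InnerProductSpace ℂ H]

theorem exists_inner_sub_eq {A : H →L[ℂ] H} {D : Set ℂ} (hne : D.Nonempty)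
    (hW : ∀ x, ‖x‖ = 1 → inner ℂ x (A x) ∈ D) (z : ℂ) (x : H) : ∃ v ∈ D,
      inner ℂ x ((algebraMap ℂ (H →L[ℂ] H) z - A) x) = (‖x‖ : ℂ) ^ 2 * (z - v) := by
  rcases eq_or_ne x 0 with rfl | hx
  · obtain ⟨v, hv⟩ := hne
    exact ⟨v, hv, by simp⟩
  have hx' : (‖x‖ : ℂ) ≠ 0 := by exact_mod_cast norm_ne_zero_iff.2 hx
  have hu : ‖(‖x‖ : ℂ)⁻¹ • x‖ = 1 := norm_smul_inv_norm hx
  have hxx : inner ℂ x x = (‖x‖ : ℂ) ^ 2 := inner_self_eq_norm_sq_to_K x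
  refine ⟨_, hW _ hu, ?_⟩
  simp only [Algebra.algebraMap_eq_smul_one, _root_.sub_apply, _root_.smul_apply,
    one_apply_eq_self, inner_sub_right, map_smul, inner_smul_left, inner_smul_right, hxx, map_inv₀,
    Complex.conj_ofReal]
  field_simp

variable [CompleteSpace H]

theorem spectrum_subset_of_inner_mem {A : H →L[ℂ] H} {D : Set ℂ} (hD : IsClosed D)
    (hne : D.Nonempty) (hW : ∀ x, ‖x‖ = 1 → inner ℂ x (A x) ∈ D) : spectrum ℂ A ⊆ D := by
  intro z hz
  by_contra hzD
  refine hz ?_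
  have hpos : 0 < infDist z D := (hD.notMem_iff_infDist_pos hne).1 hzD
  refine ContinuousLinearMap.isUnit_of_forall_le_norm_inner_map _
    (c := ⟨infDist z D, infDist_nonneg⟩) (by exact_mod_cast hpos) fun x => ?_
  obtain ⟨v, hv, hzv⟩ := exists_inner_sub_eq hne hW z x
  rw [norm_inner_symm, hzv, norm_mul]
  simp only [norm_pow, Complex.norm_real, norm_norm]
  gcongr
  rw [← dist_eq_norm]
  exact infDist_le_dist_of_mem hv

theorem IsCutoff.isPositive_doubleLayerDensity {A : H →L[ℂ] H} {D : Set ℂ} {R : ℝ} {χ : ℂ → ℝ}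
    (h : IsCutoff D R χ) (hD : IsClosed D) (hne : D.Nonempty)
    (hW : ∀ x, ‖x‖ = 1 → inner ℂ x (A x) ∈ D) (z : ℂ) : (doubleLayerDensity χ A z).IsPositive := by
  by_cases hzs : z ∈ spectrum ℂ A
  · rw [doubleLayerDensity_eq_zero A (h.dbar_eq_zero (spectrum_subset_of_inner_mem hD hne hW hzs))]
    exact ContinuousLinearMap.isPositive_zero
  rw [ContinuousLinearMap.isPositive_def']
  refine ⟨?_, fun x => ?_⟩
  · rw [doubleLayerDensity, IsSelfAdjoint, star_smul, (IsSelfAdjoint.add_star_self _).star_eq]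
    simp
  set y := resolvent A z x with hy
  have hx : x = (algebraMap ℂ (H →L[ℂ] H) z - A) y := by
    simpa using congrArg (fun S : H →L[ℂ] H => S x) (sub_mul_resolvent hzs).symm
  obtain ⟨v, hv, hzv⟩ := exists_inner_sub_eq hne hW z y
  have hxy : inner ℂ y x = (‖y‖ : ℂ) ^ 2 * (z - v) := by rw [hx, hzv]
  have hform : (doubleLayerDensity χ A z).reApplyInnerSelf x
      = -Real.pi⁻¹ * (‖y‖ ^ 2 * inner ℝ (dbar χ z) (z - v)) := by
    have hleft : inner ℂ ((dbar χ z • resolvent A z) x) x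
        = conj (dbar χ z) * ((‖y‖ : ℂ) ^ 2 * (z - v)) := by
      rw [_root_.smul_apply, ← hy, inner_smul_left, hxy]
    have hright : inner ℂ (star (dbar χ z • resolvent A z) x) x
        = conj (conj (dbar χ z) * ((‖y‖ : ℂ) ^ 2 * (z - v))) := by
      rw [ContinuousLinearMap.star_eq_adjoint, ContinuousLinearMap.adjoint_inner_left, ← hleft,
        inner_conj_symm]
    rw [ContinuousLinearMap.reApplyInnerSelf_apply, doubleLayerDensity, _root_.smul_apply,
      _root_.add_apply, inner_smul_left, inner_add_left, hleft, hright, Complex.add_conj,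
      Complex.inner, ← Complex.ofReal_pow]
    generalize ‖y‖ ^ 2 = N
    simp only [mul_inv_rev, Complex.ofReal_mul, Complex.ofReal_inv, Complex.ofReal_ofNat, map_neg,
      map_mul, map_inv₀, Complex.conj_ofReal, Complex.mul_re, Complex.conj_re, Complex.ofReal_re,
      Complex.sub_re, Complex.ofReal_im, Complex.sub_im, zero_mul, sub_zero, Complex.conj_im,
      Complex.mul_im, add_zero, neg_mul, sub_neg_eq_add, Complex.ofReal_add, Complex.ofReal_sub,
      RCLike.re_to_complex, Complex.inv_re, Complex.normSq_ofReal,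
      div_self_mul_self', Complex.re_ofNat, Complex.normSq_conj, Complex.normSq_ofNat,
      Complex.inv_im, neg_zero, zero_div, Complex.im_ofNat, mul_zero, Complex.add_re, sub_self,
      Complex.add_im, mul_neg, neg_inj]
    ring
  rw [hform]
  have := mul_nonpos_of_nonneg_of_nonpos (sq_nonneg ‖y‖) (h.inner_dbar_nonpos z v hv)
  exact mul_nonneg_of_nonpos_of_nonpos (by simpa using Real.pi_pos.le) this

theorem norm_inner_le_of_isPositive {T : H →L[ℂ] H} (hT : T.IsPositive) (x y : H) :
    ‖inner ℂ x (T y)‖ ≤ ((inner ℂ x (T x)).re + (inner ℂ y (T y)).re) / 2 := by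
  set S := CFC.sqrt T
  have hS (u v : H) : inner ℂ u (T v) = inner ℂ (S u) (S v) := by
    have hT' : 0 ≤ T := (ContinuousLinearMap.nonneg_iff_isPositive T).2 hT
    have hSS : S (S v) = T v := congrArg (fun U : H →L[ℂ] H => U v) (CFC.sqrt_mul_sqrt_self T hT')
    rw [← hSS, ← ContinuousLinearMap.adjoint_inner_left, ← ContinuousLinearMap.star_eq_adjoint,
      (CFC.sqrt_nonneg T).isSelfAdjoint.star_eq]
  have hre (u : H) : (inner ℂ u (T u)).re = ‖S u‖ ^ 2 := by
    rw [hS, norm_sq_eq_re_inner (𝕜 := ℂ)]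
    rfl
  rw [hre, hre, hS]
  linarith [norm_inner_le_norm (𝕜 := ℂ) (S x) (S y), two_mul_le_add_sq ‖S x‖ ‖S y‖]

theorem inner_integral_apply {α : Type*} [MeasurableSpace α] {μ : Measure α} {T : α → H →L[ℂ] H}
    (hT : Integrable T μ) (x y : H) :
    inner ℂ x ((∫ z, T z ∂μ) y) = ∫ z, inner ℂ x (T z y) ∂μ :=
  (((innerSL ℂ x).comp (ContinuousLinearMap.apply ℂ H y)).integral_comp_comm hT).symm

theorem integrable_inner_apply {α : Type*} [MeasurableSpace α] {μ : Measure α} {T : α → H →L[ℂ] H}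
    (hT : Integrable T μ) (x y : H) : Integrable (fun z => inner ℂ x (T z y)) μ :=
  ((innerSL ℂ x).comp (ContinuousLinearMap.apply ℂ H y)).integrable_comp hT

theorem integral_re_inner_le {α : Type*} [MeasurableSpace α] {μ : Measure α} {T : α → H →L[ℂ] H}
    (hT : Integrable T μ) {x : H} (hx : ‖x‖ = 1) :
    ∫ z, (inner ℂ x (T z x)).re ∂μ ≤ ‖∫ z, T z ∂μ‖ := calc
  _ = (inner ℂ x ((∫ z, T z ∂μ) x)).re := by
    rw [inner_integral_apply hT]
    exact integral_re (integrable_inner_apply hT x x)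
  _ ≤ ‖x‖ * ‖(∫ z, T z ∂μ) x‖ := (Complex.re_le_norm _).trans (norm_inner_le_norm _ _)
  _ ≤ ‖∫ z, T z ∂μ‖ := by simpa [hx] using (∫ z, T z ∂μ).le_opNorm x

theorem norm_integral_smul_le_of_isPositive {α : Type*} [MeasurableSpace α] {μ : Measure α}
    {T : α → H →L[ℂ] H} (hT : Integrable T μ) (hpos : ∀ z, (T z).IsPositive) {φ : α → ℂ}
    (hφ : Integrable (fun z => φ z • T z) μ) {M : ℝ} (hM : 0 ≤ M)
    (hφM : ∀ z, T z ≠ 0 → ‖φ z‖ ≤ M) :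
    ‖∫ z, φ z • T z ∂μ‖ ≤ M * ‖∫ z, T z ∂μ‖ := by
  refine ContinuousLinearMap.opNorm_le_of_re_inner_le (𝕜 := ℂ) (by positivity)
    fun y x hy hx => (RCLike.re_le_norm _).trans ?_
  rw [norm_inner_symm, inner_integral_apply hφ]
  have hre (u : H) : Integrable (fun z => (inner ℂ u (T z u)).re) μ :=
    (integrable_inner_apply hT u u).re
  have hle (z : α) : ‖inner ℂ x ((φ z • T z) y)‖
      ≤ M * (((inner ℂ x (T z x)).re + (inner ℂ y (T z y)).re) / 2) := by
    by_cases hz : T z = 0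
    · simp [hz]
    · rw [_root_.smul_apply, inner_smul_right, norm_mul]
      exact mul_le_mul (hφM z hz) (norm_inner_le_of_isPositive (hpos z) x y) (norm_nonneg _) hM
  refine (norm_integral_le_of_norm_le ((((hre x).add (hre y)).div_const 2).const_mul M)
    (Eventually.of_forall hle)).trans ?_
  rw [integral_const_mul, integral_div, integral_add' (hre x) (hre y)]
  gcongr
  linarith [integral_re_inner_le hT hx, integral_re_inner_le hT hy]

theorem IsCutoff.norm_cauchyTransform_add_star_le {A : H →L[ℂ] H} {D : Set ℂ} {R : ℝ} {χ : ℂ → ℝ}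
    (h : IsCutoff D R χ) (hD : IsCompact D) (hne : D.Nonempty)
    (hW : ∀ x, ‖x‖ = 1 → inner ℂ x (A x) ∈ D) {φ : ℂ → ℂ} (hφ : ContinuousOn φ (tsupport χ))
    {M : ℝ} (hM : 0 ≤ M) (hφM : ∀ z ∈ tsupport χ, ‖φ z‖ ≤ M) :
    ‖cauchyTransform χ φ A + star (cauchyTransform χ (fun z => conj (φ z)) A)‖ ≤ 2 * M := by
  have ha := spectrum_subset_of_inner_mem hD.isClosed hne hW
  rw [h.cauchyTransform_add_star hD ha hφ]
  refine (norm_integral_smul_le_of_isPositive (h.integrable_doubleLayerDensity hD ha)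
    (h.isPositive_doubleLayerDensity hD.isClosed hne hW)
    (h.integrable_smul_doubleLayerDensity hD ha hφ) hM
    fun z hz => hφM z (mem_tsupport_of_doubleLayerDensity_ne_zero hz)).trans ?_
  rw [h.integral_doubleLayerDensity hD ha, ← one_add_one_eq_two, mul_comm]
  gcongr
  have hone : ‖(1 : H →L[ℂ] H)‖ ≤ 1 := ContinuousLinearMap.norm_id_le
  linarith [norm_add_le (1 : H →L[ℂ] H) 1]

end PositiveDensity

section SupportingLine

variable {D : Set ℂ} {R ρ : ℝ} {χ : ℂ → ℝ} {z : ℂ}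

theorem exists_supportingLine (hD : Convex ℝ D) (hi : (interior D).Nonempty)
    (hz : z ∈ frontier D) :
    ∃ θ₀ : ℝ, ∀ w ∈ D, inner ℝ (Complex.exp (θ₀ * Complex.I)) (w - z) ≤ 0 := by
  obtain ⟨f, hf⟩ := geometric_hahn_banach_open_point hD.interior isOpen_interior hz.2
  set v := (InnerProductSpace.toDual ℝ ℂ).symm f
  have hfv (w : ℂ) : f w = inner ℝ v w := (InnerProductSpace.toDual_symm_apply).symm
  have hv : v ≠ 0 := fun hv => by
    obtain ⟨w, hw⟩ := hi
    have := hf w hw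
    simp [hfv, hv] at this
  refine ⟨v.arg, fun w hw => ?_⟩
  have hle : f w ≤ f z := by
    have hcl : D ⊆ closure (interior D) := by
      rw [hD.closure_interior_eq_closure_of_nonempty_interior hi]
      exact subset_closure
    exact closure_minimal (fun w hw => (hf w hw).le) (isClosed_le f.continuous continuous_const)
      (hcl hw)
  have hpolar : v = ‖v‖ • Complex.exp (v.arg * Complex.I) := by
    rw [Complex.real_smul, Complex.norm_mul_exp_arg_mul_I]
  rw [hfv, hfv, ← sub_nonpos, ← inner_sub_right, hpolar, real_inner_smul_left] at hle
  exact nonpos_of_mul_nonpos_right hle (norm_pos_iff.2 hv)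

theorem inner_exp_mul_I_circleMap_sub (z : ℂ) (ρ θ θ₀ : ℝ) :
    inner ℝ (Complex.exp (θ₀ * Complex.I)) (circleMap z ρ θ - z) = ρ * Real.cos (θ - θ₀) := by
  rw [circleMap_sub_center, circleMap_zero, Complex.inner, ← Complex.exp_conj,
    mul_assoc, ← Complex.exp_add, Complex.re_ofReal_mul]
  congr 1
  rw [← Complex.exp_ofReal_mul_I_re]
  congr 2
  simp only [map_mul, Complex.conj_ofReal, Complex.conj_I, mul_neg, Complex.ofReal_sub]
  ring

theorem integral_circleMap_le (hχ : Continuous χ) (hχ1 : ∀ w, χ w ≤ 1) (hρ : 0 < ρ) (hR : 0 ≤ R)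
    (hRρ : R ≤ ρ) {θ₀ : ℝ}
    (h0 : ∀ w, R < inner ℝ (Complex.exp (θ₀ * Complex.I)) (w - z) → χ w = 0) :
    ∫ θ in Set.Ioo (-Real.pi) Real.pi, χ (circleMap z ρ θ)
      ≤ Real.pi + 2 * Real.arcsin (R / ρ) := by
  set α := Real.arccos (R / ρ) with hα
  set g : ℝ → ℝ := fun θ => χ (circleMap z ρ θ)
  have hg : Continuous g := hχ.comp (continuous_circleMap z ρ)
  have hαpi : α ≤ Real.pi := Real.arccos_le_pi _
  have hα0 : 0 ≤ α := Real.arccos_nonneg _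
  have hzero (θ : ℝ) (hθ : |θ - θ₀| < α) : g θ = 0 := h0 _ <| by
    have hcos := Real.cos_lt_cos_of_nonneg_of_le_pi (abs_nonneg _) hαpi hθ
    rw [Real.cos_abs, hα, Real.cos_arccos (by linarith [div_nonneg hR hρ.le])
      ((div_le_one hρ).2 hRρ), div_lt_iff₀' hρ] at hcos
    rwa [inner_exp_mul_I_circleMap_sub]
  have hinteg (a b : ℝ) : IntervalIntegrable g volume a b := hg.intervalIntegrable a b
  have hle (a b : ℝ) (hab : a ≤ b) : ∫ θ in a..b, g θ ≤ b - a := by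
    simpa using intervalIntegral.integral_mono_on hab (hinteg a b) intervalIntegrable_const
      fun θ _ => hχ1 (circleMap z ρ θ)
  have hmid : ∫ θ in θ₀ - α..θ₀ + α, g θ = 0 := by
    rw [intervalIntegral.integral_of_le (by linarith), integral_Ioc_eq_integral_Ioo]
    refine setIntegral_eq_zero_of_forall_eq_zero fun θ hθ => hzero θ (abs_lt.2 ⟨?_, ?_⟩)
    · linarith [hθ.1]
    · linarith [hθ.2]
  have hper : ∫ θ in Set.Ioo (-Real.pi) Real.pi, g θ
      = ∫ θ in θ₀ - Real.pi..θ₀ + Real.pi, g θ := by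
    have := ((periodic_circleMap z ρ).comp χ).intervalIntegral_add_eq (-Real.pi) (θ₀ - Real.pi)
    rw [← integral_Ioc_eq_integral_Ioo, ← intervalIntegral.integral_of_le (by linarith)]
    rwa [show -Real.pi + 2 * Real.pi = Real.pi by ring,
      show θ₀ - Real.pi + 2 * Real.pi = θ₀ + Real.pi by ring] at this
  have hsplit : ∫ θ in θ₀ - Real.pi..θ₀ + Real.pi, g θ = (∫ θ in θ₀ - Real.pi..θ₀ - α, g θ)
      + (∫ θ in θ₀ - α..θ₀ + α, g θ) + ∫ θ in θ₀ + α..θ₀ + Real.pi, g θ := by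
    rw [intervalIntegral.integral_add_adjacent_intervals (hinteg _ _) (hinteg _ _),
      intervalIntegral.integral_add_adjacent_intervals (hinteg _ _) (hinteg _ _)]
  have hleft := hle (θ₀ - Real.pi) (θ₀ - α) (by linarith)
  have hright := hle (θ₀ + α) (θ₀ + Real.pi) (by linarith)
  have harc : α = Real.pi / 2 - Real.arcsin (R / ρ) := rfl
  rw [hper, hsplit, hmid]
  linarith

end SupportingLine

section Neumann

variable {D : Set ℂ} {R ρ : ℝ} {χ : ℂ → ℝ} {z : ℂ}

theorem IsCutoff.inner_le_of_mem_tsupport (h : IsCutoff D R χ) (hD : IsCompact D) (hR : 0 ≤ R)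
    {u : ℂ} (hu : ‖u‖ = 1) (hD0 : ∀ w ∈ D, inner ℝ u (w - z) ≤ 0) {w : ℂ} (hw : w ∈ tsupport χ) :
    inner ℝ u (w - z) ≤ R := by
  have hw' := h.tsupport_subset hw
  rw [hD.cthickening_eq_biUnion_closedBall hR, Set.mem_iUnion₂] at hw'
  obtain ⟨v, hv, hwv⟩ := hw'
  rw [← sub_add_sub_cancel w v z, inner_add_right]
  rw [mem_closedBall, dist_eq_norm] at hwv
  have := real_inner_le_norm u (w - v)
  rw [hu, one_mul] at this
  linarith [hD0 v hv]

theorem doubleLayerDensity_complex (χ : ℂ → ℝ) (z ζ : ℂ) :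
    doubleLayerDensity χ z ζ = ((-Real.pi⁻¹ * (dbar χ ζ / (ζ - z)).re : ℝ) : ℂ) := by
  have hres : resolvent z ζ = (ζ - z)⁻¹ := by simp [resolvent]
  rw [doubleLayerDensity, hres, smul_eq_mul (dbar χ ζ), ← div_eq_mul_inv, RCLike.star_def,
    Complex.add_conj, smul_eq_mul]
  push_cast
  field_simp

theorem IsCutoff.re_dbar_div_nonpos (h : IsCutoff D R χ) (hz : z ∈ D) (ζ : ℂ) :
    (dbar χ ζ / (ζ - z)).re ≤ 0 := by
  have hinner : (dbar χ ζ / (ζ - z)).re = inner ℝ (dbar χ ζ) (ζ - z) / Complex.normSq (ζ - z) := by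
    rw [Complex.div_re, Complex.inner]
    simp only [Complex.sub_re, Complex.sub_im, Complex.mul_re, Complex.conj_re, Complex.conj_im,
      mul_neg, sub_neg_eq_add]
    ring
  rw [hinner]
  exact div_nonpos_of_nonpos_of_nonneg (h.inner_dbar_nonpos ζ z hz) (Complex.normSq_nonneg _)

theorem IsCutoff.norm_doubleLayerDensity (h : IsCutoff D R χ) (hz : z ∈ D) (ζ : ℂ) :
    ‖doubleLayerDensity χ z ζ‖ = -Real.pi⁻¹ * (dbar χ ζ / (ζ - z)).re := by
  rw [doubleLayerDensity_complex, Complex.norm_of_nonneg]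
  exact mul_nonneg_of_nonpos_of_nonpos (by simpa using Real.pi_pos.le) (h.re_dbar_div_nonpos hz ζ)

theorem IsCutoff.setIntegral_norm_doubleLayerDensity (h : IsCutoff D R χ) (hD : IsCompact D)
    (hz : z ∈ D) (hρ : 0 ≤ ρ) :
    ∫ ζ in {ζ | ρ < ‖ζ - z‖}, ‖doubleLayerDensity χ z ζ‖
      = Real.pi⁻¹ * ∫ θ in Set.Ioo (-Real.pi) Real.pi, χ (circleMap z ρ θ) := by
  have hshift := (measurePreserving_add_left volume z).setIntegral_preimage_emb
    (measurableEmbedding_addLeft z) (fun ζ => (dbar χ ζ / (ζ - z)).re) {ζ | ρ < ‖ζ - z‖}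
  simp only [Set.preimage_ofPred_eq, add_sub_cancel_left] at hshift
  simp_rw [h.norm_doubleLayerDensity hz]
  rw [integral_const_mul, ← hshift,
    setIntegral_re_dbar_div h.contDiff (h.hasCompactSupport hD) z hρ]
  ring

theorem IsCutoff.setIntegral_norm_doubleLayerDensity_le (h : IsCutoff D R χ) (hD : IsCompact D)
    (hDc : Convex ℝ D) (hi : (interior D).Nonempty) (hz : z ∈ frontier D) (hR : 0 ≤ R)
    (hρ : 0 < ρ) (hRρ : R ≤ ρ) :
    ∫ ζ in {ζ | ρ < ‖ζ - z‖}, ‖doubleLayerDensity χ z ζ‖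
      ≤ 1 + 2 * Real.arcsin (R / ρ) / Real.pi := by
  obtain ⟨θ₀, hθ₀⟩ := exists_supportingLine hDc hi hz
  have hcirc : ∫ θ in Set.Ioo (-Real.pi) Real.pi, χ (circleMap z ρ θ)
      ≤ Real.pi + 2 * Real.arcsin (R / ρ) :=
    integral_circleMap_le h.contDiff.continuous h.le_one hρ hR hRρ fun w hw =>
      image_eq_zero_of_notMem_tsupport fun hwt => hw.not_ge
        (h.inner_le_of_mem_tsupport hD hR (Complex.norm_exp_ofReal_mul_I θ₀) hθ₀ hwt)
  rw [h.setIntegral_norm_doubleLayerDensity hD (hD.isClosed.frontier_subset hz) hρ.le,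
    inv_mul_eq_div, div_le_iff₀ Real.pi_pos, add_mul, div_mul_cancel₀ _ Real.pi_ne_zero, one_mul]
  exact hcirc

theorem norm_integral_smul_sub_le {α E : Type*} [MeasurableSpace α] {μ : Measure α}
    [NormedAddCommGroup E] [NormedSpace ℝ E] [CompleteSpace E] {m : α → ℝ} (hm : Integrable m μ)
    (hm0 : 0 ≤ m) (hm2 : ∫ x, m x ∂μ = 2) {φ : α → E} (hφ : Integrable (fun x => m x • φ x) μ)
    {S : Set α} (hS : MeasurableSet S) {c : E} {M ε η : ℝ} (hη : 0 ≤ η)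
    (hmS : ∫ x in S, m x ∂μ ≤ 1 + η) (hc : ‖c‖ ≤ M) (hφM : ∀ x, m x ≠ 0 → ‖φ x‖ ≤ M)
    (hφc : ∀ x ∉ S, m x ≠ 0 → ‖φ x - c‖ ≤ ε) (hε : 0 ≤ ε) :
    ‖∫ x, m x • φ x ∂μ - c‖ ≤ M * (1 + 2 * η) + 2 * ε := by
  set F := ∫ x in S, m x ∂μ
  have hF : 0 ≤ F := integral_nonneg hm0
  have hFc : ∫ x in Sᶜ, m x ∂μ = 2 - F := by rw [← hm2, ← integral_add_compl hS hm]; ring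
  have hbound {ψ : α → E} {K : ℝ} {U : Set α} (hU : MeasurableSet U)
      (hψ : ∀ x ∈ U, m x ≠ 0 → ‖ψ x‖ ≤ K) :
      ‖∫ x in U, m x • ψ x ∂μ‖ ≤ K * ∫ x in U, m x ∂μ := by
    rw [← integral_const_mul]
    refine norm_integral_le_of_norm_le (hm.integrableOn.const_mul K)
      ((ae_restrict_iff' hU).2 (Eventually.of_forall fun x hx => ?_))
    rcases eq_or_ne (m x) 0 with h0 | h0
    · simp [h0]
    · rw [norm_smul, Real.norm_of_nonneg (hm0 x), mul_comm]
      exact mul_le_mul_of_nonneg_right (hψ x hx h0) (hm0 x)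
  have hfar := hbound hS fun x _ => hφM x
  have hnear := hbound hS.compl hφc
  have hsplit : ∫ x, m x • φ x ∂μ - c
      = ∫ x in S, m x • φ x ∂μ + ∫ x in Sᶜ, m x • (φ x - c) ∂μ + (1 - F) • c := by
    simp_rw [smul_sub]
    rw [integral_sub hφ.integrableOn (hm.smul_const c).integrableOn, integral_smul_const, hFc,
      ← integral_add_compl hS hφ]
    module
  have habs : ‖(1 - F) • c‖ ≤ M * |1 - F| := by
    rw [norm_smul, mul_comm, Real.norm_eq_abs]
    gcongr
  rw [hFc] at hnear
  have hM : 0 ≤ M := (norm_nonneg c).trans hc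
  have htotal := (norm_add₃_le (a := ∫ x in S, m x • φ x ∂μ)).trans
    (add_le_add_three hfar hnear habs)
  rw [hsplit]
  refine htotal.trans ?_
  rcases abs_cases (1 - F) with ⟨habsF, _⟩ | ⟨habsF, _⟩ <;> rw [habsF] <;>
    nlinarith [mul_nonneg hε hF, mul_nonneg hM hη, mul_le_mul_of_nonneg_left hmS hM]

/-- Neumann's lemma: on the boundary of a convex set the double-layer density of total mass `2` has
about half of its mass concentrated near the pole, which leaves the Cauchy transform of `conj f`
bounded by the supremum of `|f|`. -/
theorem IsCutoff.norm_cauchyTransform_conj_le (h : IsCutoff D R χ) (hD : IsCompact D)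
    (hDc : Convex ℝ D) (hi : (interior D).Nonempty) (hz : z ∈ frontier D) (hR : 0 ≤ R)
    (hρ : 0 < ρ) (hRρ : R ≤ ρ) {p q : ℂ[X]} (hq : ∀ ζ ∈ tsupport χ, q.eval ζ ≠ 0) {M ε : ℝ}
    (hε : 0 ≤ ε) (hM : ∀ ζ ∈ tsupport χ, ‖p.eval ζ / q.eval ζ‖ ≤ M)
    (hnear : ∀ ζ ∈ tsupport χ, ‖ζ - z‖ ≤ ρ → ‖p.eval ζ / q.eval ζ - p.eval z / q.eval z‖ ≤ ε) :
    ‖cauchyTransform χ (fun ζ => conj (p.eval ζ / q.eval ζ)) z‖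
      ≤ M * (1 + 2 * (2 * Real.arcsin (R / ρ) / Real.pi)) + 2 * ε := by
  have hzD : z ∈ D := hD.isClosed.frontier_subset hz
  have ha : spectrum ℂ z ⊆ D :=
    (spectrum.scalar_eq (A := ℂ) z).trans_subset (Set.singleton_subset_iff.2 hzD)
  have hf := continuousOn_eval_div_eval p hq
  set m : ℂ → ℝ := fun ζ => ‖doubleLayerDensity χ z ζ‖
  have hdens (ζ : ℂ) : doubleLayerDensity χ z ζ = m ζ := by
    change _ = (‖doubleLayerDensity χ z ζ‖ : ℂ)
    rw [h.norm_doubleLayerDensity hzD ζ, doubleLayerDensity_complex]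
  have hsmul (φ : ℂ → ℂ) (ζ : ℂ) : φ ζ • doubleLayerDensity χ z ζ = m ζ • φ ζ := by
    rw [hdens, smul_eq_mul, Complex.real_smul, mul_comm]
  have hsum := h.cauchyTransform_add_star hD ha hf
  rw [h.cauchyTransform_eq_ratEval hD ha p hq, ratEval_complex, ← eq_sub_iff_add_eq'] at hsum
  simp_rw [hsmul fun ζ => p.eval ζ / q.eval ζ] at hsum
  have hmi : Integrable m := (h.integrable_doubleLayerDensity hD ha).norm
  have hm2 : ∫ ζ, m ζ = 2 := by
    have := h.integral_doubleLayerDensity hD ha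
    simp_rw [hdens, integral_complex_ofReal] at this
    exact_mod_cast this
  have hsupp {ζ : ℂ} (hζ : m ζ ≠ 0) : ζ ∈ tsupport χ :=
    mem_tsupport_of_doubleLayerDensity_ne_zero (norm_ne_zero_iff.1 hζ)
  have hfi : Integrable fun ζ => m ζ • (p.eval ζ / q.eval ζ) := by
    simp_rw [← hsmul fun ζ => p.eval ζ / q.eval ζ]
    exact h.integrable_smul_doubleLayerDensity hD ha hf
  have hη : 0 ≤ 2 * Real.arcsin (R / ρ) / Real.pi := by
    have := Real.arcsin_nonneg.2 (div_nonneg hR hρ.le)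
    positivity
  rw [← norm_star, hsum]
  exact norm_integral_smul_sub_le hmi (fun ζ => norm_nonneg _) hm2 hfi
    (measurableSet_lt measurable_const (by fun_prop)) hη
    (h.setIntegral_norm_doubleLayerDensity_le hD hDc hi hz hR hρ hRρ)
    (hM z (h.subset_tsupport hzD)) (fun ζ hζ => hM ζ (hsupp hζ))
    (fun ζ hζS hζ => hnear ζ (hsupp hζ) (not_lt.1 hζS)) hε

theorem exists_isCutoff_norm_cauchyTransform_conj_le (hD : IsCompact D) (hDc : Convex ℝ D)
    (hi : (interior D).Nonempty) {p q : ℂ[X]} (hq : ∀ ζ ∈ D, q.eval ζ ≠ 0) {M ε : ℝ}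
    (hM : ∀ ζ ∈ D, ‖p.eval ζ / q.eval ζ‖ ≤ M) (hε : 0 < ε) :
    ∃ R χ, IsCutoff D R χ ∧ (∀ ζ ∈ tsupport χ, q.eval ζ ≠ 0) ∧
      (∀ ζ ∈ tsupport χ, ‖p.eval ζ / q.eval ζ‖ ≤ M + ε) ∧
      ∀ z ∈ frontier D, ‖cauchyTransform χ (fun ζ => conj (p.eval ζ / q.eval ζ)) z‖ ≤ M + ε := by
  set U := {ζ | q.eval ζ ≠ 0}
  have hf : ContinuousOn (fun ζ => p.eval ζ / q.eval ζ) U :=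
    continuousOn_eval_div_eval p fun ζ hζ => hζ
  have hU : IsOpen U := isOpen_ne_fun q.continuous continuous_const
  set V := U ∩ (fun ζ => ‖p.eval ζ / q.eval ζ‖) ⁻¹' Set.Iio (M + ε / 4)
  have hV : IsOpen V := hf.norm.isOpen_inter_preimage hU isOpen_Iio
  obtain ⟨R₀, hR₀, hR₀V⟩ := hD.exists_cthickening_subset_open hV fun ζ hζ =>
    ⟨hq ζ hζ, (hM ζ hζ).trans_lt (by linarith)⟩
  obtain ⟨ρ, hρ, hρf⟩ := Metric.uniformContinuousOn_iff_le.1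
    (hD.cthickening.uniformContinuousOn_of_continuous (hf.mono fun ζ hζ => (hR₀V hζ).1))
    (ε / 4) (by positivity)
  have hlim : Tendsto (fun R => (M + ε / 4) * (1 + 2 * (2 * Real.arcsin (R / ρ) / Real.pi))
      + 2 * (ε / 4)) (𝓝[>] 0) (𝓝 (M + ε / 4 + 2 * (ε / 4))) := by
    refine (Continuous.tendsto' ?_ 0 _ (by simp)).mono_left nhdsWithin_le_nhds
    have := Real.continuous_arcsin
    fun_prop
  obtain ⟨R, ⟨hRε, hRR₀⟩, hR⟩ := (((hlim.eventually_le_const (by linarith :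
    M + ε / 4 + 2 * (ε / 4) < M + ε)).and (Ioo_mem_nhdsGT (lt_min hR₀ hρ))).and
      self_mem_nhdsWithin).exists
  obtain ⟨χ, hχ⟩ := exists_isCutoff hDc hR
  have hsupp : tsupport χ ⊆ cthickening R₀ D := hχ.tsupport_subset.trans
    (cthickening_mono (hRR₀.2.le.trans (min_le_left _ _)) D)
  have hq' (ζ : ℂ) (hζ : ζ ∈ tsupport χ) : q.eval ζ ≠ 0 := (hR₀V (hsupp hζ)).1
  have hM' (ζ : ℂ) (hζ : ζ ∈ tsupport χ) : ‖p.eval ζ / q.eval ζ‖ ≤ M + ε / 4 :=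
    (hR₀V (hsupp hζ)).2.le
  refine ⟨R, χ, hχ, hq', fun ζ hζ => (hM' ζ hζ).trans (by linarith), fun z hz => ?_⟩
  refine (hχ.norm_cauchyTransform_conj_le hD hDc hi hz hRR₀.1.le hρ
    (hRR₀.2.le.trans (min_le_right _ _)) hq' (by positivity) hM' fun ζ hζ hζz => ?_).trans hRε
  rw [← dist_eq_norm] at hζz ⊢
  exact hρf ζ (hsupp hζ) z
    (self_subset_cthickening D (hD.isClosed.frontier_subset hz)) hζz

end Neumann

section CrouzeixPalencia

variable {H : Type*} [NormedAddCommGroup H] [InnerProductSpace ℂ H]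

/-- `D` is a `C`-spectral set of `A`: every rational function `f` without poles in `D` satisfies
`‖f(A)‖ ≤ C sup_D |f|`. -/
def IsSpectralConstant (A : H →L[ℂ] H) (D : Set ℂ) (C : ℝ) : Prop :=
  ∀ p q : ℂ[X], (∀ z ∈ D, q.eval z ≠ 0) → ∀ M, 0 ≤ M →
    (∀ z ∈ D, ‖p.eval z‖ ≤ M * ‖q.eval z‖) → ‖ratEval p q A‖ ≤ C * M

variable {A : H →L[ℂ] H} {D E : Set ℂ} {C : ℝ}

theorem norm_eval_div_eval_le_iff {p q : ℂ[X]} {z : ℂ} {M : ℝ} (hz : q.eval z ≠ 0) :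
    ‖p.eval z / q.eval z‖ ≤ M ↔ ‖p.eval z‖ ≤ M * ‖q.eval z‖ := by
  rw [norm_div, div_le_iff₀ (norm_pos_iff.2 hz)]

/-- The identity function on the boundary of `D` paired with `A`: norm estimates for the rational
values of this element compare `f(A)` with `f` on the boundary, for all `f` at once. -/
def boundaryPair (A : H →L[ℂ] H) (D : Set ℂ) : C(frontier D, ℂ) × (H →L[ℂ] H) :=
  (⟨Subtype.val, continuous_subtype_val⟩, A)

theorem IsSpectralConstant.sInf_mem (hne : {C | 0 ≤ C ∧ IsSpectralConstant A D C}.Nonempty) :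
    IsSpectralConstant A D (sInf {C | 0 ≤ C ∧ IsSpectralConstant A D C}) := by
  intro p q hq M hM hpq
  rcases hM.eq_or_lt with rfl | hM'
  · obtain ⟨C, -, hC⟩ := hne
    simpa using hC p q hq 0 hM hpq
  · rw [← div_le_iff₀ hM']
    refine le_csInf hne fun C hC => ?_
    rw [div_le_iff₀ hM']
    exact hC.2 p q hq M hM hpq

theorem spectrum_boundaryPair_subset (hD : IsClosed D) (hA : spectrum ℂ A ⊆ D) :
    spectrum ℂ (boundaryPair A D) ⊆ D := by
  intro z hz
  by_contra hzD
  refine hz (Prod.isUnit_iff.2 ⟨(ContinuousMap.isUnit_iff_forall_ne_zero _).2 fun w hw => ?_,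
    spectrum.notMem_iff.1 fun h => hzD (hA h)⟩)
  have hzw : z - w = 0 := hw
  exact hzD (sub_eq_zero.1 hzw ▸ hD.frontier_subset w.2)

section

variable [CompactSpace (frontier D)]

/-- Evaluation of the first component of a pair at a boundary point. -/
def boundaryEval (z : frontier D) : C(frontier D, ℂ) × (H →L[ℂ] H) →A[ℂ] ℂ :=
  ContinuousAlgHom.comp ⟨ContinuousMap.evalAlgHom ℂ ℂ z, continuous_eval_const z⟩
    (ContinuousAlgHom.fst ℂ _ _)

variable [CompleteSpace H]

theorem ratEval_boundaryPair_fst (ha : spectrum ℂ (boundaryPair A D) ⊆ D) {p q : ℂ[X]}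
    (hq : ∀ z ∈ D, q.eval z ≠ 0) (z : frontier D) :
    (ratEval p q (boundaryPair A D)).1 z = p.eval (z : ℂ) / q.eval (z : ℂ) :=
  (map_ratEval (a := boundaryPair A D)
    (boundaryEval z : C(frontier D, ℂ) × (H →L[ℂ] H) →A[ℂ] ℂ).toAlgHom
    (isUnit_aeval fun z hz => hq z (ha hz))).trans (ratEval_complex p q z)

theorem ratEval_boundaryPair_snd (ha : spectrum ℂ (boundaryPair A D) ⊆ D) {p q : ℂ[X]}
    (hq : ∀ z ∈ D, q.eval z ≠ 0) : (ratEval p q (boundaryPair A D)).2 = ratEval p q A :=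
  map_ratEval (AlgHom.snd ℂ C(frontier D, ℂ) (H →L[ℂ] H))
    (isUnit_aeval fun z hz => hq z (ha hz))

/-- By the maximum principle a spectral constant bounds `f(A)` by `f` on the boundary of `D`. -/
theorem IsSpectralConstant.norm_snd_le (hAC : IsSpectralConstant A D C) (hD : IsCompact D)
    (ha : spectrum ℂ (boundaryPair A D) ⊆ D) {b : C(frontier D, ℂ) × (H →L[ℂ] H)}
    (hb : b ∈ (rationalValues (boundaryPair A D) D ha).topologicalClosure) :
    ‖b.2‖ ≤ C * ‖b.1‖ := by
  have hcl : IsClosed {b : C(frontier D, ℂ) × (H →L[ℂ] H) | ‖b.2‖ ≤ C * ‖b.1‖} :=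
    isClosed_le (by fun_prop) (by fun_prop)
  refine closure_minimal (fun b hb => ?_) hcl hb
  obtain ⟨p, q, hq, rfl⟩ := hb
  rw [Set.mem_ofPred_eq, ratEval_boundaryPair_snd ha hq]
  refine hAC p q hq _ (norm_nonneg _) fun z hz => (norm_eval_div_eval_le_iff (hq z hz)).1 ?_
  have hd : DiffContOnCl ℂ (fun z => p.eval z / q.eval z) D := by
    refine DifferentiableOn.diffContOnCl ?_
    rw [hD.isClosed.closure_eq]
    exact p.differentiable.differentiableOn.div q.differentiable.differentiableOn hq
  refine Complex.norm_le_of_forall_mem_frontier_norm_le hD.isBounded hd (fun w hw => ?_)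
    (subset_closure hz)
  rw [← ratEval_boundaryPair_fst ha hq ⟨w, hw⟩]
  exact ContinuousMap.norm_coe_le_norm _ _

theorem IsSpectralConstant.norm_mul_cauchyTransform_mul_le (hAC : IsSpectralConstant A D C)
    (hC : 0 ≤ C) (hD : IsCompact D) (hA : spectrum ℂ A ⊆ D) {R : ℝ} {χ : ℂ → ℝ}
    (h : IsCutoff D R χ) {φ : ℂ → ℂ} (hφ : ContinuousOn φ (tsupport χ)) {p q : ℂ[X]}
    (hq : ∀ z ∈ D, q.eval z ≠ 0) {M N : ℝ} (hM : 0 ≤ M)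
    (hpM : ∀ z ∈ frontier D, ‖p.eval z / q.eval z‖ ≤ M) (hN : 0 ≤ N)
    (hφN : ∀ z ∈ frontier D, ‖cauchyTransform χ φ z‖ ≤ N) :
    ‖ratEval p q A * cauchyTransform χ φ A * ratEval p q A‖ ≤ C * (M * N * M) := by
  set a := boundaryPair A D
  have ha : spectrum ℂ a ⊆ D := spectrum_boundaryPair_subset hD.isClosed hA
  have hf : ratEval p q a ∈ (rationalValues a D ha).topologicalClosure :=
    Subalgebra.le_topologicalClosure _ ⟨p, q, hq, rfl⟩
  have key := hAC.norm_snd_le hD ha (mul_mem (mul_mem hf (h.cauchyTransform_mem_closure ha φ)) hf)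
  have hsnd : (cauchyTransform χ φ a).2 = cauchyTransform χ φ A :=
    h.map_cauchyTransform hD ha hφ (ContinuousAlgHom.snd ℂ C(frontier D, ℂ) (H →L[ℂ] H))
  rw [Prod.snd_mul, Prod.snd_mul, ratEval_boundaryPair_snd ha hq, hsnd] at key
  refine key.trans (mul_le_mul_of_nonneg_left ?_ hC)
  refine (ContinuousMap.norm_le _ (by positivity)).2 fun z => ?_
  have hfst : (cauchyTransform χ φ a).1 z = cauchyTransform χ φ (z : ℂ) :=
    h.map_cauchyTransform hD ha hφ (boundaryEval z)
  rw [Prod.fst_mul, Prod.fst_mul, ContinuousMap.mul_apply, ContinuousMap.mul_apply,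
    ratEval_boundaryPair_fst ha hq, hfst, norm_mul, norm_mul]
  gcongr
  exacts [hpM z z.2, hφN z z.2, hpM z z.2]

end

variable [CompleteSpace H]

theorem norm_pow_four_le (S T : H →L[ℂ] H) :
    ‖T‖ ^ 4 ≤ ‖T + star S‖ * ‖T‖ ^ 3 + ‖T * S * T‖ * ‖T‖ := by
  have hid : T * star T * (T * star T)
      = T * star (T + star S) * T * star T - T * S * T * star T := by
    rw [star_add, star_star]
    noncomm_ring
  calc ‖T‖ ^ 4 = ‖T * star T * (T * star T)‖ := by
        nth_rewrite 2 [← (IsSelfAdjoint.mul_star_self T).star_eq]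
        rw [CStarRing.norm_self_mul_star, CStarRing.norm_self_mul_star]
        ring
    _ ≤ ‖T * star (T + star S) * T * star T‖ + ‖T * S * T * star T‖ := hid ▸ norm_sub_le _ _
    _ ≤ ‖T‖ * ‖T + star S‖ * ‖T‖ * ‖T‖ + ‖T * S * T‖ * ‖T‖ := by
        gcongr
        · refine (norm_mul_le_of_le (norm_mul_le_of_le (norm_mul_le _ _) le_rfl) le_rfl).trans_eq ?_
          rw [norm_star, norm_star]
        · exact (norm_mul_le _ _).trans_eq (by rw [norm_star])
    _ = ‖T + star S‖ * ‖T‖ ^ 3 + ‖T * S * T‖ * ‖T‖ := by ring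

theorem IsSpectralConstant.norm_ratEval_pow_four_le (hAC : IsSpectralConstant A D C) (hC : 0 ≤ C)
    (hD : IsCompact D) (hDc : Convex ℝ D) (hi : (interior D).Nonempty)
    (hW : ∀ x, ‖x‖ = 1 → inner ℂ x (A x) ∈ D) {p q : ℂ[X]} (hq : ∀ z ∈ D, q.eval z ≠ 0) {M : ℝ}
    (hM : 0 ≤ M) (hpq : ∀ z ∈ D, ‖p.eval z / q.eval z‖ ≤ M) :
    ‖ratEval p q A‖ ^ 4 ≤ 2 * M * ‖ratEval p q A‖ ^ 3 + C * (M * M * M) * ‖ratEval p q A‖ := by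
  have hne : D.Nonempty := hi.mono interior_subset
  have hA := spectrum_subset_of_inner_mem hD.isClosed hne hW
  have : CompactSpace (frontier D) := isCompact_iff_compactSpace.1
    (hD.of_isClosed_subset isClosed_frontier hD.isClosed.frontier_subset)
  have main (ε : ℝ) (hε : 0 < ε) : ‖ratEval p q A‖ ^ 4 ≤ 2 * (M + ε) * ‖ratEval p q A‖ ^ 3
      + C * (M * (M + ε) * M) * ‖ratEval p q A‖ := by
    obtain ⟨R, χ, h, hqχ, hMχ, hconj⟩ :=
      exists_isCutoff_norm_cauchyTransform_conj_le hD hDc hi hq hpq hε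
    have hφ := continuousOn_eval_div_eval p hqχ
    have hadd := h.norm_cauchyTransform_add_star_le hD hne hW hφ (by positivity) hMχ
    rw [h.cauchyTransform_eq_ratEval hD hA p hqχ] at hadd
    have hmul := hAC.norm_mul_cauchyTransform_mul_le hC hD hA h
      (Complex.continuous_conj.comp_continuousOn hφ) hq hM
      (fun z hz => hpq z (hD.isClosed.frontier_subset hz)) (by positivity) hconj
    refine (norm_pow_four_le (cauchyTransform χ (fun z => conj (p.eval z / q.eval z)) A) _).trans ?_
    gcongr
    exact hmul
  have hlim : Tendsto (fun ε : ℝ => 2 * (M + ε) * ‖ratEval p q A‖ ^ 3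
      + C * (M * (M + ε) * M) * ‖ratEval p q A‖) (𝓝[>] 0)
      (𝓝 (2 * M * ‖ratEval p q A‖ ^ 3 + C * (M * M * M) * ‖ratEval p q A‖)) :=
    (Continuous.tendsto' (by fun_prop) 0 _ (by simp)).mono_left nhdsWithin_le_nhds
  exact ge_of_tendsto hlim (eventually_mem_nhdsWithin.mono fun ε hε => main ε hε)

theorem IsSpectralConstant.cbrt (hAC : IsSpectralConstant A D C) (hC : 0 ≤ C) (hD : IsCompact D)
    (hDc : Convex ℝ D) (hi : (interior D).Nonempty) (hW : ∀ x, ‖x‖ = 1 → inner ℂ x (A x) ∈ D)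
    {K : ℝ} (hK : 0 ≤ K) (hKC : K ^ 3 = 2 * C ^ 2 + C) : IsSpectralConstant A D K := by
  intro p q hq M hM hpq
  have hle := hAC p q hq M hM hpq
  have hfour := hAC.norm_ratEval_pow_four_le hC hD hDc hi hW hq hM fun z hz =>
    (norm_eval_div_eval_le_iff (hq z hz)).2 (hpq z hz)
  set x := ‖ratEval p q A‖
  rcases (norm_nonneg _ : 0 ≤ x).eq_or_lt with hx | hx
  · exact hx.symm.trans_le (by positivity)
  have hx3 : x ^ 3 ≤ 2 * M * x ^ 2 + C * (M * M * M) := le_of_mul_le_mul_right (by linarith) hx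
  refine le_of_pow_le_pow_left₀ three_ne_zero (by positivity) (hx3.trans ?_)
  calc 2 * M * x ^ 2 + C * (M * M * M) ≤ 2 * M * (C * M) ^ 2 + C * (M * M * M) := by gcongr
    _ = (K * M) ^ 3 := by rw [mul_pow K, hKC]; ring

theorem le_one_add_sqrt_two_of_pow_three_le {x : ℝ} (hx : x ^ 3 ≤ 2 * x ^ 2 + x) :
    x ≤ 1 + √2 := by
  by_contra! hlt
  have h2 := Real.sq_sqrt (zero_le_two (α := ℝ))
  have hpos : 0 < x := lt_trans (by positivity) hlt
  have hmul : 0 < x * ((x - (1 + √2)) * (x - 1 + √2)) :=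
    mul_pos hpos (mul_pos (sub_pos.2 hlt) (by linarith [Real.sqrt_nonneg 2]))
  have hid : x * ((x - (1 + √2)) * (x - 1 + √2)) = x ^ 3 - 2 * x ^ 2 - x := by
    linear_combination -x * h2
  linarith

/-- The infimum `K` of the spectral constants satisfies `K ^ 3 ≤ 2 K ^ 2 + K`. -/
theorem isSpectralConstant_of_exists (hD : IsCompact D) (hDc : Convex ℝ D)
    (hi : (interior D).Nonempty) (hW : ∀ x, ‖x‖ = 1 → inner ℂ x (A x) ∈ D)
    (hex : ∃ C, 0 ≤ C ∧ IsSpectralConstant A D C) : IsSpectralConstant A D (1 + √2) := by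
  set K := sInf {C | 0 ≤ C ∧ IsSpectralConstant A D C}
  have hK0 : 0 ≤ K := le_csInf hex fun C hC => hC.1
  have hK : IsSpectralConstant A D K := .sInf_mem hex
  have hcube : ((2 * K ^ 2 + K) ^ (3⁻¹ : ℝ)) ^ 3 = 2 * K ^ 2 + K :=
    Real.rpow_inv_natCast_pow (by positivity) three_ne_zero
  have himproved := hK.cbrt hK0 hD hDc hi hW (by positivity) hcube
  have hKle : K ≤ (2 * K ^ 2 + K) ^ (3⁻¹ : ℝ) :=
    csInf_le ⟨0, fun C hC => hC.1⟩ ⟨by positivity, himproved⟩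
  intro p q hq M hM hpq
  refine (hK p q hq M hM hpq).trans (mul_le_mul_of_nonneg_right ?_ hM)
  exact le_one_add_sqrt_two_of_pow_three_le ((pow_le_pow_left₀ hK0 hKle 3).trans_eq hcube)

theorem exists_isSpectralConstant_cthickening (hE : IsCompact E) (hc : Convex ℝ E)
    (hA : spectrum ℂ A ⊆ E) {δ : ℝ} (hδ : 0 < δ) :
    ∃ C, 0 ≤ C ∧ IsSpectralConstant A (cthickening δ E) C := by
  obtain ⟨χ, h⟩ := exists_isCutoff hc hδ
  refine ⟨‖(-(2 * Real.pi)⁻¹ : ℂ)‖ * ∫ z, ‖dbar χ z • resolvent A z‖, by positivity,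
    fun p q hq M _ hpq => ?_⟩
  have hi : Integrable fun z => dbar χ z • resolvent A z := by
    simpa using h.integrable hE hA (φ := 1) continuousOn_const
  rw [← h.cauchyTransform_eq_ratEval hE hA p fun z hz => hq z (h.tsupport_subset hz),
    cauchyTransform, norm_smul, mul_assoc, ← integral_mul_const]
  refine mul_le_mul_of_nonneg_left (norm_integral_le_of_norm_le (hi.norm.mul_const M)
    (Eventually.of_forall fun z => ?_)) (norm_nonneg _)
  by_cases hz : z ∈ tsupport χ
  · rw [smul_comm, norm_smul, mul_comm]
    gcongr
    have hzE := h.tsupport_subset hz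
    exact (norm_eval_div_eval_le_iff (hq z hzE)).2 (hpq z hzE)
  · have hd : dbar χ z = 0 := image_eq_zero_of_notMem_tsupport
      fun hz' => hz (tsupport_dbar_subset χ hz')
    simp [hd]

/-- The Crouzeix–Palencia theorem. -/
theorem isSpectralConstant_one_add_sqrt_two (hE : IsCompact E) (hc : Convex ℝ E)
    (hne : E.Nonempty) (hW : ∀ x, ‖x‖ = 1 → inner ℂ x (A x) ∈ E) :
    IsSpectralConstant A E (1 + √2) := by
  have hthick (δ : ℝ) (hδ : 0 < δ) : IsSpectralConstant A (cthickening δ E) (1 + √2) := by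
    refine isSpectralConstant_of_exists hE.cthickening (hc.cthickening δ) ?_
      (fun x hx => self_subset_cthickening E (hW x hx))
      (exists_isSpectralConstant_cthickening hE hc
        (spectrum_subset_of_inner_mem hE.isClosed hne hW) hδ)
    exact (hne.mono (self_subset_thickening hδ E)).mono
      (interior_maximal (thickening_subset_cthickening δ E) isOpen_thickening)
  intro p q hq M hM hpq
  refine le_of_forall_pos_le_add fun ε hε => ?_
  have hε' : 0 < ε / (1 + √2) := by positivity
  set U : Set ℂ := {z | q.eval z ≠ 0} ∩ {z | ‖p.eval z‖ < (M + ε / (1 + √2)) * ‖q.eval z‖}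
  have hU : IsOpen U := (isOpen_ne_fun q.continuous continuous_const).inter
    (isOpen_lt p.continuous.norm (q.continuous.norm.const_mul _))
  have hEU : E ⊆ U := fun z hz => ⟨hq z hz, (hpq z hz).trans_lt
    (mul_lt_mul_of_pos_right (by linarith) (norm_pos_iff.2 (hq z hz)))⟩
  obtain ⟨δ, hδ, hδU⟩ := hE.exists_cthickening_subset_open hU hEU
  calc ‖ratEval p q A‖ ≤ (1 + √2) * (M + ε / (1 + √2)) :=
        hthick δ hδ p q (fun z hz => (hδU hz).1) _ (by positivity) fun z hz => (hδU hz).2.le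
    _ = (1 + √2) * M + ε := by field_simp

end CrouzeixPalencia

section ToeplitzHausdorff

variable {H : Type*} [NormedAddCommGroup H] [InnerProductSpace ℂ H] {A : H →L[ℂ] H} {x y : H}

theorem inner_segment_apply (h0 : inner ℂ x (A x) = 0) (h1 : inner ℂ y (A y) = 1) (s : ℝ) :
    inner ℂ (((1 - s : ℝ) : ℂ) • x + (s : ℂ) • y) (A (((1 - s : ℝ) : ℂ) • x + (s : ℂ) • y))
      = ((1 - s) * s : ℝ) * (inner ℂ x (A y) + inner ℂ y (A x)) + (s ^ 2 : ℝ) := by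
  simp only [map_add, map_smul, inner_add_left, inner_add_right, inner_smul_left,
    inner_smul_right, h0, h1, Complex.conj_ofReal]
  push_cast
  ring

theorem segment_ne_zero (hx : x ≠ 0) (h0 : inner ℂ x (A x) = 0) (h1 : inner ℂ y (A y) = 1)
    (s : ℝ) : ((1 - s : ℝ) : ℂ) • x + (s : ℂ) • y ≠ 0 := by
  intro hs
  have hsy : (s : ℂ) • y = -(((1 - s : ℝ) : ℂ) • x) := eq_neg_of_add_eq_zero_right hs
  have hinner : (s : ℂ) * s = 0 := by
    have := congrArg (fun v => inner ℂ v (A v)) hsy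
    simpa [inner_smul_left, inner_smul_right, h0, h1] using this
  have hs0 : s = 0 := by exact_mod_cast mul_self_eq_zero.1 hinner
  exact hx (by simpa [hs0] using hs)

theorem exists_unit_inner_eq_of_im_eq_zero (hx : ‖x‖ = 1) (hy : ‖y‖ = 1)
    (h0 : inner ℂ x (A x) = 0) (h1 : inner ℂ y (A y) = 1)
    (him : (inner ℂ x (A y) + inner ℂ y (A x)).im = 0) {t : ℝ} (ht : t ∈ Set.Icc (0 : ℝ) 1) :
    ∃ u : H, ‖u‖ = 1 ∧ inner ℂ u (A u) = (t : ℂ) := by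
  have hne := segment_ne_zero (norm_ne_zero_iff.1 (by simp [hx])) h0 h1
  have hinner := inner_segment_apply h0 h1
  set u : ℝ → H := fun s => ((1 - s : ℝ) : ℂ) • x + (s : ℂ) • y with hu
  have hcont : Continuous u := by fun_prop
  set f : ℝ → ℝ := fun s => (inner ℂ (u s) (A (u s))).re / ‖u s‖ ^ 2 with hf
  have hfc : Continuous f := by
    refine Continuous.div ?_ (by fun_prop) fun s => pow_ne_zero _ (norm_ne_zero_iff.2 (hne s))
    exact Complex.continuous_re.comp (hcont.inner (A.continuous.comp hcont))
  have hf0 : f 0 = 0 := by simp [hf, hu, h0]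
  have hf1 : f 1 = 1 := by simp [hf, hu, h1, hy]
  obtain ⟨s, -, hs⟩ := intermediate_value_Icc zero_le_one hfc.continuousOn
    (by rwa [hf0, hf1] : t ∈ Set.Icc (f 0) (f 1))
  have hus : ‖u s‖ ≠ 0 := norm_ne_zero_iff.2 (hne s)
  have hreal : inner ℂ (u s) (A (u s)) = ((t * ‖u s‖ ^ 2 : ℝ) : ℂ) := by
    refine Complex.ext ?_ ?_
    · rw [Complex.ofReal_re, ← hs, hf]
      field_simp
    · rw [hinner, Complex.add_im, Complex.im_ofReal_mul, him, Complex.ofReal_im, Complex.ofReal_im,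
        mul_zero, add_zero]
  refine ⟨(‖u s‖⁻¹ : ℂ) • u s, by rw [norm_smul]; simp [hus], ?_⟩
  have hus' : (‖u s‖ : ℂ) ≠ 0 := by exact_mod_cast hus
  rw [map_smul, inner_smul_left, inner_smul_right, hreal, ← Complex.ofReal_inv, Complex.conj_ofReal]
  push_cast
  field_simp

theorem exists_norm_eq_one_im_mul_eq_zero (w : ℂ) : ∃ c : ℂ, ‖c‖ = 1 ∧ (c * w).im = 0 := by
  rcases eq_or_ne w 0 with rfl | hw
  · exact ⟨1, by simp, by simp⟩
  · refine ⟨‖w‖ / w, by simp [norm_ne_zero_iff.2 hw], ?_⟩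
    rw [div_mul_cancel₀ _ hw]
    exact Complex.ofReal_im _

theorem exists_unit_inner_eq_of_zero_one (hx : ‖x‖ = 1) (hy : ‖y‖ = 1)
    (h0 : inner ℂ x (A x) = 0) (h1 : inner ℂ y (A y) = 1) {t : ℝ} (ht : t ∈ Set.Icc (0 : ℝ) 1) :
    ∃ u : H, ‖u‖ = 1 ∧ inner ℂ u (A u) = (t : ℂ) := by
  obtain ⟨c, hc, hcim⟩ :=
    exists_norm_eq_one_im_mul_eq_zero (inner ℂ y (A x) - conj (inner ℂ x (A y)))
  refine exists_unit_inner_eq_of_im_eq_zero (x := c • x) (by rw [norm_smul, hc, hx, one_mul]) hy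
    (by rw [map_smul, inner_smul_left, inner_smul_right, h0, mul_zero, mul_zero]) h1 ?_ ht
  rw [mul_sub, Complex.sub_im, sub_eq_zero] at hcim
  rw [map_smul, inner_smul_left, inner_smul_right, Complex.add_im, hcim, ← Complex.add_im,
    show conj c * inner ℂ x (A y) = conj (c * conj (inner ℂ x (A y))) by
      rw [map_mul, Complex.conj_conj], Complex.add_im, Complex.conj_im, neg_add_cancel]

/-- The Toeplitz–Hausdorff theorem. -/
theorem convex_setOf_inner (A : H →L[ℂ] H) :
    Convex ℝ {z : ℂ | ∃ x, ‖x‖ = 1 ∧ inner ℂ x (A x) = z} := by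
  rintro _ ⟨x, hx, rfl⟩ _ ⟨y, hy, rfl⟩ a b ha hb hab
  set α := inner ℂ x (A x)
  set β := inner ℂ y (A y)
  rcases eq_or_ne α β with h | h
  · exact ⟨x, hx, by rw [← h, ← add_smul, hab, one_smul]⟩
  have hne : β - α ≠ 0 := sub_ne_zero.2 h.symm
  set B : H →L[ℂ] H := (β - α)⁻¹ • (A - α • ContinuousLinearMap.id ℂ H)
  have hB (v : H) (hv : ‖v‖ = 1) : inner ℂ v (B v) = (β - α)⁻¹ * (inner ℂ v (A v) - α) := by
    simp only [B, smul_apply, sub_apply, ContinuousLinearMap.id_apply, inner_smul_right,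
      inner_sub_right, inner_self_eq_norm_sq_to_K, hv]
    simp
  obtain ⟨u, hu, hub⟩ := exists_unit_inner_eq_of_zero_one (A := B) hx hy
    (by rw [hB x hx, sub_self, mul_zero]) (by rw [hB y hy, inv_mul_cancel₀ hne])
    (t := b) ⟨hb, by linarith⟩
  refine ⟨u, hu, ?_⟩
  rw [hB u hu, inv_mul_eq_iff_eq_mul₀ hne] at hub
  have hab' : (a : ℂ) + b = 1 := by exact_mod_cast hab
  simp only [Complex.real_smul]
  linear_combination hub - α * hab'

end ToeplitzHausdorff

section NumericalRange

variable {n : ℕ}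

theorem star_dotProduct_mulVec_eq_inner {ι : Type*} [Fintype ι] [DecidableEq ι]
    (B : Matrix ι ι ℂ) (x : EuclideanSpace ℂ ι) : star x.ofLp ⬝ᵥ (B *ᵥ x.ofLp)
      = inner ℂ x (Matrix.toEuclideanCLM (𝕜 := ℂ) B x) := by
  rw [EuclideanSpace.inner_eq_star_dotProduct, dotProduct_comm, Matrix.ofLp_toEuclideanCLM]

theorem numericalRange_eq (B : Matrix (Fin n) (Fin n) ℂ) : numericalRange B
    = {z : ℂ | ∃ x, ‖x‖ = 1 ∧ inner ℂ x (Matrix.toEuclideanCLM (𝕜 := ℂ) B x) = z} := by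
  simp only [numericalRange, star_dotProduct_mulVec_eq_inner]
  ext z
  exact exists_congr fun x => and_congr_right fun _ => eq_comm

theorem convex_numericalRange (B : Matrix (Fin n) (Fin n) ℂ) : Convex ℝ (numericalRange B) := by
  rw [numericalRange_eq]
  exact convex_setOf_inner _

theorem isCompact_numericalRange (B : Matrix (Fin n) (Fin n) ℂ) :
    IsCompact (numericalRange B) := by
  have himage : numericalRange B
      = (fun x => inner ℂ x (Matrix.toEuclideanCLM (𝕜 := ℂ) B x)) '' sphere 0 1 := by
    rw [numericalRange_eq]
    ext z
    simp
  rw [himage]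
  exact (isCompact_sphere _ _).image
    (continuous_id.inner (Matrix.toEuclideanCLM (𝕜 := ℂ) B).continuous)

theorem nonempty_numericalRange [NeZero n] (B : Matrix (Fin n) (Fin n) ℂ) :
    (numericalRange B).Nonempty :=
  ⟨_, EuclideanSpace.single 0 1, by simp, rfl⟩

variable (A F Q L : Matrix (Fin n) (Fin n) ℝ)

theorem convex_setE : Convex ℝ (setE A F Q L) :=
  (convex_numericalRange _).add ((convex_Icc _ _).linear_image Complex.ofRealCLM.toLinearMap)

theorem isCompact_setE : IsCompact (setE A F Q L) :=
  (isCompact_numericalRange _).add (isCompact_Icc.image Complex.continuous_ofReal)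

theorem nonempty_setE [NeZero n] : (setE A F Q L).Nonempty := by
  refine (nonempty_numericalRange _).add (Set.Nonempty.image _ ⟨0, ?_, le_rfl⟩)
  have hτ : 0 ≤ tau (L⁻¹ * A * L) := abs_nonneg _
  linarith [Real.sqrt_nonneg (tau (L⁻¹ * A * L) ^ 2 + ‖F‖ * ‖Q‖)]

end NumericalRange

section Rank

theorem rank_add_le {K ι κ : Type*} [Field K] [Finite ι] [Fintype κ] (A B : Matrix ι κ K) :
    (A + B).rank ≤ A.rank + B.rank := by
  rw [Matrix.rank, Matrix.mulVecLin_add]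
  exact (Submodule.finrank_mono (LinearMap.range_add_le _ _)).trans
    (Submodule.finrank_add_le_finrank_add_finrank _ _)

theorem rank_sum_le {K ι κ α : Type*} [Field K] [Finite ι] [Fintype κ] (s : Finset α)
    (M : α → Matrix ι κ K) : (∑ m ∈ s, M m).rank ≤ ∑ m ∈ s, (M m).rank :=
  Finset.le_sum_of_subadditive _ Matrix.rank_zero.le rank_add_le s M

theorem rank_map_ringHom_le {K L ι κ : Type*} [Field K] [Field L] [Finite ι] [Fintype κ]
    (f : K →+* L) (M : Matrix ι κ K) : (M.map f).rank ≤ M.rank := by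
  set V := Submodule.span K (Set.range M.col)
  have hV : Module.finrank K V = M.rank := M.rank_eq_finrank_span_cols.symm
  let b := Module.finBasisOfFinrankEq K V hV
  have hmem (j : κ) : M.col j ∈ V := Submodule.subset_span ⟨j, rfl⟩
  let U : Matrix ι (Fin M.rank) K := fun i k => (b k : ι → K) i
  let N : Matrix (Fin M.rank) κ K := fun k j => b.repr ⟨M.col j, hmem j⟩ k
  have hUN : M = U * N := by
    ext i j
    have h := congrArg (fun v : V => (v : ι → K) i) (b.sum_repr ⟨M.col j, hmem j⟩)
    simp only [AddSubmonoidClass.coe_finsetSum, Finset.sum_apply, SetLike.val_smul, Pi.smul_apply,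
      smul_eq_mul] at h
    rw [Matrix.mul_apply]
    exact h.symm.trans (Finset.sum_congr rfl fun k _ => mul_comm _ _)
  calc (M.map f).rank = (U.map f * N.map f).rank := by
        rw [← Matrix.map_mul, ← hUN]
    _ ≤ (U.map f).rank := Matrix.rank_mul_le_left _ _
    _ ≤ M.rank := by simpa using Matrix.rank_le_card_width (U.map f)

end Rank

section Sylvester

variable {K ι κ : Type*} [Field K] [Fintype ι] [Fintype κ] [DecidableEq ι]

/-- The block Krylov space of the matrices `∑_{m < d} Bᵐ R Nₘ`, which have rank at most
`d * R.rank`. -/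
def krylovSpan (B : Matrix ι ι K) (R : Matrix ι κ K) (d : ℕ) : Submodule K (Matrix ι κ K) where
  carrier := {D | ∃ N : ℕ → Matrix κ κ K, D = ∑ m ∈ Finset.range d, B ^ m * R * N m}
  zero_mem' := ⟨0, by simp⟩
  add_mem' := by
    rintro _ _ ⟨N₁, rfl⟩ ⟨N₂, rfl⟩
    exact ⟨N₁ + N₂, by simp [Matrix.mul_add, Finset.sum_add_distrib]⟩
  smul_mem' := by
    rintro c _ ⟨N, rfl⟩
    exact ⟨c • N, by simp [Finset.smul_sum]⟩

theorem rank_le_of_mem_krylovSpan {B : Matrix ι ι K} {R D : Matrix ι κ K} {d : ℕ}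
    (hD : D ∈ krylovSpan B R d) : D.rank ≤ d * R.rank := by
  obtain ⟨N, rfl⟩ := hD
  refine (rank_sum_le _ _).trans ((Finset.sum_le_card_nsmul _ _ R.rank fun m _ => ?_).trans ?_)
  · exact (Matrix.rank_mul_le_left _ _).trans (Matrix.rank_mul_le_right _ _)
  · simp

theorem pow_mul_mul_mem_krylovSpan (B : Matrix ι ι K) (R : Matrix ι κ K) {d m : ℕ} (hm : m < d)
    (N : Matrix κ κ K) : B ^ m * R * N ∈ krylovSpan B R d := by
  refine ⟨fun k => if k = m then N else 0, ?_⟩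
  rw [Finset.sum_eq_single_of_mem m (Finset.mem_range.2 hm) fun k _ hk => by simp [hk]]
  simp only [if_true]

variable [DecidableEq κ] (B : Matrix ι ι K) (C : Matrix κ κ K) (Y : Matrix ι κ K)

theorem pow_mul_sub_mul_pow (k : ℕ) :
    B ^ k * Y - Y * C ^ k
      = ∑ l ∈ Finset.range k, B ^ l * (B * Y - Y * C) * C ^ (k - 1 - l) := by
  induction k with
  | zero => simp
  | succ k ih =>
    have hsucc : B ^ (k + 1) * Y - Y * C ^ (k + 1)
        = (B ^ k * Y - Y * C ^ k) * C + B ^ k * (B * Y - Y * C) := by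
      rw [pow_succ, pow_succ, Matrix.sub_mul, Matrix.mul_sub]
      simp only [Matrix.mul_assoc]
      abel
    rw [hsucc, ih, Finset.sum_range_succ, Matrix.sum_mul]
    congr 1
    · refine Finset.sum_congr rfl fun l hl => ?_
      have hl' := Finset.mem_range.1 hl
      rw [show k + 1 - 1 - l = k - 1 - l + 1 by omega, pow_succ]
      simp only [Matrix.mul_assoc]
    · simp

theorem pow_mul_mul_pow_sub_mem_krylovSpan {i j d : ℕ} (hi : i ≤ d) (hj : j ≤ d) :
    B ^ i * Y * C ^ j - B ^ j * Y * C ^ i ∈ krylovSpan B (B * Y - Y * C) d := by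
  wlog hij : j ≤ i generalizing i j
  · rw [← neg_sub (B ^ j * Y * C ^ i)]
    exact Submodule.neg_mem _ (this hj hi (by omega))
  obtain ⟨k, rfl⟩ := Nat.exists_eq_add_of_le hij
  have hfactor : B ^ (j + k) * Y * C ^ j - B ^ j * Y * C ^ (j + k)
      = B ^ j * (B ^ k * Y - Y * C ^ k) * C ^ j := by
    rw [pow_add, pow_add, (Commute.pow_pow_self C j k).eq]
    simp only [Matrix.mul_sub, Matrix.sub_mul, Matrix.mul_assoc]
  rw [hfactor, pow_mul_sub_mul_pow, Matrix.mul_sum, Matrix.sum_mul]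
  refine Submodule.sum_mem _ fun l hl => ?_
  have hl' := Finset.mem_range.1 hl
  have hterm : B ^ j * (B ^ l * (B * Y - Y * C) * C ^ (k - 1 - l)) * C ^ j
      = B ^ (j + l) * (B * Y - Y * C) * (C ^ (k - 1 - l) * C ^ j) := by
    rw [pow_add]
    simp only [Matrix.mul_assoc]
  rw [hterm]
  exact pow_mul_mul_mem_krylovSpan _ _ (by omega) _

theorem aeval_mul_mul_aeval_sub_mem_krylovSpan {p q : K[X]} {d : ℕ} (hp : p.natDegree ≤ d)
    (hq : q.natDegree ≤ d) : aeval B p * Y * aeval C q - aeval B q * Y * aeval C p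
      ∈ krylovSpan B (B * Y - Y * C) d := by
  have hexpand : aeval B p * Y * aeval C q - aeval B q * Y * aeval C p
      = ∑ i ∈ Finset.range (d + 1), ∑ j ∈ Finset.range (d + 1), (p.coeff i * q.coeff j) •
        (B ^ i * Y * C ^ j - B ^ j * Y * C ^ i) := by
    simp only [aeval_eq_sum_range' (Nat.lt_succ_of_le hp),
      aeval_eq_sum_range' (Nat.lt_succ_of_le hq), Matrix.sum_mul, Matrix.mul_sum, smul_sub,
      Finset.sum_sub_distrib]
    congr 1
    · rw [Finset.sum_comm]
      refine Finset.sum_congr rfl fun i _ => Finset.sum_congr rfl fun j _ => ?_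
      simp [smul_smul, mul_comm]
    · refine Finset.sum_congr rfl fun i _ => Finset.sum_congr rfl fun j _ => ?_
      simp [smul_smul]
  rw [hexpand]
  exact Submodule.sum_mem _ fun i hi => Submodule.sum_mem _ fun j hj => Submodule.smul_mem _ _
    (pow_mul_mul_pow_sub_mem_krylovSpan B C Y (Finset.mem_range_succ_iff.1 hi)
      (Finset.mem_range_succ_iff.1 hj))

end Sylvester

section SylvesterApproximation

variable {ι κ : Type*} [Fintype ι] [Fintype κ] [DecidableEq κ]
  {B : Matrix ι ι ℂ} {C : Matrix κ κ ℂ} {E E' : Set ℂ} {p q : ℂ[X]} {M M' : ℝ}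

theorem isUnit_aeval_matrix [DecidableEq ι] (hE : IsClosed E) (hne : E.Nonempty)
    (hW : ∀ x : EuclideanSpace ℂ ι, ‖x‖ = 1 → star x.ofLp ⬝ᵥ (B *ᵥ x.ofLp) ∈ E)
    (hq : ∀ z ∈ E, q.eval z ≠ 0) : IsUnit (aeval B q) := by
  refine isUnit_aeval fun z hz => hq z ?_
  rw [← AlgEquiv.spectrum_eq (Matrix.toEuclideanCLM (n := ι) (𝕜 := ℂ)).toAlgEquiv B] at hz
  exact spectrum_subset_of_inner_mem hE hne
    (fun x hx => star_dotProduct_mulVec_eq_inner B x ▸ hW x hx) hz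

theorem norm_ratEval_matrix_le [DecidableEq ι] (hE : IsCompact E) (hc : Convex ℝ E)
    (hne : E.Nonempty)
    (hW : ∀ x : EuclideanSpace ℂ ι, ‖x‖ = 1 → star x.ofLp ⬝ᵥ (B *ᵥ x.ofLp) ∈ E)
    (hq : ∀ z ∈ E, q.eval z ≠ 0) (hM : 0 ≤ M) (hpq : ∀ z ∈ E, ‖p.eval z‖ ≤ M * ‖q.eval z‖) :
    ‖ratEval p q B‖ ≤ (1 + √2) * M := by
  have hmap : Matrix.toEuclideanCLM (𝕜 := ℂ) (ratEval p q B)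
      = ratEval p q (Matrix.toEuclideanCLM (𝕜 := ℂ) B) :=
    map_ratEval (Matrix.toEuclideanCLM (n := ι) (𝕜 := ℂ)).toAlgEquiv.toAlgHom
      (isUnit_aeval_matrix hE.isClosed hne hW hq)
  rw [← Matrix.l2_opNorm_toEuclideanCLM, hmap]
  exact isSpectralConstant_one_add_sqrt_two hE hc hne
    (fun x hx => star_dotProduct_mulVec_eq_inner B x ▸ hW x hx) p q hq M hM hpq

theorem sub_inverse_mul_mul_inverse [DecidableEq ι] (Y : Matrix ι κ ℂ) (hB : IsUnit (aeval B q))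
    (hC : IsUnit (aeval C p)) :
    Y - Ring.inverse (aeval B q) * (aeval B q * Y * aeval C p - aeval B p * Y * aeval C q)
        * Ring.inverse (aeval C p) = ratEval p q B * Y * ratEval q p C := by
  have hcomm : Ring.inverse (aeval B q) * aeval B p = ratEval p q B := by
    rw [eq_ratEval_iff hB, mul_assoc, (commute_aeval B p q).eq, Ring.inverse_mul_cancel_left _ _ hB]
  have hcancel : Ring.inverse (aeval B q) * (aeval B q * Y * aeval C p)
      * Ring.inverse (aeval C p) = Y := by
    rw [Matrix.mul_assoc, Matrix.mul_assoc, Matrix.mul_assoc, Ring.mul_inverse_cancel _ hC,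
      Matrix.mul_one, ← Matrix.mul_assoc, Ring.inverse_mul_cancel _ hB, Matrix.one_mul]
  rw [Matrix.mul_sub, Matrix.sub_mul, hcancel, sub_sub_cancel, ← hcomm, ratEval]
  simp only [Matrix.mul_assoc]

theorem exists_rank_le_norm_sub_le (Y : Matrix ι κ ℂ) (hE : IsCompact E) (hcE : Convex ℝ E)
    (hneE : E.Nonempty) (hE' : IsCompact E') (hcE' : Convex ℝ E') (hneE' : E'.Nonempty)
    (hB : ∀ x : EuclideanSpace ℂ ι, ‖x‖ = 1 → star x.ofLp ⬝ᵥ (B *ᵥ x.ofLp) ∈ E)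
    (hC : ∀ x : EuclideanSpace ℂ κ, ‖x‖ = 1 → star x.ofLp ⬝ᵥ (C *ᵥ x.ofLp) ∈ E')
    {d : ℕ} (hp : p.natDegree ≤ d) (hq : q.natDegree ≤ d) (hqE : ∀ z ∈ E, q.eval z ≠ 0)
    (hpE' : ∀ z ∈ E', p.eval z ≠ 0) (hM : 0 ≤ M) (hM' : 0 ≤ M')
    (hMp : ∀ z ∈ E, ‖p.eval z‖ ≤ M * ‖q.eval z‖) (hMq : ∀ z ∈ E', ‖q.eval z‖ ≤ M' * ‖p.eval z‖) :
    ∃ Z : Matrix ι κ ℂ, Z.rank ≤ d * (B * Y - Y * C).rank ∧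
      ‖Y - Z‖ ≤ (1 + √2) ^ 2 * (M * M') * ‖Y‖ := by
  classical
  have hqB := isUnit_aeval_matrix hE.isClosed hneE hB hqE
  have hpC := isUnit_aeval_matrix hE'.isClosed hneE' hC hpE'
  refine ⟨Ring.inverse (aeval B q) * (aeval B q * Y * aeval C p - aeval B p * Y * aeval C q)
    * Ring.inverse (aeval C p), ?_, ?_⟩
  · exact (Matrix.rank_mul_le_left _ _).trans ((Matrix.rank_mul_le_right _ _).trans
      (rank_le_of_mem_krylovSpan (aeval_mul_mul_aeval_sub_mem_krylovSpan B C Y hq hp)))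
  · rw [sub_inverse_mul_mul_inverse Y hqB hpC]
    calc ‖ratEval p q B * Y * ratEval q p C‖ ≤ ‖ratEval p q B‖ * ‖Y‖ * ‖ratEval q p C‖ :=
          (Matrix.l2_opNorm_mul _ _).trans (mul_le_mul_of_nonneg_right (Matrix.l2_opNorm_mul _ _)
            (norm_nonneg _))
      _ ≤ (1 + √2) * M * ‖Y‖ * ((1 + √2) * M') := by
          gcongr
          · exact norm_ratEval_matrix_le hE hcE hneE hB hqE hM hMp
          · exact norm_ratEval_matrix_le hE' hcE' hneE' hC hpE' hM' hMq
      _ = (1 + √2) ^ 2 * (M * M') * ‖Y‖ := by ring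

end SylvesterApproximation

section Complexification

variable {ι κ : Type*}

/-- The vector `a + i b` with real part `a` and imaginary part `b`. -/
def complexify (a b : EuclideanSpace ℝ κ) : EuclideanSpace ℂ κ :=
  WithLp.toLp 2 fun j => a j + b j * Complex.I

theorem exists_eq_complexify (x : EuclideanSpace ℂ κ) : ∃ a b, x = complexify a b :=
  ⟨WithLp.toLp 2 fun j => (x j).re, WithLp.toLp 2 fun j => (x j).im,
    WithLp.ofLp_injective 2 (funext fun j => (Complex.re_add_im (x j)).symm)⟩

theorem complexify_sum_re_im {α : Type*} [Fintype α] (v : α → EuclideanSpace ℝ κ) (c : α → ℂ) :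
    complexify (∑ i, (c i).re • v i) (∑ i, (c i).im • v i)
      = WithLp.toLp 2 ((Matrix.of fun j i => (v i j : ℂ)) *ᵥ c) := by
  refine WithLp.ofLp_injective 2 (funext fun j => ?_)
  simp only [complexify, Matrix.mulVec, dotProduct, Matrix.of_apply, WithLp.ofLp_sum,
    Finset.sum_apply, WithLp.ofLp_smul, Pi.smul_apply, smul_eq_mul]
  push_cast
  rw [Finset.sum_mul, ← Finset.sum_add_distrib]
  refine Finset.sum_congr rfl fun i _ => ?_
  conv_rhs => rw [← Complex.re_add_im (c i)]
  ring

variable [Fintype κ]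

theorem norm_sq_complexify (a b : EuclideanSpace ℝ κ) :
    ‖complexify a b‖ ^ 2 = ‖a‖ ^ 2 + ‖b‖ ^ 2 := by
  rw [EuclideanSpace.norm_sq_eq, EuclideanSpace.norm_sq_eq, EuclideanSpace.norm_sq_eq,
    ← Finset.sum_add_distrib]
  refine Finset.sum_congr rfl fun i _ => ?_
  rw [Complex.sq_norm, complexify, Complex.normSq_add_mul_I]
  simp

theorem map_ofReal_mulVec_complexify (M : Matrix ι κ ℝ) (a b : EuclideanSpace ℝ κ) :
    WithLp.toLp 2 (M.map Complex.ofReal *ᵥ (complexify a b).ofLp)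
      = complexify (WithLp.toLp 2 (M *ᵥ a.ofLp)) (WithLp.toLp 2 (M *ᵥ b.ofLp)) := by
  refine WithLp.ofLp_injective 2 (funext fun i => ?_)
  simp only [complexify, Matrix.mulVec, dotProduct, Matrix.map_apply]
  push_cast
  rw [Finset.sum_mul, ← Finset.sum_add_distrib]
  exact Finset.sum_congr rfl fun j _ => by ring

theorem norm_map_ofReal_le [Fintype ι] [DecidableEq κ] (M : Matrix ι κ ℝ) :
    ‖M.map Complex.ofReal‖ ≤ ‖M‖ := by
  rw [Matrix.l2_opNorm_def (M.map Complex.ofReal)]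
  refine ContinuousLinearMap.opNorm_le_bound _ (norm_nonneg _) fun x => ?_
  obtain ⟨a, b, rfl⟩ := exists_eq_complexify x
  have hsq : ‖WithLp.toLp 2 (M.map Complex.ofReal *ᵥ (complexify a b).ofLp)‖ ^ 2
      ≤ (‖M‖ * ‖complexify a b‖) ^ 2 := by
    rw [map_ofReal_mulVec_complexify, norm_sq_complexify, mul_pow, norm_sq_complexify, mul_add,
      ← mul_pow, ← mul_pow]
    gcongr
    · exact Matrix.l2_opNorm_mulVec M a
    · exact Matrix.l2_opNorm_mulVec M b
  exact (sq_le_sq₀ (norm_nonneg _) (by positivity)).1 hsq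

theorem dotProduct_mulVec_comm {R : Type*} [CommSemiring R] {S : Matrix κ κ R} (hS : S.IsSymm)
    (a b : κ → R) : a ⬝ᵥ (S *ᵥ b) = b ⬝ᵥ (S *ᵥ a) := by
  rw [Matrix.dotProduct_mulVec, ← Matrix.mulVec_transpose, hS, dotProduct_comm]

theorem star_dotProduct_map_ofReal_mulVec {S : Matrix κ κ ℝ} (hS : S.IsSymm)
    (a b : EuclideanSpace ℝ κ) :
    star (complexify a b).ofLp ⬝ᵥ (S.map Complex.ofReal *ᵥ (complexify a b).ofLp)
      = ((a.ofLp ⬝ᵥ (S *ᵥ a.ofLp) + b.ofLp ⬝ᵥ (S *ᵥ b.ofLp) : ℝ) : ℂ) := by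
  have hexpand : star (complexify a b).ofLp ⬝ᵥ
      (S.map Complex.ofReal *ᵥ (complexify a b).ofLp)
      = ((a.ofLp ⬝ᵥ (S *ᵥ a.ofLp) + b.ofLp ⬝ᵥ (S *ᵥ b.ofLp) : ℝ) : ℂ)
        + ((a.ofLp ⬝ᵥ (S *ᵥ b.ofLp) - b.ofLp ⬝ᵥ (S *ᵥ a.ofLp) : ℝ) : ℂ) * Complex.I := by
    have hS := congrArg WithLp.ofLp (map_ofReal_mulVec_complexify S a b)
    rw [WithLp.ofLp_toLp] at hS
    rw [hS]
    simp only [dotProduct, complexify]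
    push_cast
    rw [← Finset.sum_add_distrib, ← Finset.sum_sub_distrib, Finset.sum_mul,
      ← Finset.sum_add_distrib]
    refine Finset.sum_congr rfl fun j _ => ?_
    simp only [Pi.star_apply, RCLike.star_def, map_add, map_mul, Complex.conj_ofReal,
      Complex.conj_I]
    linear_combination (-(b j : ℂ) * ((S *ᵥ b.ofLp) j : ℂ)) * Complex.I_mul_I
  rw [hexpand, dotProduct_mulVec_comm hS a.ofLp b.ofLp, sub_self]
  simp

end Complexification

section SingularValues

theorem norm_sq_sum_smul_of_orthonormal {𝕜 V α : Type*} [RCLike 𝕜] [NormedAddCommGroup V]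
    [InnerProductSpace 𝕜 V] [Fintype α] {v : α → V} (hv : Orthonormal 𝕜 v) (c : α → 𝕜) :
    ‖∑ i, c i • v i‖ ^ 2 = ∑ i, ‖c i‖ ^ 2 := by
  have h := hv.inner_sum c c Finset.univ
  simp only [inner_self_eq_norm_sq_to_K, RCLike.conj_mul] at h
  exact_mod_cast h

theorem norm_sq_complexify_sum_re_im {α κ : Type*} [Fintype α] [Fintype κ]
    {v : α → EuclideanSpace ℝ κ} (hv : Orthonormal ℝ v) (c : α → ℂ) :
    ‖complexify (∑ i, (c i).re • v i) (∑ i, (c i).im • v i)‖ ^ 2 = ∑ i, ‖c i‖ ^ 2 := by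
  rw [norm_sq_complexify, norm_sq_sum_smul_of_orthonormal hv, norm_sq_sum_smul_of_orthonormal hv,
    ← Finset.sum_add_distrib]
  refine Finset.sum_congr rfl fun i _ => ?_
  rw [Complex.sq_norm, Complex.normSq_apply, Real.norm_eq_abs, Real.norm_eq_abs, sq_abs, sq_abs,
    sq, sq]

theorem exists_orthonormal_singularValues_mul_norm_le {𝕜 V W : Type*} [RCLike 𝕜]
    [NormedAddCommGroup V] [InnerProductSpace 𝕜 V] [FiniteDimensional 𝕜 V]
    [NormedAddCommGroup W] [InnerProductSpace 𝕜 W] [FiniteDimensional 𝕜 W] (T : V →ₗ[𝕜] W)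
    {r : ℕ} (hr : r < Module.finrank 𝕜 V) : ∃ v : Fin (r + 1) → V, Orthonormal 𝕜 v ∧
      ∀ c : Fin (r + 1) → 𝕜, T.singularValues r * ‖∑ i, c i • v i‖ ≤ ‖T (∑ i, c i • v i)‖ := by
  have hS : (T.adjoint ∘ₗ T).IsSymmetric := T.isSymmetric_adjoint_comp_self
  let f : Fin (r + 1) → Fin (Module.finrank 𝕜 V) := Fin.castLE hr
  let v : Fin (r + 1) → V := hS.eigenvectorBasis rfl ∘ f
  have hv : Orthonormal 𝕜 v :=
    (hS.eigenvectorBasis rfl).orthonormal.comp f (Fin.castLE_injective hr)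
  refine ⟨v, hv, fun c => abs_le_of_sq_le_sq' ?_ (norm_nonneg _) |>.2⟩
  have happly : T.adjoint (T (∑ i, c i • v i))
      = ∑ i, ((T.singularValues (f i) ^ 2 : ℝ) * c i : 𝕜) • v i := by
    change (T.adjoint ∘ₗ T) (∑ i, c i • v i) = _
    rw [map_sum]
    refine Finset.sum_congr rfl fun i _ => ?_
    rw [map_smul, mul_comm, mul_smul, T.sq_singularValues_fin rfl (f i)]
    exact congrArg (c i • ·) (hS.apply_eigenvectorBasis rfl (f i))
  have hnorm : ‖T (∑ i, c i • v i)‖ ^ 2 = ∑ i, T.singularValues (f i) ^ 2 * ‖c i‖ ^ 2 := by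
    have h : (‖T (∑ i, c i • v i)‖ ^ 2 : 𝕜)
        = ∑ i, (T.singularValues (f i) ^ 2 * ‖c i‖ ^ 2 : 𝕜) := by
      rw [← inner_self_eq_norm_sq_to_K, ← LinearMap.adjoint_inner_right, happly, hv.inner_sum]
      refine Finset.sum_congr rfl fun i _ => ?_
      rw [mul_left_comm, RCLike.conj_mul]
      push_cast
      rfl
    exact_mod_cast h
  rw [mul_pow, norm_sq_sum_smul_of_orthonormal hv, hnorm, Finset.mul_sum]
  refine Finset.sum_le_sum fun i _ => ?_
  have hle : T.singularValues r ≤ T.singularValues (f i) :=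
    T.singularValues_antitone (by simpa [f] using Nat.lt_succ_iff.1 i.2)
  have := T.singularValues_nonneg r
  gcongr

theorem exists_mulVec_eq_zero_of_rank_lt {K ι κ : Type*} [Field K] [Fintype κ]
    {M : Matrix ι κ K} (hM : M.rank < Fintype.card κ) : ∃ c ≠ 0, M *ᵥ c = 0 := by
  by_contra! hcon
  have hker : LinearMap.ker M.mulVecLin = ⊥ :=
    LinearMap.ker_eq_bot'.2 fun c hc => of_not_not fun hne => hcon c hne hc
  have hrank : M.rank = Fintype.card κ := by
    rw [Matrix.rank, LinearMap.finrank_range_of_inj (LinearMap.ker_eq_bot.1 hker)]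
    simp
  omega

variable {ι κ : Type*} [Fintype ι] [Fintype κ] [DecidableEq κ]

theorem sigma_antitone (M : Matrix ι κ ℝ) : Antitone fun i => sigma i M := fun _ _ h =>
  LinearMap.singularValues_antitone _ (Nat.sub_le_sub_right h 1)

theorem sigma_le_norm_sub (M : Matrix ι κ ℝ) (Z : Matrix ι κ ℂ) :
    sigma (Z.rank + 1) M ≤ ‖M.map Complex.ofReal - Z‖ := by
  set T := Matrix.toEuclideanLin M
  rw [sigma, Nat.add_sub_cancel]
  rcases le_or_gt (Module.finrank ℝ (EuclideanSpace ℝ κ)) Z.rank with hle | hlt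
  · rw [T.singularValues_of_finrank_le hle]
    exact norm_nonneg _
  obtain ⟨v, hv, hT⟩ := exists_orthonormal_singularValues_mul_norm_le T hlt
  let V : Matrix κ (Fin (Z.rank + 1)) ℂ := Matrix.of fun j i => (v i j : ℂ)
  obtain ⟨c, hc0, hc⟩ : ∃ c ≠ 0, (Z * V) *ᵥ c = 0 :=
    exists_mulVec_eq_zero_of_rank_lt (by
      simpa [Nat.lt_succ_iff] using Matrix.rank_mul_le_left Z V)
  set a := ∑ i, (c i).re • v i
  set b := ∑ i, (c i).im • v i
  have hw : complexify a b = WithLp.toLp 2 (V *ᵥ c) := complexify_sum_re_im v c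
  have hw0 : 0 < ‖complexify a b‖ := by
    obtain ⟨i, hi⟩ := Function.ne_iff.1 hc0
    have hpos : 0 < ∑ i, ‖c i‖ ^ 2 := Finset.sum_pos' (fun i _ => by positivity)
      ⟨i, Finset.mem_univ i, by have := norm_pos_iff.2 hi; positivity⟩
    rw [← norm_sq_complexify_sum_re_im hv] at hpos
    exact (norm_nonneg _).lt_of_ne' (sq_pos_iff.1 hpos)
  have hupper : ‖WithLp.toLp 2 (M.map Complex.ofReal *ᵥ (complexify a b).ofLp)‖
      ≤ ‖M.map Complex.ofReal - Z‖ * ‖complexify a b‖ := by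
    have hZw : Z *ᵥ (complexify a b).ofLp = 0 := by rw [hw, Matrix.mulVec_mulVec, hc]
    have hsub := Matrix.l2_opNorm_mulVec (M.map Complex.ofReal - Z) (complexify a b)
    rwa [Matrix.sub_mulVec, hZw, sub_zero] at hsub
  have hlower : (T.singularValues Z.rank * ‖complexify a b‖) ^ 2
      ≤ ‖WithLp.toLp 2 (M.map Complex.ofReal *ᵥ (complexify a b).ofLp)‖ ^ 2 := by
    rw [map_ofReal_mulVec_complexify, norm_sq_complexify, mul_pow, norm_sq_complexify, mul_add,
      ← mul_pow, ← mul_pow]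
    have := T.singularValues_nonneg Z.rank
    gcongr
    · exact hT fun i => (c i).re
    · exact hT fun i => (c i).im
  exact le_of_mul_le_mul_right ((abs_le_of_sq_le_sq' hlower (norm_nonneg _)).2.trans hupper) hw0

open scoped ComplexOrder in
theorem sigma_transpose_le_norm_sub [DecidableEq ι] (M : Matrix ι κ ℝ) (Z : Matrix ι κ ℂ) :
    sigma (Z.rank + 1) Mᵀ ≤ ‖M.map Complex.ofReal - Z‖ := by
  have hmap : Mᵀ.map Complex.ofReal = (M.map Complex.ofReal)ᴴ := by
    ext
    simp
  have h := sigma_le_norm_sub Mᵀ Zᴴ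
  rwa [hmap, ← Matrix.conjTranspose_sub, Matrix.l2_opNorm_conjTranspose,
    Matrix.rank_conjTranspose] at h

end SingularValues

section Compression

variable {𝕜 : Type*} [RCLike 𝕜] {ι κ μ : Type*} [Fintype ι] [DecidableEq ι]

theorem submatrix_eq_mul_mul (M : Matrix ι ι 𝕜) (f : μ → ι) (g : κ → ι) : M.submatrix f g
    = ((1 : Matrix ι ι 𝕜).submatrix id f)ᴴ * M * (1 : Matrix ι ι 𝕜).submatrix id g := by
  rw [Matrix.conjTranspose_submatrix, Matrix.conjTranspose_one]
  ext i j
  simp [Matrix.mul_apply, Matrix.one_apply]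

variable [Fintype κ] {g : κ → ι}

theorem star_dotProduct_submatrix_mulVec (M : Matrix ι ι 𝕜) (u : κ → 𝕜) :
    star u ⬝ᵥ (M.submatrix g g *ᵥ u) = star ((1 : Matrix ι ι 𝕜).submatrix id g *ᵥ u) ⬝ᵥ
      (M *ᵥ ((1 : Matrix ι ι 𝕜).submatrix id g *ᵥ u)) := by
  rw [submatrix_eq_mul_mul, Matrix.star_mulVec, ← Matrix.dotProduct_mulVec, Matrix.mulVec_mulVec,
    Matrix.mulVec_mulVec, Matrix.mul_assoc]

theorem norm_one_submatrix_mulVec (hg : Function.Injective g) (u : EuclideanSpace 𝕜 κ) :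
    ‖WithLp.toLp 2 ((1 : Matrix ι ι 𝕜).submatrix id g *ᵥ u.ofLp)‖ = ‖u‖ := by
  classical
  have h := star_dotProduct_submatrix_mulVec (g := g) (1 : Matrix ι ι 𝕜) u.ofLp
  rw [Matrix.submatrix_one _ hg, Matrix.one_mulVec, Matrix.one_mulVec, dotProduct_comm,
    dotProduct_comm (star _)] at h
  rw [@norm_eq_sqrt_re_inner 𝕜, @norm_eq_sqrt_re_inner 𝕜, EuclideanSpace.inner_eq_star_dotProduct,
    EuclideanSpace.inner_eq_star_dotProduct, h]

theorem norm_one_submatrix_le [DecidableEq κ] (hg : Function.Injective g) :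
    ‖(1 : Matrix ι ι 𝕜).submatrix id g‖ ≤ 1 := by
  rw [Matrix.l2_opNorm_def]
  exact ContinuousLinearMap.opNorm_le_bound _ zero_le_one fun u =>
    (norm_one_submatrix_mulVec hg u).le.trans_eq (one_mul _).symm

theorem norm_submatrix_le [DecidableEq κ] [Fintype μ] (M : Matrix ι ι 𝕜) {f : μ → ι}
    (hf : Function.Injective f) (hg : Function.Injective g) : ‖M.submatrix f g‖ ≤ ‖M‖ := by
  classical
  rw [submatrix_eq_mul_mul]
  refine (Matrix.l2_opNorm_mul _ _).trans ?_
  refine (mul_le_of_le_one_right (norm_nonneg _) (norm_one_submatrix_le hg)).trans ?_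
  refine (Matrix.l2_opNorm_mul _ _).trans (mul_le_of_le_one_left (norm_nonneg _) ?_)
  rw [Matrix.l2_opNorm_conjTranspose]
  exact norm_one_submatrix_le hf

end Compression

section Zolotarev

variable {S T : Set ℂ} {p q : ℂ[X]}

theorem iSup_ratModulus_ne_top (hS : IsCompact S) (p : ℂ[X]) (hq : ∀ z ∈ S, q.eval z ≠ 0) :
    ⨆ z ∈ S, ratModulus p q z ≠ ⊤ := by
  obtain ⟨K, hK⟩ := hS.exists_bound_of_continuousOn
    (p.continuous.continuousOn.div q.continuous.continuousOn hq)
  refine ((iSup₂_le fun z hz => ?_).trans_lt (ENNReal.ofReal_lt_top (r := K))).ne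
  have hdiv : ratModulus p q z = ‖p.eval z / q.eval z‖ₑ := by
    rw [ratModulus, div_eq_mul_inv (p.eval z), enorm_mul, enorm_inv (hq z hz)]
    rfl
  rw [hdiv, ← ofReal_norm]
  exact ENNReal.ofReal_le_ofReal (hK z hz)

theorem norm_eval_le_iSup_ratModulus_mul (hS : IsCompact S) (p : ℂ[X])
    (hq : ∀ z ∈ S, q.eval z ≠ 0) {z : ℂ} (hz : z ∈ S) :
    ‖p.eval z‖ ≤ (⨆ z ∈ S, ratModulus p q z).toReal * ‖q.eval z‖ := by
  have hle : ratModulus p q z ≤ ⨆ z ∈ S, ratModulus p q z :=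
    le_iSup₂ (f := fun z (_ : z ∈ S) => ratModulus p q z) z hz
  have hreal := ENNReal.toReal_mono (iSup_ratModulus_ne_top hS p hq) hle
  rwa [ratModulus, ENNReal.toReal_div, toReal_enorm, toReal_enorm,
    div_le_iff₀ (norm_pos_iff.2 (hq z hz))] at hreal

theorem zolotarevRatio_eq_mul (q : ℂ[X]) (S : Set ℂ) (hp : ∀ z ∈ T, p.eval z ≠ 0) :
    zolotarevRatio p q S T = (⨆ z ∈ S, ratModulus p q z) * ⨆ z ∈ T, ratModulus q p z := by
  rw [zolotarevRatio, div_eq_mul_inv]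
  congr 1
  simp only [ENNReal.inv_iInf]
  refine iSup_congr fun z => iSup_congr fun hz => ?_
  exact ENNReal.inv_div (Or.inr enorm_ne_top) (Or.inr (by simpa using hp z hz))

theorem le_mul_zolotarev {h : ℕ} (hS : IsCompact S) (hT : IsCompact T) {x c : ℝ} (hc : 0 ≤ c)
    (hx : ∀ p q : ℂ[X], p.natDegree ≤ h → q.natDegree ≤ h → (∀ z ∈ S, q.eval z ≠ 0) →
      (∀ z ∈ T, p.eval z ≠ 0) →
      x ≤ c * ((⨆ z ∈ S, ratModulus p q z).toReal * (⨆ z ∈ T, ratModulus q p z).toReal)) :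
    x ≤ c * zolotarev h S T := by
  rcases hc.eq_or_lt with rfl | hc
  · simpa using hx 1 1 (by simp) (by simp) (by simp) (by simp)
  rw [← div_le_iff₀' hc]
  have hfin : zolotarevENN h S T ≠ ⊤ := ne_top_of_le_ne_top ENNReal.one_ne_top
    (zolotarevENN_le_one h S T)
  refine (ENNReal.ofReal_le_iff_le_toReal hfin).1 ?_
  refine le_iInf fun p => le_iInf fun q => le_iInf fun ⟨hp, hq, hqS, hpT⟩ => ?_
  rw [zolotarevRatio_eq_mul q S hpT, ENNReal.ofReal_le_iff_le_toReal (ENNReal.mul_ne_top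
    (iSup_ratModulus_ne_top hS p hqS) (iSup_ratModulus_ne_top hT q hpT)), ENNReal.toReal_mul,
    div_le_iff₀' hc]
  exact hx p q hp hq hqS hpT

end Zolotarev

section Blocks

variable {n : ℕ}

/-- The block `M(1:s, 1:s)`. -/
def headBlock (M : Matrix (Fin n) (Fin n) ℝ) (s : ℕ) :
    Matrix {i : Fin n // (i : ℕ) < s} {j : Fin n // (j : ℕ) < s} ℝ :=
  M.toBlock (fun i => (i : ℕ) < s) (fun j => (j : ℕ) < s)

/-- The block `M(s+1:n, s+1:n)`. -/
def tailBlock (M : Matrix (Fin n) (Fin n) ℝ) (s : ℕ) :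
    Matrix {i : Fin n // s ≤ (i : ℕ)} {j : Fin n // s ≤ (j : ℕ)} ℝ :=
  M.toBlock (fun i => s ≤ (i : ℕ)) (fun j => s ≤ (j : ℕ))

theorem sum_eq_sum_head_add_sum_tail (f : Fin n → ℝ) (s : ℕ) :
    ∑ i, f i = (∑ i : {i : Fin n // (i : ℕ) < s}, f i) + ∑ i : {i : Fin n // s ≤ (i : ℕ)}, f i := by
  rw [← Fintype.sum_subtype_add_sum_subtype (fun i : Fin n => (i : ℕ) < s) f]
  congr 1
  exact Fintype.sum_equiv (Equiv.subtypeEquivRight fun i => not_lt) _ _ fun _ => rfl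

theorem upperBlock_one (s : ℕ) : upperBlock (1 : Matrix (Fin n) (Fin n) ℝ) s = 0 := by
  ext i j
  exact Matrix.one_apply_ne (Fin.lt_def.2 (i.2.trans_le j.2)).ne

theorem lowerBlock_one (s : ℕ) : lowerBlock (1 : Matrix (Fin n) (Fin n) ℝ) s = 0 := by
  ext i j
  exact Matrix.one_apply_ne (Fin.lt_def.2 (j.2.trans_le i.2)).ne'

theorem headBlock_one (s : ℕ) : headBlock (1 : Matrix (Fin n) (Fin n) ℝ) s = 1 :=
  Matrix.submatrix_one _ Subtype.val_injective

variable (M N : Matrix (Fin n) (Fin n) ℝ) (s : ℕ)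

theorem lowerBlock_mul : lowerBlock (M * N) s
    = lowerBlock M s * headBlock N s + tailBlock M s * lowerBlock N s := by
  ext i j
  exact sum_eq_sum_head_add_sum_tail _ s

theorem headBlock_mul : headBlock (M * N) s
    = headBlock M s * headBlock N s + upperBlock M s * lowerBlock N s := by
  ext i j
  exact sum_eq_sum_head_add_sum_tail _ s

theorem upperBlock_mul : upperBlock (M * N) s
    = headBlock M s * upperBlock N s + upperBlock M s * tailBlock N s := by
  ext i j
  exact sum_eq_sum_head_add_sum_tail _ s

theorem rank_lowerBlock_mul_le : (lowerBlock (M * N) s).rank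
    ≤ (lowerBlock M s).rank + (lowerBlock N s).rank := by
  rw [lowerBlock_mul]
  exact (rank_add_le _ _).trans
    (add_le_add (Matrix.rank_mul_le_left _ _) (Matrix.rank_mul_le_right _ _))

theorem rank_upperBlock_mul_le : (upperBlock (M * N) s).rank
    ≤ (upperBlock M s).rank + (upperBlock N s).rank := by
  rw [upperBlock_mul, add_comm (upperBlock M s).rank]
  exact (rank_add_le _ _).trans
    (add_le_add (Matrix.rank_mul_le_right _ _) (Matrix.rank_mul_le_left _ _))

theorem lowerBlock_transpose : lowerBlock Mᵀ s = (upperBlock M s)ᵀ := rfl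

theorem rank_lowerBlock_transpose : (lowerBlock Mᵀ s).rank = (upperBlock M s).rank :=
  (upperBlock M s).rank_transpose

theorem rank_lowerBlock_le_qsrank {s : ℕ} (hs : 1 ≤ s) (hsn : s < n) :
    (lowerBlock M s).rank ≤ qsrank M :=
  (le_max_left _ _).trans (Finset.le_sup
    (f := fun s => max (lowerBlock M s).rank (upperBlock M s).rank) (Finset.mem_Ico.2 ⟨hs, hsn⟩))

theorem rank_upperBlock_le_qsrank {s : ℕ} (hs : 1 ≤ s) (hsn : s < n) :
    (upperBlock M s).rank ≤ qsrank M :=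
  (le_max_right _ _).trans (Finset.le_sup
    (f := fun s => max (lowerBlock M s).rank (upperBlock M s).rank) (Finset.mem_Ico.2 ⟨hs, hsn⟩))

end Blocks

section Cholesky

variable {n : ℕ} {L F : Matrix (Fin n) (Fin n) ℝ}

theorem IsCholeskyFactor.isUnit_det (h : IsCholeskyFactor L F) : IsUnit L.det := by
  rw [Matrix.det_of_isLowerTriangular L fun i j hij => h.lower i j hij]
  exact (Finset.prod_pos fun i _ => h.diag_pos i).ne'.isUnit

theorem IsCholeskyFactor.inv_mul (h : IsCholeskyFactor L F) : L⁻¹ * L = 1 :=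
  Matrix.nonsing_inv_mul L h.isUnit_det

theorem IsCholeskyFactor.mul_inv (h : IsCholeskyFactor L F) : L * L⁻¹ = 1 :=
  Matrix.mul_nonsing_inv L h.isUnit_det

theorem IsCholeskyFactor.upperBlock_eq_zero (h : IsCholeskyFactor L F) (s : ℕ) :
    upperBlock L s = 0 := by
  ext i j
  exact h.lower _ _ (Fin.lt_def.2 (i.2.trans_le j.2))

theorem IsCholeskyFactor.headBlock_mul_headBlock_inv (h : IsCholeskyFactor L F) (s : ℕ) :
    headBlock L s * headBlock L⁻¹ s = 1 := by
  have hone := headBlock_mul L L⁻¹ s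
  rw [h.mul_inv, headBlock_one, h.upperBlock_eq_zero, Matrix.zero_mul, add_zero] at hone
  exact hone.symm

theorem IsCholeskyFactor.headBlock_inv_mul_headBlock (h : IsCholeskyFactor L F) (s : ℕ) :
    headBlock L⁻¹ s * headBlock L s = 1 :=
  mul_eq_one_comm.1 (h.headBlock_mul_headBlock_inv s)

theorem IsCholeskyFactor.upperBlock_inv_eq_zero (h : IsCholeskyFactor L F) (s : ℕ) :
    upperBlock L⁻¹ s = 0 := by
  have hzero := upperBlock_mul L L⁻¹ s
  rw [h.mul_inv, upperBlock_one, h.upperBlock_eq_zero, Matrix.zero_mul, add_zero] at hzero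
  rw [← Matrix.one_mul (upperBlock L⁻¹ s), ← h.headBlock_inv_mul_headBlock, Matrix.mul_assoc,
    ← hzero, Matrix.mul_zero]

theorem IsCholeskyFactor.lowerBlock_eq_mul (h : IsCholeskyFactor L F) (s : ℕ) :
    lowerBlock L s = lowerBlock F s * (headBlock L⁻¹ s)ᵀ := by
  have hF : lowerBlock F s = lowerBlock L s * (headBlock L s)ᵀ := by
    have hLt : lowerBlock Lᵀ s = 0 := by
      rw [lowerBlock_transpose, h.upperBlock_eq_zero, Matrix.transpose_zero]
    rw [← h.mul_transpose, lowerBlock_mul, hLt, Matrix.mul_zero, add_zero]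
    rfl
  rw [hF, Matrix.mul_assoc, ← Matrix.transpose_mul, h.headBlock_inv_mul_headBlock,
    Matrix.transpose_one, Matrix.mul_one]

theorem IsCholeskyFactor.lowerBlock_inv_eq_mul (h : IsCholeskyFactor L F) (s : ℕ) :
    lowerBlock L⁻¹ s = -tailBlock L⁻¹ s * (lowerBlock L s * headBlock L⁻¹ s) := by
  have hzero := lowerBlock_mul L⁻¹ L s
  rw [h.inv_mul, lowerBlock_one] at hzero
  rw [← Matrix.mul_assoc, Matrix.neg_mul, ← eq_neg_of_add_eq_zero_left hzero.symm,
    Matrix.mul_assoc, h.headBlock_mul_headBlock_inv, Matrix.mul_one]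

theorem IsCholeskyFactor.rank_lowerBlock_le (h : IsCholeskyFactor L F) (s : ℕ) :
    (lowerBlock L s).rank ≤ (lowerBlock F s).rank := by
  rw [h.lowerBlock_eq_mul]
  exact Matrix.rank_mul_le_left _ _

theorem IsCholeskyFactor.rank_lowerBlock_inv_le (h : IsCholeskyFactor L F) (s : ℕ) :
    (lowerBlock L⁻¹ s).rank ≤ (lowerBlock F s).rank := by
  rw [h.lowerBlock_inv_eq_mul]
  exact (Matrix.rank_mul_le_right _ _).trans
    ((Matrix.rank_mul_le_left _ _).trans (h.rank_lowerBlock_le s))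

theorem IsCholeskyFactor.norm_mul_self (h : IsCholeskyFactor L F) : ‖L‖ * ‖L‖ = ‖F‖ := by
  have hnorm := Matrix.l2_opNorm_conjTranspose_mul_self Lᴴ
  rw [Matrix.conjTranspose_conjTranspose, Matrix.l2_opNorm_conjTranspose,
    Matrix.conjTranspose_eq_transpose_of_trivial, h.mul_transpose] at hnorm
  exact hnorm.symm

theorem IsCholeskyFactor.norm_inv_mul_self (h : IsCholeskyFactor L F) :
    ‖L⁻¹‖ * ‖L⁻¹‖ = ‖F⁻¹‖ := by
  have hnorm := Matrix.l2_opNorm_conjTranspose_mul_self L⁻¹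
  rw [Matrix.conjTranspose_eq_transpose_of_trivial, Matrix.transpose_nonsing_inv,
    ← Matrix.mul_inv_rev, h.mul_transpose] at hnorm
  exact hnorm.symm

theorem IsCholeskyFactor.norm_transpose_mul_mul_le (h : IsCholeskyFactor L F)
    (M : Matrix (Fin n) (Fin n) ℝ) : ‖Lᵀ * M * L‖ ≤ ‖F‖ * ‖M‖ := by
  calc ‖Lᵀ * M * L‖ ≤ ‖Lᵀ‖ * ‖M‖ * ‖L‖ := by
        grw [norm_mul_le, norm_mul_le]
    _ = ‖F‖ * ‖M‖ := by
        rw [← Matrix.conjTranspose_eq_transpose_of_trivial, Matrix.l2_opNorm_conjTranspose,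
          ← h.norm_mul_self]
        ring

end Cholesky

section QuadraticForm

variable {ι : Type*} [Fintype ι]

theorem real_inner_toLp_mulVec (M : Matrix ι ι ℝ) (x y : EuclideanSpace ℝ ι) :
    inner ℝ x (WithLp.toLp 2 (M *ᵥ y.ofLp)) = x.ofLp ⬝ᵥ (M *ᵥ y.ofLp) := by
  rw [EuclideanSpace.inner_eq_star_dotProduct, star_trivial, dotProduct_comm]

theorem dotProduct_mulVec_le [DecidableEq ι] (M : Matrix ι ι ℝ) (x : EuclideanSpace ℝ ι) :
    x.ofLp ⬝ᵥ (M *ᵥ x.ofLp) ≤ ‖M‖ * ‖x‖ ^ 2 := by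
  calc x.ofLp ⬝ᵥ (M *ᵥ x.ofLp) = inner ℝ x (WithLp.toLp 2 (M *ᵥ x.ofLp)) :=
        (real_inner_toLp_mulVec M x x).symm
    _ ≤ ‖x‖ * (‖M‖ * ‖x‖) := by
        grw [real_inner_le_norm]
        gcongr
        exact Matrix.l2_opNorm_mulVec M x
    _ = ‖M‖ * ‖x‖ ^ 2 := by ring

theorem exists_eigenvector_forall_dotProduct_mulVec_le [Nonempty ι] {S : Matrix ι ι ℝ}
    (hS : S.IsSymm) : ∃ (μ : ℝ) (v : EuclideanSpace ℝ ι), ‖v‖ = 1 ∧ S *ᵥ v.ofLp = μ • v.ofLp ∧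
      ∀ x : EuclideanSpace ℝ ι, x.ofLp ⬝ᵥ (S *ᵥ x.ofLp) ≤ μ * ‖x‖ ^ 2 := by
  classical
  have hherm : S.IsHermitian := Matrix.isHermitian_iff_isSymm.2 hS
  set b := hherm.eigenvectorBasis
  obtain ⟨i, hi⟩ := Finite.exists_max hherm.eigenvalues
  refine ⟨hherm.eigenvalues i, b i, b.norm_eq_one i, hherm.mulVec_eigenvectorBasis i, fun x => ?_⟩
  have hcoeff (j : ι) :
      inner ℝ (b j) (WithLp.toLp 2 (S *ᵥ x.ofLp)) = hherm.eigenvalues j * inner ℝ x (b j) := by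
    rw [real_inner_toLp_mulVec, dotProduct_mulVec_comm hS, hherm.mulVec_eigenvectorBasis,
      dotProduct_smul, EuclideanSpace.inner_eq_star_dotProduct, star_trivial,
      dotProduct_comm, smul_eq_mul]
  rw [← real_inner_toLp_mulVec, ← b.sum_inner_mul_inner, ← b.sum_sq_inner_left x,
    Finset.mul_sum]
  refine Finset.sum_le_sum fun j _ => ?_
  calc inner ℝ x (b j) * inner ℝ (b j) (WithLp.toLp 2 (S *ᵥ x.ofLp))
      = hherm.eigenvalues j * inner ℝ x (b j) ^ 2 := by
        rw [hcoeff]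
        ring
    _ ≤ hherm.eigenvalues i * inner ℝ x (b j) ^ 2 := by
        gcongr
        exact hi j

variable {A Q X : Matrix ι ι ℝ}

theorem sq_eigenvalue_mul_eq_of_riccati (hX : X.IsSymm)
    (h : Aᵀ * X + X * A - X * X + Q = 0) {μ : ℝ} {v : ι → ℝ} (hv : X *ᵥ v = μ • v) :
    μ ^ 2 * (v ⬝ᵥ v) = 2 * μ * (v ⬝ᵥ (A *ᵥ v)) + v ⬝ᵥ (Q *ᵥ v) := by
  have hform := congrArg (fun M : Matrix ι ι ℝ => v ⬝ᵥ (M *ᵥ v)) h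
  have hvX : v ᵥ* X = μ • v := by rw [← hv, ← Matrix.mulVec_transpose, hX]
  have hleft (M : Matrix ι ι ℝ) : v ⬝ᵥ ((X * M) *ᵥ v) = μ * (v ⬝ᵥ (M *ᵥ v)) := by
    rw [← Matrix.mulVec_mulVec, Matrix.dotProduct_mulVec, hvX, smul_dotProduct, smul_eq_mul]
  have hright : v ⬝ᵥ ((Aᵀ * X) *ᵥ v) = μ * (v ⬝ᵥ (A *ᵥ v)) := by
    rw [← Matrix.mulVec_mulVec, hv, Matrix.mulVec_smul, dotProduct_smul,
      Matrix.dotProduct_mulVec, Matrix.vecMul_transpose, dotProduct_comm, smul_eq_mul]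
  simp only [Matrix.add_mulVec, Matrix.sub_mulVec, dotProduct_add, dotProduct_sub, hleft, hright,
    hv, dotProduct_smul, Matrix.zero_mulVec, dotProduct_zero, smul_eq_mul] at hform
  linear_combination -hform

theorem dotProduct_mulVec_le_sqrt_norm_of_riccati [DecidableEq ι] (hX : X.PosSemidef)
    (h : Aᵀ * X + X * A - X * X + Q = 0)
    (hA : ∀ v : EuclideanSpace ℝ ι, ‖v‖ = 1 → v.ofLp ⬝ᵥ (A *ᵥ v.ofLp) ≤ 0)
    (x : EuclideanSpace ℝ ι) : x.ofLp ⬝ᵥ (X *ᵥ x.ofLp) ≤ √‖Q‖ * ‖x‖ ^ 2 := by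
  rcases isEmpty_or_nonempty ι with hι | hι
  · simp [Subsingleton.elim x 0]
  have hsymm : X.IsSymm := Matrix.isHermitian_iff_isSymm.1 hX.isHermitian
  obtain ⟨μ, v, hv, heig, hμ⟩ := exists_eigenvector_forall_dotProduct_mulVec_le hsymm
  have hvv : v.ofLp ⬝ᵥ v.ofLp = 1 := by
    rw [← one_pow (M := ℝ) 2, ← hv, ← real_inner_self_eq_norm_sq,
      EuclideanSpace.inner_eq_star_dotProduct, star_trivial]
  have hμ0 : 0 ≤ μ := by
    have hnonneg := hX.dotProduct_mulVec_nonneg v.ofLp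
    rwa [star_trivial, heig, dotProduct_smul, hvv, smul_eq_mul, mul_one] at hnonneg
  have hμ2 : μ ^ 2 ≤ ‖Q‖ := by
    have hsq := sq_eigenvalue_mul_eq_of_riccati hsymm h heig
    have hQ := dotProduct_mulVec_le Q v
    rw [hv, one_pow, mul_one] at hQ
    rw [hvv, mul_one] at hsq
    linarith [mul_nonpos_of_nonneg_of_nonpos hμ0 (hA v hv)]
  exact (hμ x).trans (by grw [Real.le_sqrt_of_sq_le hμ2])

end QuadraticForm

section ClosedLoop

variable {n : ℕ}

theorem star_dotProduct_submatrix_mulVec_mem_numericalRange {κ : Type*} [Fintype κ]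
    {g : κ → Fin n} (hg : Function.Injective g) (B : Matrix (Fin n) (Fin n) ℂ)
    {u : EuclideanSpace ℂ κ} (hu : ‖u‖ = 1) :
    star u.ofLp ⬝ᵥ (B.submatrix g g *ᵥ u.ofLp) ∈ numericalRange B :=
  ⟨_, (norm_one_submatrix_mulVec hg u).trans hu, star_dotProduct_submatrix_mulVec B u.ofLp⟩

theorem numericalRange_transpose_subset (B : Matrix (Fin n) (Fin n) ℂ) :
    numericalRange Bᵀ ⊆ numericalRange B := by
  rintro _ ⟨x, hx, rfl⟩
  refine ⟨WithLp.toLp 2 (star x.ofLp), ?_, ?_⟩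
  · rw [← hx, EuclideanSpace.norm_eq, EuclideanSpace.norm_eq]
    simp
  · rw [Matrix.dotProduct_mulVec, Matrix.vecMul_transpose, star_star, dotProduct_comm]

theorem ofReal_dotProduct_mulVec_mem_realNumericalRange (M : Matrix (Fin n) (Fin n) ℝ)
    {v : EuclideanSpace ℝ (Fin n)} (hv : ‖v‖ = 1) :
    ((v.ofLp ⬝ᵥ (M *ᵥ v.ofLp) : ℝ) : ℂ) ∈ realNumericalRange M := by
  refine ⟨complexify v 0, ?_, ?_⟩
  · rw [← sq_eq_sq₀ (norm_nonneg _) zero_le_one, norm_sq_complexify, hv, norm_zero]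
    ring
  · simp [complexify, dotProduct, Matrix.mulVec]

theorem realNumericalRange_sub_subset {S : Matrix (Fin n) (Fin n) ℝ} (hS : S.PosSemidef) {c : ℝ}
    (hc : ∀ x : EuclideanSpace ℝ (Fin n), x.ofLp ⬝ᵥ (S *ᵥ x.ofLp) ≤ c * ‖x‖ ^ 2)
    (M : Matrix (Fin n) (Fin n) ℝ) : realNumericalRange (M - S)
      ⊆ realNumericalRange M + Complex.ofReal '' Set.Icc (-c) 0 := by
  rintro _ ⟨x, hx, rfl⟩
  obtain ⟨a, b, rfl⟩ := exists_eq_complexify x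
  have hform := star_dotProduct_map_ofReal_mulVec (Matrix.isHermitian_iff_isSymm.1 hS.isHermitian)
    a b
  set t := a.ofLp ⬝ᵥ (S *ᵥ a.ofLp) + b.ofLp ⬝ᵥ (S *ᵥ b.ofLp)
  have ht0 : 0 ≤ t :=
    add_nonneg (hS.dotProduct_mulVec_nonneg a.ofLp) (hS.dotProduct_mulVec_nonneg b.ofLp)
  have htc : t ≤ c := by
    calc t ≤ c * ‖a‖ ^ 2 + c * ‖b‖ ^ 2 := add_le_add (hc a) (hc b)
      _ = c := by rw [← mul_add, ← norm_sq_complexify, hx, one_pow, mul_one]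
  refine Set.mem_add.2 ⟨_, ⟨complexify a b, hx, rfl⟩, ((-t : ℝ) : ℂ),
    ⟨-t, ⟨neg_le_neg htc, neg_nonpos.2 ht0⟩, rfl⟩, ?_⟩
  rw [Matrix.map_sub _ Complex.ofReal_sub, Matrix.sub_mulVec, dotProduct_sub, hform]
  push_cast
  ring

variable {A F Q X L : Matrix (Fin n) (Fin n) ℝ}

theorem IsCholeskyFactor.riccati (hL : IsCholeskyFactor L F)
    (h : Aᵀ * X + X * A - X * F * X + Q = 0) :
    (L⁻¹ * A * L)ᵀ * (Lᵀ * X * L) + Lᵀ * X * L * (L⁻¹ * A * L)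
      - Lᵀ * X * L * (Lᵀ * X * L) + Lᵀ * Q * L = 0 := by
  have hinv : L⁻¹ᵀ * Lᵀ = 1 := by rw [← Matrix.transpose_mul, hL.mul_inv, Matrix.transpose_one]
  have hleft : (L⁻¹ * A * L)ᵀ * (Lᵀ * X * L) = Lᵀ * (Aᵀ * X) * L := by
    calc (L⁻¹ * A * L)ᵀ * (Lᵀ * X * L) = Lᵀ * Aᵀ * (L⁻¹ᵀ * Lᵀ) * X * L := by
          simp only [Matrix.transpose_mul, Matrix.mul_assoc]
      _ = _ := by rw [hinv, Matrix.mul_one, Matrix.mul_assoc Lᵀ Aᵀ X]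
  have hright : Lᵀ * X * L * (L⁻¹ * A * L) = Lᵀ * (X * A) * L := by
    calc Lᵀ * X * L * (L⁻¹ * A * L) = Lᵀ * X * (L * L⁻¹) * A * L := by
          simp only [Matrix.mul_assoc]
      _ = _ := by rw [hL.mul_inv, Matrix.mul_one, Matrix.mul_assoc Lᵀ X A]
  have hquad : Lᵀ * X * L * (Lᵀ * X * L) = Lᵀ * (X * F * X) * L := by
    rw [← hL.mul_transpose]
    simp only [Matrix.mul_assoc]
  rw [hleft, hright, hquad, ← Matrix.add_mul, ← Matrix.mul_add, ← Matrix.sub_mul,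
    ← Matrix.mul_sub, ← Matrix.add_mul, ← Matrix.mul_add, h, Matrix.mul_zero, Matrix.zero_mul]

theorem posSemidef_transpose_mul_mul (hX : X.PosSemidef) (L : Matrix (Fin n) (Fin n) ℝ) :
    (Lᵀ * X * L).PosSemidef := by
  rw [← Matrix.conjTranspose_eq_transpose_of_trivial]
  exact hX.conjTranspose_mul_mul_same L

theorem IsCholeskyFactor.realNumericalRange_closedLoop_subset_setE (hL : IsCholeskyFactor L F)
    (hX : X.PosSemidef) (hCARE : Aᵀ * X + X * A - X * F * X + Q = 0)
    (hW : realNumericalRange (L⁻¹ * A * L) ⊆ {z : ℂ | z.re ≤ 0}) :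
    realNumericalRange (L⁻¹ * A * L - Lᵀ * X * L) ⊆ setE A F Q L := by
  have hX' := posSemidef_transpose_mul_mul hX L
  have hbound := dotProduct_mulVec_le_sqrt_norm_of_riccati hX' (hL.riccati hCARE)
    fun v hv => hW (ofReal_dotProduct_mulVec_mem_realNumericalRange _ hv)
  refine (realNumericalRange_sub_subset hX' hbound _).trans
    (Set.add_subset_add_left (Set.image_mono (Set.Icc_subset_Icc_left ?_)))
  have hτ : 0 ≤ tau (L⁻¹ * A * L) := abs_nonneg _
  have hsqrt : √‖Lᵀ * Q * L‖ ≤ √(tau (L⁻¹ * A * L) ^ 2 + ‖F‖ * ‖Q‖) :=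
    Real.sqrt_le_sqrt ((hL.norm_transpose_mul_mul_le Q).trans
      (le_add_of_nonneg_left (sq_nonneg _)))
  linarith

end ClosedLoop

section Riccati

variable {n s : ℕ} {A F Q X L : Matrix (Fin n) (Fin n) ℝ}

theorem tailBlock_mul_lowerBlock_add_of_riccati (s : ℕ) (h : Aᵀ * X + X * A - X * X + Q = 0) :
    tailBlock (Aᵀ - X) s * lowerBlock X s + lowerBlock X s * headBlock (A - X) s
      = -(lowerBlock Aᵀ s * headBlock X s + tailBlock X s * lowerBlock A s + lowerBlock Q s) := by
  have hblock : lowerBlock (Aᵀ * X) s + lowerBlock (X * A) s - lowerBlock (X * X) s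
      + lowerBlock Q s = 0 :=
    congrArg (fun M => lowerBlock M s) h
  have htail : tailBlock (Aᵀ - X) s = tailBlock Aᵀ s - tailBlock X s := rfl
  have hhead : headBlock (A - X) s = headBlock A s - headBlock X s := rfl
  simp only [lowerBlock_mul] at hblock
  rw [htail, hhead, Matrix.sub_mul, Matrix.mul_sub, ← sub_eq_zero, ← hblock]
  abel

theorem rank_tailBlock_mul_lowerBlock_add_le_of_riccati (s : ℕ)
    (h : Aᵀ * X + X * A - X * X + Q = 0) :
    (tailBlock (Aᵀ - X) s * lowerBlock X s + lowerBlock X s * headBlock (A - X) s).rank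
      ≤ (upperBlock A s).rank + (lowerBlock A s).rank + (lowerBlock Q s).rank := by
  rw [tailBlock_mul_lowerBlock_add_of_riccati s h, ← Matrix.one_mul (_ + _), ← Matrix.neg_mul,
    ← rank_lowerBlock_transpose]
  refine (Matrix.rank_mul_le_right _ _).trans ((rank_add_le _ _).trans ?_)
  gcongr
  exact (rank_add_le _ _).trans
    (add_le_add (Matrix.rank_mul_le_left _ _) (Matrix.rank_mul_le_right _ _))

theorem exists_rank_le_norm_lowerBlock_sub_le_of_riccati (hX : X.IsSymm)
    (h : Aᵀ * X + X * A - X * X + Q = 0) {E : Set ℂ} (hE : IsCompact E) (hcE : Convex ℝ E)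
    (hneE : E.Nonempty) (hAX : realNumericalRange (A - X) ⊆ E) (s : ℕ) {p q : ℂ[X]} {d : ℕ}
    (hp : p.natDegree ≤ d) (hq : q.natDegree ≤ d) (hqE : ∀ z ∈ E, q.eval z ≠ 0)
    (hpE : ∀ z ∈ -E, p.eval z ≠ 0) {M M' : ℝ} (hM : 0 ≤ M) (hM' : 0 ≤ M')
    (hMp : ∀ z ∈ E, ‖p.eval z‖ ≤ M * ‖q.eval z‖) (hMq : ∀ z ∈ -E, ‖q.eval z‖ ≤ M' * ‖p.eval z‖) :
    ∃ Z : Matrix {i : Fin n // s ≤ (i : ℕ)} {j : Fin n // (j : ℕ) < s} ℂ,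
      Z.rank ≤ d * ((upperBlock A s).rank + (lowerBlock A s).rank + (lowerBlock Q s).rank) ∧
      ‖(lowerBlock X s).map Complex.ofReal - Z‖
        ≤ (1 + √2) ^ 2 * (M * M') * ‖(lowerBlock X s).map Complex.ofReal‖ := by
  have hB (u : EuclideanSpace ℂ {i : Fin n // s ≤ (i : ℕ)}) (hu : ‖u‖ = 1) :
      star u.ofLp ⬝ᵥ ((tailBlock (Aᵀ - X) s).map Complex.ofReal *ᵥ u.ofLp) ∈ E := by
    have htranspose : Aᵀ - X = (A - X)ᵀ := by rw [Matrix.transpose_sub, hX]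
    rw [htranspose]
    exact hAX (numericalRange_transpose_subset _
      (star_dotProduct_submatrix_mulVec_mem_numericalRange Subtype.val_injective _ hu))
  have hC (u : EuclideanSpace ℂ {j : Fin n // (j : ℕ) < s}) (hu : ‖u‖ = 1) :
      star u.ofLp ⬝ᵥ (-(headBlock (A - X) s).map Complex.ofReal *ᵥ u.ofLp) ∈ -E := by
    rw [Set.mem_neg, Matrix.neg_mulVec, dotProduct_neg, neg_neg]
    exact hAX (star_dotProduct_submatrix_mulVec_mem_numericalRange Subtype.val_injective _ hu)
  obtain ⟨Z, hZ, hXZ⟩ := exists_rank_le_norm_sub_le ((lowerBlock X s).map Complex.ofReal)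
    hE hcE hneE hE.neg hcE.neg hneE.neg hB hC hp hq hqE hpE hM hM' hMp hMq
  refine ⟨Z, hZ.trans (Nat.mul_le_mul_left d ?_), hXZ⟩
  have hmap : (tailBlock (Aᵀ - X) s).map Complex.ofReal * (lowerBlock X s).map Complex.ofReal
      - (lowerBlock X s).map Complex.ofReal * -(headBlock (A - X) s).map Complex.ofReal
      = (tailBlock (Aᵀ - X) s * lowerBlock X s
        + lowerBlock X s * headBlock (A - X) s).map Complex.ofRealHom := by
    rw [Matrix.mul_neg, sub_neg_eq_add, Matrix.map_add _ Complex.ofRealHom.map_add,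
      Matrix.map_mul, Matrix.map_mul]
    rfl
  rw [hmap]
  exact (rank_map_ringHom_le _ _).trans (rank_tailBlock_mul_lowerBlock_add_le_of_riccati s h)

theorem IsCholeskyFactor.rank_upperBlock_inv_mul_mul_le (hL : IsCholeskyFactor L F)
    (A : Matrix (Fin n) (Fin n) ℝ) (s : ℕ) :
    (upperBlock (L⁻¹ * A * L) s).rank ≤ (upperBlock A s).rank := by
  calc (upperBlock (L⁻¹ * A * L) s).rank
      ≤ (upperBlock L⁻¹ s).rank + (upperBlock A s).rank + (upperBlock L s).rank := by
        grw [rank_upperBlock_mul_le, rank_upperBlock_mul_le]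
    _ = (upperBlock A s).rank := by
        rw [hL.upperBlock_inv_eq_zero, hL.upperBlock_eq_zero, Matrix.rank_zero,
          zero_add, add_zero]

theorem IsCholeskyFactor.rank_lowerBlock_inv_mul_mul_le (hL : IsCholeskyFactor L F)
    (A : Matrix (Fin n) (Fin n) ℝ) (s : ℕ) :
    (lowerBlock (L⁻¹ * A * L) s).rank ≤ (lowerBlock A s).rank + 2 * (lowerBlock F s).rank := by
  calc (lowerBlock (L⁻¹ * A * L) s).rank
      ≤ (lowerBlock L⁻¹ s).rank + (lowerBlock A s).rank + (lowerBlock L s).rank := by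
        grw [rank_lowerBlock_mul_le, rank_lowerBlock_mul_le]
    _ ≤ (lowerBlock F s).rank + (lowerBlock A s).rank + (lowerBlock F s).rank := by
        grw [hL.rank_lowerBlock_inv_le, hL.rank_lowerBlock_le]
    _ = (lowerBlock A s).rank + 2 * (lowerBlock F s).rank := by ring

theorem IsCholeskyFactor.rank_lowerBlock_transpose_mul_mul_le (hL : IsCholeskyFactor L F)
    (Q : Matrix (Fin n) (Fin n) ℝ) (s : ℕ) :
    (lowerBlock (Lᵀ * Q * L) s).rank ≤ (lowerBlock Q s).rank + (lowerBlock F s).rank := by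
  calc (lowerBlock (Lᵀ * Q * L) s).rank
      ≤ (lowerBlock Lᵀ s).rank + (lowerBlock Q s).rank + (lowerBlock L s).rank := by
        grw [rank_lowerBlock_mul_le, rank_lowerBlock_mul_le]
    _ ≤ (lowerBlock Q s).rank + (lowerBlock F s).rank := by
        rw [rank_lowerBlock_transpose, hL.upperBlock_eq_zero, Matrix.rank_zero, zero_add]
        grw [hL.rank_lowerBlock_le]

theorem IsCholeskyFactor.lowerBlock_eq_transpose_mul_add (hL : IsCholeskyFactor L F)
    (X : Matrix (Fin n) (Fin n) ℝ) (s : ℕ) : lowerBlock X s = (tailBlock L⁻¹ s)ᵀ *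
      (lowerBlock (Lᵀ * X * L) s * headBlock L⁻¹ s
        + tailBlock (Lᵀ * X * L) s * lowerBlock L⁻¹ s) := by
  have hinv : L⁻¹ᵀ * Lᵀ = 1 := by rw [← Matrix.transpose_mul, hL.mul_inv, Matrix.transpose_one]
  have hX : X = L⁻¹ᵀ * (Lᵀ * X * L * L⁻¹) := by
    rw [Matrix.mul_assoc (Lᵀ * X), hL.mul_inv, Matrix.mul_one, ← Matrix.mul_assoc, hinv,
      Matrix.one_mul]
  have hzero : lowerBlock L⁻¹ᵀ s = 0 := by
    rw [lowerBlock_transpose, hL.upperBlock_inv_eq_zero, Matrix.transpose_zero]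
  conv_lhs => rw [hX, lowerBlock_mul, hzero, Matrix.zero_mul, zero_add, lowerBlock_mul]
  rfl

theorem norm_map_ofReal_submatrix_le {α β : Type*} [Fintype α] [Fintype β] [DecidableEq β]
    (M : Matrix (Fin n) (Fin n) ℝ) {f : α → Fin n} {g : β → Fin n} (hf : Function.Injective f)
    (hg : Function.Injective g) : ‖(M.submatrix f g).map Complex.ofReal‖ ≤ ‖M‖ :=
  (norm_map_ofReal_le _).trans (norm_submatrix_le M hf hg)

theorem IsCholeskyFactor.exists_rank_le_norm_lowerBlock_sub_le (hL : IsCholeskyFactor L F)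
    (X : Matrix (Fin n) (Fin n) ℝ)
    (Z : Matrix {i : Fin n // s ≤ (i : ℕ)} {j : Fin n // (j : ℕ) < s} ℂ) :
    ∃ W : Matrix {i : Fin n // s ≤ (i : ℕ)} {j : Fin n // (j : ℕ) < s} ℂ,
      W.rank ≤ Z.rank + (lowerBlock F s).rank ∧
      ‖(lowerBlock X s).map Complex.ofReal - W‖
        ≤ ‖F⁻¹‖ * ‖(lowerBlock (Lᵀ * X * L) s).map Complex.ofReal - Z‖ := by
  set P := ((tailBlock L⁻¹ s)ᵀ).map Complex.ofRealHom
  set H := (headBlock L⁻¹ s).map Complex.ofRealHom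
  set T := (tailBlock (Lᵀ * X * L) s).map Complex.ofRealHom
  set K := (lowerBlock L⁻¹ s).map Complex.ofRealHom
  have hP : ‖P‖ ≤ ‖L⁻¹‖ := by
    rw [← Matrix.l2_opNorm_conjTranspose L⁻¹, Matrix.conjTranspose_eq_transpose_of_trivial]
    exact norm_map_ofReal_submatrix_le L⁻¹ᵀ Subtype.val_injective Subtype.val_injective
  have hH : ‖H‖ ≤ ‖L⁻¹‖ :=
    norm_map_ofReal_submatrix_le L⁻¹ Subtype.val_injective Subtype.val_injective
  refine ⟨P * (Z * H + T * K), ?_, ?_⟩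
  · grw [Matrix.rank_mul_le_right, rank_add_le, Matrix.rank_mul_le_left, Matrix.rank_mul_le_right,
      rank_map_ringHom_le, hL.rank_lowerBlock_inv_le]
  · have hsub : (lowerBlock X s).map Complex.ofReal - P * (Z * H + T * K)
        = P * (((lowerBlock (Lᵀ * X * L) s).map Complex.ofReal - Z) * H) := by
      have hmap : (lowerBlock X s).map Complex.ofReal
          = P * ((lowerBlock (Lᵀ * X * L) s).map Complex.ofReal * H + T * K) := by
        rw [hL.lowerBlock_eq_transpose_mul_add X s]
        change Matrix.map _ Complex.ofRealHom = _
        rw [Matrix.map_mul, Matrix.map_add _ Complex.ofRealHom.map_add, Matrix.map_mul,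
          Matrix.map_mul]
        rfl
      rw [hmap, ← Matrix.mul_sub, add_sub_add_right_eq_sub, Matrix.sub_mul]
    calc ‖(lowerBlock X s).map Complex.ofReal - P * (Z * H + T * K)‖
        ≤ ‖P‖ * (‖(lowerBlock (Lᵀ * X * L) s).map Complex.ofReal - Z‖ * ‖H‖) := by
          grw [hsub, Matrix.l2_opNorm_mul, Matrix.l2_opNorm_mul]
      _ ≤ ‖L⁻¹‖ * (‖(lowerBlock (Lᵀ * X * L) s).map Complex.ofReal - Z‖ * ‖L⁻¹‖) := by gcongr
      _ = ‖F⁻¹‖ * ‖(lowerBlock (Lᵀ * X * L) s).map Complex.ofReal - Z‖ := by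
          rw [← hL.norm_inv_mul_self]
          ring

theorem sigma_offDiag_le {W : Matrix {i : Fin n // s ≤ (i : ℕ)} {j : Fin n // (j : ℕ) < s} ℂ}
    (hX : X.IsSymm) {k : ℕ} (hW : W.rank < k) :
    max (sigma k (lowerBlock X s)) (sigma k (upperBlock X s))
      ≤ ‖(lowerBlock X s).map Complex.ofReal - W‖ := by
  have hupper : upperBlock X s = (lowerBlock X s)ᵀ := by
    conv_lhs => rw [← hX]
    rfl
  rw [hupper]
  exact max_le ((sigma_antitone _ hW).trans (sigma_le_norm_sub _ W))
    ((sigma_antitone _ hW).trans (sigma_transpose_le_norm_sub _ W))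

theorem IsCholeskyFactor.sigma_offDiag_le (hL : IsCholeskyFactor L F) (hX : X.PosSemidef)
    (hCARE : Aᵀ * X + X * A - X * F * X + Q = 0)
    (hW : realNumericalRange (L⁻¹ * A * L) ⊆ {z : ℂ | z.re ≤ 0}) (hs : 1 ≤ s) (hsn : s < n)
    {h k : ℕ} (hk : h * (2 * qsrank A + 3 * qsrank F + qsrank Q) + qsrank F < k)
    {p q : ℂ[X]} (hp : p.natDegree ≤ h) (hq : q.natDegree ≤ h)
    (hqE : ∀ z ∈ setE A F Q L, q.eval z ≠ 0) (hpE : ∀ z ∈ -setE A F Q L, p.eval z ≠ 0)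
    {M M' : ℝ} (hM : 0 ≤ M) (hM' : 0 ≤ M')
    (hMp : ∀ z ∈ setE A F Q L, ‖p.eval z‖ ≤ M * ‖q.eval z‖)
    (hMq : ∀ z ∈ -setE A F Q L, ‖q.eval z‖ ≤ M' * ‖p.eval z‖) :
    max (sigma k (lowerBlock X s)) (sigma k (upperBlock X s))
      ≤ cond F * (1 + √2) ^ 2 * (M * M') * ‖X‖ := by
  have : NeZero n := ⟨(Nat.zero_le s).trans_lt hsn |>.ne'⟩
  obtain ⟨Z, hZ, hZnorm⟩ := exists_rank_le_norm_lowerBlock_sub_le_of_riccati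
    (Matrix.isHermitian_iff_isSymm.1 (posSemidef_transpose_mul_mul hX L).isHermitian)
    (hL.riccati hCARE) (isCompact_setE A F Q L) (convex_setE A F Q L) (nonempty_setE A F Q L)
    (hL.realNumericalRange_closedLoop_subset_setE hX hCARE hW) s hp hq hqE hpE hM hM' hMp hMq
  obtain ⟨W, hWrank, hWnorm⟩ := hL.exists_rank_le_norm_lowerBlock_sub_le X Z
  have hF := rank_lowerBlock_le_qsrank F hs hsn
  have hrank : W.rank ≤ h * (2 * qsrank A + 3 * qsrank F + qsrank Q) + qsrank F := by
    grw [hWrank, hZ, hL.rank_upperBlock_inv_mul_mul_le, hL.rank_lowerBlock_inv_mul_mul_le,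
      hL.rank_lowerBlock_transpose_mul_mul_le, rank_upperBlock_le_qsrank A hs hsn,
      rank_lowerBlock_le_qsrank A hs hsn, rank_lowerBlock_le_qsrank Q hs hsn, hF]
    exact le_of_eq (by ring)
  have hsymm := Matrix.isHermitian_iff_isSymm.1 hX.isHermitian
  refine (QSRiccati.sigma_offDiag_le hsymm (hrank.trans_lt hk)).trans ?_
  have hX' : ‖(lowerBlock (Lᵀ * X * L) s).map Complex.ofReal‖ ≤ ‖F‖ * ‖X‖ :=
    (norm_map_ofReal_submatrix_le _ Subtype.val_injective Subtype.val_injective).trans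
      (hL.norm_transpose_mul_mul_le X)
  calc ‖(lowerBlock X s).map Complex.ofReal - W‖
      ≤ ‖F⁻¹‖ * ((1 + √2) ^ 2 * (M * M') * (‖F‖ * ‖X‖)) := by
        grw [hWnorm, hZnorm, hX']
    _ = cond F * (1 + √2) ^ 2 * (M * M') * ‖X‖ := by
        rw [cond]
        ring

end Riccati

end QSRiccati

end

open QSRiccati in
theorem corollary2p5_general {n : ℕ} {A F Q X L : Matrix (Fin n) (Fin n) ℝ}
    (hX : X.PosSemidef) (hCARE : Aᵀ * X + X * A - X * F * X + Q = 0) (hL : IsCholeskyFactor L F)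
    (hW : realNumericalRange (L⁻¹ * A * L) ⊆ {z : ℂ | z.re ≤ 0}) {s : ℕ} (hs : 1 ≤ s)
    (hsn : s < n) {h k : ℕ} (hk : h * (2 * qsrank A + 3 * qsrank F + qsrank Q) + qsrank F < k) :
    sigma k (lowerBlock X s) / ‖X‖
        ≤ cond F * (1 + √2) ^ 2 * zolotarev h (setE A F Q L) (-setE A F Q L) ∧
      sigma k (upperBlock X s) / ‖X‖
        ≤ cond F * (1 + √2) ^ 2 * zolotarev h (setE A F Q L) (-setE A F Q L) := by
  have hE := isCompact_setE A F Q L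
  have hc : 0 ≤ cond F * (1 + √2) ^ 2 :=
    mul_nonneg (mul_nonneg (norm_nonneg _) (norm_nonneg _)) (sq_nonneg _)
  have hmax : max (sigma k (lowerBlock X s)) (sigma k (upperBlock X s)) / ‖X‖
      ≤ cond F * (1 + √2) ^ 2 * zolotarev h (setE A F Q L) (-setE A F Q L) := by
    refine le_mul_zolotarev hE hE.neg hc fun p q hp hq hqE hpE =>
      div_le_of_le_mul₀ (norm_nonneg _) (by positivity) ?_
    exact hL.sigma_offDiag_le hX hCARE hW hs hsn hk hp hq hqE hpE
      ENNReal.toReal_nonneg ENNReal.toReal_nonneg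
      (fun z hz => norm_eval_le_iSup_ratModulus_mul hE p hqE hz)
      (fun z hz => norm_eval_le_iSup_ratModulus_mul hE.neg q hpE hz)
  exact ⟨(div_le_div_of_nonneg_right (le_max_left _ _) (norm_nonneg X)).trans hmax,
    (div_le_div_of_nonneg_right (le_max_right _ _) (norm_nonneg X)).trans hmax⟩

theorem corollary2p5 (n : ℕ) (A F Q X L : Matrix (Fin n) (Fin n) ℝ) (ra rf rq : ℕ)
    (hra : QSRiccati.qsrank A = ra) (hrf : QSRiccati.qsrank F = rf)
    (hrq : QSRiccati.qsrank Q = rq)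
    (hA : QSRiccati.realNumericalRange A ⊆ {z : ℂ | z.re < 0})
    (hF : F.PosDef) (hQ : Q.PosSemidef)
    (hX : X.PosSemidef) (hCARE : Aᵀ * X + X * A - X * F * X + Q = 0)
    (hL : QSRiccati.IsCholeskyFactor L F)
    (hW : QSRiccati.realNumericalRange (L⁻¹ * A * L) ⊆ {z : ℂ | z.re < 0}) :
    ∀ h : ℕ, 1 ≤ h → ∀ s : ℕ, 1 ≤ s → s < n →
      QSRiccati.sigma (h * (4 * ra + 6 * rf + 2 * rq) + rf + 1) (QSRiccati.lowerBlock X s) / ‖X‖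
          ≤ QSRiccati.cond F * (1 + Real.sqrt 2) ^ 2 *
            QSRiccati.zolotarev h (QSRiccati.setE A F Q L) (-QSRiccati.setE A F Q L) ∧
      QSRiccati.sigma (h * (4 * ra + 6 * rf + 2 * rq) + rf + 1) (QSRiccati.upperBlock X s) / ‖X‖
          ≤ QSRiccati.cond F * (1 + Real.sqrt 2) ^ 2 *
            QSRiccati.zolotarev h (QSRiccati.setE A F Q L) (-QSRiccati.setE A F Q L) := by
  subst hra hrf hrq
  exact fun h _ s hs hsn => corollary2p5_general hX hCARE hL
    (hW.trans fun z (hz : z.re < 0) => hz.le) hs hsn (Nat.lt_succ_of_le (by gcongr <;> omega))
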